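/- Let $G$ be a finite undirected graph (loops and parallel edges are allowed) which is \emph{triconed}: there are three distinct vertices $0,1,2$ of $G$ such that $1$ and $2$ are adjacent to $0$, no two parallel edges have $0$, $1$ or $2$ as an endpoint, and every other vertex of $G$ is adjacent to at least one of $0,1,2$. (Parallel edges are two distinct edges with the same two distinct endpoints.) Then the $h$-vector of the graphic matroid of $G$ is a pure O-sequence. Here the graphic matroid of $G$ is the matroid on the edge set $E$ of $G$ whose independent sets are the edge sets containing no cycle, so that its bases are the spanning trees of $G$. Fix any total order on $E$. An element $i$ of a base $B$ is \emph{passive} if $(B\setminus\{i\})\cup\{j\}$ is a base for some $j<i$. The $h$-vector is $(h_0,\dots,h_r)$, where $r$ is the rank of the matroid and $h_i$ is the number of bases with exactly $i$ passive elements; it does not depend on the order, and the claim holds for every order. An \emph{order ideal} is a finite set $X$ of monomials in finitely many variables such that every monomial dividing a member of $X$ belongs to $X$; it is \emph{pure} if all its members that are maximal under divisibility have the same degree. That $(h_0,\dots,h_r)$ is a \emph{pure O-sequence} means that there is a pure order ideal $X$ such that, for every $i\ge 0$, the number of monomials of degree $i$ in $X$ is $h_i$ (with $h_i=0$ for $i>r$).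 -/

import Mathlib

/-! Graphs are Mathlib's multigraphs `Graph α β` (vertices in `α`, edges in `β`, loops and parallel
edges allowed). -/

namespace Graph

/-- `G.Joined F x y`: there is a walk from `x` to `y` in `G` that uses only edges from `F`. -/
def Joined {α β : Type*} (G : Graph α β) (F : Set β) : α → α → Prop :=
  Relation.ReflTransGen (fun x y => ∃ e ∈ F, G.IsLink e x y)

/-- The set `F` of edges of `G` contains no cycle: no edge `e ∈ F` has its two ends joined by a walk
in the remaining edges `F \ {e}`. (A loop is a cycle, and so are two parallel edges.) -/
def IsForest {α β : Type*} (G : Graph α β) (F : Set β) : Prop :=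
  F ⊆ G.edgeSet ∧ ∀ e ∈ F, ∀ x y, G.IsLink e x y → ¬ G.Joined (F \ {e}) x y

/-- `G` is connected. -/
def IsConnected {α β : Type*} (G : Graph α β) : Prop :=
  G.vertexSet.Nonempty ∧ ∀ x ∈ G.vertexSet, ∀ y ∈ G.vertexSet, G.Joined G.edgeSet x y

/-- The edge set `T` is (the edge set of) a spanning tree of `G`: it has no cycles, and it connects
all the vertices of `G`. -/
def IsSpanningTree {α β : Type*} (G : Graph α β) (T : Set β) : Prop :=
  G.IsForest T ∧ ∀ x ∈ G.vertexSet, ∀ y ∈ G.vertexSet, G.Joined T x y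

theorem Joined.symm {α β : Type*} {G : Graph α β} {F : Set β} {x y : α}
    (h : G.Joined F x y) : G.Joined F y x := by
  induction h with
  | refl => exact Relation.ReflTransGen.refl
  | tail _ hs ih =>
    obtain ⟨e, he, hl⟩ := hs
    exact Relation.ReflTransGen.head ⟨e, he, hl.symm⟩ ih

theorem Joined.of_link {α β : Type*} {G : Graph α β} {F : Set β} {x y : α} {e : β}
    (he : e ∈ F) (h : G.IsLink e x y) : G.Joined F x y :=
  Relation.ReflTransGen.single ⟨e, he, h⟩

/-- If every edge of `F` has ends joined in `F'`, then joined in `F` implies joined in `F'`. -/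
theorem Joined.lift {α β : Type*} {G : Graph α β} {F F' : Set β} {x y : α}
    (h : G.Joined F x y) (hF : ∀ e ∈ F, ∀ u v, G.IsLink e u v → G.Joined F' u v) :
    G.Joined F' x y := by
  induction h with
  | refl => exact Relation.ReflTransGen.refl
  | tail _ hs ih =>
    obtain ⟨e, he, hl⟩ := hs
    exact ih.trans (hF e he _ _ hl)

theorem Joined.mono {α β : Type*} {G : Graph α β} {F F' : Set β} {x y : α}
    (h : G.Joined F x y) (hF : F ⊆ F') : G.Joined F' x y :=
  h.lift fun _ he _ _ hl => Joined.of_link (hF he) hl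

/-- A walk uses finitely many edges. -/
theorem Joined.exists_finite {α β : Type*} {G : Graph α β} {F : Set β} {x y : α}
    (h : G.Joined F x y) : ∃ F₀ ⊆ F, F₀.Finite ∧ G.Joined F₀ x y := by
  induction h with
  | refl => exact ⟨∅, Set.empty_subset _, Set.finite_empty, Relation.ReflTransGen.refl⟩
  | tail _ hs ih =>
    obtain ⟨e, he, hl⟩ := hs
    obtain ⟨F₀, h0, hfin, hj⟩ := ih
    exact ⟨insert e F₀, Set.insert_subset he h0, hfin.insert e,
      (hj.mono (Set.subset_insert _ _)).trans (Joined.of_link (Set.mem_insert _ _) hl)⟩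

/-- A walk either avoids the edge `e`, or reaches one end of `e` and leaves from the other. -/
theorem Joined.split {α β : Type*} {G : Graph α β} {F : Set β} {x y u v : α} {e : β}
    (he : G.IsLink e u v) (h : G.Joined F x y) :
    G.Joined (F \ {e}) x y ∨ (G.Joined (F \ {e}) x u ∧ G.Joined (F \ {e}) v y) ∨
      (G.Joined (F \ {e}) x v ∧ G.Joined (F \ {e}) u y) := by
  induction h with
  | refl => exact Or.inl Relation.ReflTransGen.refl
  | @tail b c _ hs ih =>
    obtain ⟨f, hf, hl⟩ := hs
    by_cases hfe : f = e
    · subst hfe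
      have hr : ∀ a, G.Joined (F \ {f}) a a := fun a => Relation.ReflTransGen.refl
      rcases he.eq_and_eq_or_eq_and_eq hl with ⟨rfl, rfl⟩ | ⟨rfl, rfl⟩
      · rcases ih with h1 | h1 | h1
        · exact Or.inr (Or.inl ⟨h1, hr _⟩)
        · exact Or.inr (Or.inl ⟨h1.1, hr _⟩)
        · exact Or.inl h1.1
      · rcases ih with h1 | h1 | h1
        · exact Or.inr (Or.inr ⟨h1, hr _⟩)
        · exact Or.inl h1.1
        · exact Or.inr (Or.inr ⟨h1.1, hr _⟩)
    · have hbc : G.Joined (F \ {e}) b c := Joined.of_link ⟨hf, hfe⟩ hl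
      rcases ih with h1 | h1 | h1
      · exact Or.inl (h1.trans hbc)
      · exact Or.inr (Or.inl ⟨h1.1, h1.2.trans hbc⟩)
      · exact Or.inr (Or.inr ⟨h1.1, h1.2.trans hbc⟩)

theorem IsForest.subset {α β : Type*} {G : Graph α β} {I J : Set β} (hJ : G.IsForest J)
    (hIJ : I ⊆ J) : G.IsForest I :=
  ⟨hIJ.trans hJ.1, fun e he x y hl hj => hJ.2 e (hIJ he) x y hl
    (hj.mono (Set.sdiff_subset_sdiff_left hIJ))⟩

/-- Adding an edge that joins two different components of a forest gives a forest. -/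
theorem IsForest.insertEdge {α β : Type*} {G : Graph α β} {I : Set β} (hI : G.IsForest I)
    {e : β} {x y : α} (hl : G.IsLink e x y) (hxy : ¬ G.Joined I x y) :
    G.IsForest (insert e I) := by
  have heI : e ∉ I := fun h => hxy (Joined.of_link h hl)
  refine ⟨Set.insert_subset hl.edge_mem hI.1, fun f hf a b hab hj => ?_⟩
  by_cases hfe : f = e
  · subst hfe
    have hj' : G.Joined I a b := hj.mono (by
      rintro g ⟨hg | hg, hg'⟩
      · exact absurd hg hg'
      · exact hg)
    rcases hl.eq_and_eq_or_eq_and_eq hab with ⟨rfl, rfl⟩ | ⟨rfl, rfl⟩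
    · exact hxy hj'
    · exact hxy hj'.symm
  · have hfI : f ∈ I := hf.resolve_left hfe
    have hsub : (insert e I \ {f}) \ {e} ⊆ I \ {f} := by
      rintro g ⟨⟨hg | hg, hg'⟩, hg''⟩
      · exact absurd hg hg''
      · exact ⟨hg, hg'⟩
    have hsub' : (insert e I \ {f}) \ {e} ⊆ I := hsub.trans Set.sdiff_subset
    have hba : G.Joined I b a := (Joined.of_link hfI hab).symm
    rcases hj.split hl with h1 | ⟨h1, h2⟩ | ⟨h1, h2⟩
    · exact hI.2 f hfI a b hab (h1.mono hsub)
    · exact hxy (((h1.mono hsub').symm.trans hba.symm).trans (h2.mono hsub').symm)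
    · exact hxy (((h2.mono hsub').trans hba).trans (h1.mono hsub'))

/-- A forest all of whose edges have ends joined in `I` has at most as many edges as `I`. -/
theorem IsForest.ncard_le {α β : Type*} {G : Graph α β} {J : Set β} (hJ : G.IsForest J)
    (hJfin : J.Finite) (n : ℕ) : ∀ I : Set β, I.Finite → (J \ I).ncard = n →
      (∀ e ∈ J, ∀ u v, G.IsLink e u v → G.Joined I u v) → J.ncard ≤ I.ncard := by
  induction n with
  | zero =>
    intro I hI hn _
    have h0 : J \ I = ∅ := (Set.ncard_eq_zero hJfin.sdiff).1 hn
    exact Set.ncard_le_ncard (Set.sdiff_eq_empty.1 h0) hI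
  | succ n ih =>
    intro I hI hn hspan
    obtain ⟨f, hfJ, hfI⟩ : (J \ I).Nonempty := by
      rw [← Set.ncard_pos hJfin.sdiff]; omega
    obtain ⟨x, y, hf⟩ := G.exists_isLink_of_mem_edgeSet (hJ.1 hfJ)
    have hfin : {K | K ⊆ I ∧ G.Joined K x y}.Finite :=
      hI.finite_subsets.subset fun K hK => hK.1
    obtain ⟨K, hK⟩ := hfin.exists_minimal ⟨I, subset_rfl, hspan f hfJ x y hf⟩
    obtain ⟨e, heK, heJ⟩ : ∃ e ∈ K, e ∉ J \ {f} := by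
      by_contra! hcon
      exact hJ.2 f hfJ x y hf (hK.prop.2.mono hcon)
    have heI : e ∈ I := hK.prop.1 heK
    have hfe : f ≠ e := by rintro rfl; exact hfI heI
    have heJ' : e ∉ J := fun h => heJ ⟨h, hfe.symm⟩
    have hmin : ¬ G.Joined (K \ {e}) x y := fun h =>
      (hK.le_of_le ⟨Set.sdiff_subset.trans hK.prop.1, h⟩ Set.sdiff_subset heK).2 rfl
    have hsub : K \ {e} ⊆ insert f (I \ {e}) :=
      (Set.sdiff_subset_sdiff_left hK.prop.1).trans (Set.subset_insert _ _)
    have hfj : G.Joined (insert f (I \ {e})) x y := Joined.of_link (Set.mem_insert _ _) hf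
    have hrep : ∀ u v, G.IsLink e u v → G.Joined (insert f (I \ {e})) u v := by
      intro u v huv
      rcases hK.prop.2.split huv with h1 | ⟨h1, h2⟩ | ⟨h1, h2⟩
      · exact absurd h1 hmin
      · exact ((h1.mono hsub).symm.trans hfj).trans (h2.mono hsub).symm
      · exact ((h2.mono hsub).trans hfj.symm).trans (h1.mono hsub)
    have hcard : (insert f (I \ {e})).ncard = I.ncard := by
      rw [Set.ncard_insert_of_notMem (fun h => hfI h.1) hI.sdiff,
        Set.ncard_sdiff_singleton_add_one heI hI]
    rw [← hcard]
    refine ih _ (hI.sdiff.insert f) ?_ fun g hg u v huv => (hspan g hg u v huv).lift ?_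
    · have : J \ insert f (I \ {e}) = (J \ I) \ {f} := by
        ext g
        simp only [Set.mem_sdiff, Set.mem_insert_iff, Set.mem_singleton_iff]
        constructor
        · rintro ⟨h1, h2⟩
          refine ⟨⟨h1, fun h3 => h2 (Or.inr ⟨h3, ?_⟩)⟩, fun h3 => h2 (Or.inl h3)⟩
          rintro rfl; exact heJ' h1
        · rintro ⟨⟨h1, h2⟩, h3⟩
          exact ⟨h1, fun h => h.elim h3 fun h => h2 h.1⟩
      have hfJI : f ∈ J \ I := ⟨hfJ, hfI⟩
      rw [this, Set.ncard_sdiff_singleton_of_mem hfJI, hn]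
      rfl
    · intro g hg u v huv
      by_cases hge : g = e
      · subst hge; exact hrep u v huv
      · exact Joined.of_link (Or.inr ⟨hg, hge⟩) huv

/-- The graphic matroid of `G`: its ground set is the edge set of `G`, and its independent sets are
the sets of edges that contain no cycle. -/
def graphicMatroid {α β : Type*} (G : Graph α β) : Matroid β :=
  (IndepMatroid.ofFinitaryCardAugment G.edgeSet G.IsForest
    ⟨Set.empty_subset _, fun _ he => absurd he (Set.notMem_empty _)⟩
    (fun _ _ hJ hIJ => hJ.subset hIJ)
    (by
      intro I J hI hIfin hJ hJfin hlt
      by_contra! hcon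
      refine absurd (hJ.ncard_le hJfin _ I hIfin rfl fun e he u v huv => ?_) (not_le.2 hlt)
      by_contra hnj
      exact hcon e he (fun heI => hnj (Joined.of_link heI huv)) (hI.insertEdge huv hnj))
    (by
      intro I hI
      refine ⟨fun e he => (hI {e} (by simpa using he) (Set.finite_singleton e)).1 rfl,
        fun e he x y hl hj => ?_⟩
      obtain ⟨F, hFI, hFfin, hF⟩ := hj.exists_finite
      refine (hI (insert e F) (Set.insert_subset he fun g hg => (hFI hg).1)
        (hFfin.insert e)).2 e (Set.mem_insert _ _) x y hl (hF.mono fun g hg => ?_)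
      exact ⟨Or.inr hg, (hFI hg).2⟩)
    (fun _ hI => hI.1)).matroid

theorem graphicMatroid_indep {α β : Type*} (G : Graph α β) (I : Set β) :
    G.graphicMatroid.Indep I ↔ G.IsForest I := Iff.rfl

/-- The bases of the graphic matroid of a connected graph are the spanning trees. -/
theorem graphicMatroid_isBase_iff {α β : Type*} (G : Graph α β) (hG : G.IsConnected) (B : Set β) :
    G.graphicMatroid.IsBase B ↔ G.IsSpanningTree B := by
  rw [Matroid.isBase_iff_maximal_indep]
  constructor
  · intro hB
    refine ⟨hB.prop, fun x hx y hy => (hG.2 x hx y hy).lift fun e _ u v huv => ?_⟩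
    by_contra hnj
    have hins : G.graphicMatroid.Indep (insert e B) := IsForest.insertEdge hB.prop huv hnj
    exact hnj (Joined.of_link (hB.le_of_ge hins (Set.subset_insert _ _) (Set.mem_insert _ _)) huv)
  · rintro ⟨hB, hspan⟩
    refine ⟨hB, fun J (hJ : G.IsForest J) hBJ e he => ?_⟩
    by_contra heB
    obtain ⟨x, y, hl⟩ := G.exists_isLink_of_mem_edgeSet (hJ.1 he)
    refine hJ.2 e he x y hl ((hspan x hl.left_mem y hl.right_mem).mono fun g hg => ?_)
    refine ⟨hBJ hg, ?_⟩
    rintro rfl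
    exact heB hg

/-- A triconed graph: there is a path `c₁ - c₀ - c₂` on three distinct vertices such that no two
parallel edges have one of these three vertices as an end, and every other vertex is adjacent to at
least one of the three. -/
def IsTriconed {α β : Type*} (G : Graph α β) : Prop :=
  ∃ c₀ c₁ c₂ : α, c₀ ≠ c₁ ∧ c₀ ≠ c₂ ∧ c₁ ≠ c₂ ∧
    G.Adj c₀ c₁ ∧ G.Adj c₀ c₂ ∧
    (∀ c, c = c₀ ∨ c = c₁ ∨ c = c₂ → ∀ v, v ≠ c → ∀ e f, G.IsLink e c v → G.IsLink f c v → e = f) ∧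
    (∀ v ∈ G.vertexSet, v ≠ c₀ → v ≠ c₁ → v ≠ c₂ → G.Adj c₀ v ∨ G.Adj c₁ v ∨ G.Adj c₂ v)

end Graph

namespace Matroid

/-- The element `e` of the base `B` is (internally) passive, with respect to the given ordering:
it can be exchanged for a smaller element so that the result is again a base. -/
def IsPassive {β : Type*} [LinearOrder β] (M : Matroid β) (B : Set β) (e : β) : Prop :=
  e ∈ B ∧ ∃ f, f < e ∧ M.IsBase (insert f (B \ {e}))

/-- The `h`-vector of a matroid on a finite ground set: `h i` is the number of bases that have
exactly `i` passive elements (so `h i = 0` if `i` exceeds the rank). -/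
noncomputable def hVector {β : Type*} [LinearOrder β] (M : Matroid β) (i : ℕ) : ℕ :=
  {B : Set β | M.IsBase B ∧ {e | M.IsPassive B e}.ncard = i}.ncard

end Matroid

/-- A monomial in the variables `x₀, …, xₙ₋₁` is given by its exponent vector `Fin n →₀ ℕ`;
divisibility of monomials is the componentwise order `≤`. An order ideal is a finite set of
monomials that contains all divisors of its members. -/
def IsOrderIdeal {n : ℕ} (X : Finset (Fin n →₀ ℕ)) : Prop :=
  ∀ m ∈ X, ∀ m', m' ≤ m → m' ∈ X

/-- All the maximal monomials of `X` (under divisibility) have the same degree. -/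
def IsPureIdeal {n : ℕ} (X : Finset (Fin n →₀ ℕ)) : Prop :=
  ∀ m m', Maximal (fun k => k ∈ X) m → Maximal (fun k => k ∈ X) m' → m.degree = m'.degree

/-- `h` is a pure O-sequence: `h i` counts the monomials of degree `i` in a pure order ideal. -/
def IsPureOSequence (h : ℕ → ℕ) : Prop :=
  ∃ (n : ℕ) (X : Finset (Fin n →₀ ℕ)), IsOrderIdeal X ∧ IsPureIdeal X ∧
    ∀ i, h i = (X.filter (fun m => m.degree = i)).card

/-! The independent sets of a matroid split into Boolean intervals, each running from the passive
part of a base up to that base. Hence the h-polynomial is the sum of `t ^ |I| * (1 - t) ^ (r - |I|)`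
over the independent sets `I` (`Matroid.sum_pow_passive`), and it suffices to find a pure order
ideal with this degree generating function.

A forest of `G` consists of edges `F` between vertices that are not cones, edges `S` from a cone to
another vertex, and edges `B` between cones. For a fixed forest `F`, whether `S` and `B` create a
cycle depends only on how they connect the three cones: inside each component of `F` the edges of
`S` must end at distinct cones, and the resulting partitions of the set of cones must have a join
whose rank is the sum of their ranks. The monoid `Lab` records this (`ConeModel.forest_iff`). In its
algebra `Tri` the sum over `S` and `B` becomes a product over the components of `F` and over the
base edges. With `s = t / (1 - t)`, the ring endomorphism `Tri.theta` absorbs the two base edges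
that are always present and all powers of `1 - t` (`Tri.theta_setGen`, `Tri.total_theta`). What
remains is `t ^ |F|` times the total of a product of factors `markGen`, whose coefficients are
polynomials in the numbers `a 0, a 1, a 2` of cone edges of each colour at the component, and are
nonnegative.

These coefficients are realized by marks on trees. Every vertex that is not a cone is replaced by a
star on its cone edges, coloured by their cones. The admissible marks in a component of a forest
are: at most one edge (label `1`); the two end edges of a path between vertices of different colours
(a label of rank 1); or a triple (label `top`), given by the end edges of a tripod on three colours,
or by the end edges of a path with one more "exit edge" that encodes a vertex on it. The choice of
triples is asymmetric in the colours, because besides `a 0 * a 1 * a 2` triples there must be `a 1 *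
a 2` more. `sum_compMarks` shows that the marks have the generating function `markGen`.

A monomial in the edges of the star graph is admissible if its support, together with the fixed star
edges `N`, is a forest, and the product of the labels of its surplus exponents (the marks) is
nonzero. If the second and third cones are adjacent, one more variable enters, whose powers have
labels `1, x12, top`.

Admissible monomials form an order ideal, because the label of smaller data divides the label of
larger data (`prodLab_dvd`). For purity, every component of a maximal monomial other than an
isolated vertex carries one more mark than the rank of its label, so the degree is a constant plus
the rank of the total label (`Stuck.card_eq`). That rank is the same for all maximal monomials
(`Stuck.rank_eq`): it is 2 with the extra variable, and otherwise it is determined by which colours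
meet in the components of the whole star graph. -/

/-- The partitions of a set of three points, with a zero: the product of two partitions is their
join if the ranks add up, and zero otherwise. -/
inductive Lab : Type
  | zero | one | x01 | x02 | x12 | top
  deriving DecidableEq

namespace Lab

instance : Fintype Lab where
  elems := {zero, one, x01, x02, x12, top}
  complete := by rintro ⟨⟩ <;> decide

/-- The product of labels. -/
def mul : Lab → Lab → Lab
  | one, b => b
  | a, one => a
  | x01, x02 => top
  | x01, x12 => top
  | x02, x01 => top
  | x02, x12 => top
  | x12, x01 => top
  | x12, x02 => top
  | _, _ => zero

instance : Mul Lab := ⟨mul⟩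
instance : One Lab := ⟨one⟩
instance : Zero Lab := ⟨zero⟩

instance : CommMonoidWithZero Lab where
  mul_assoc := by decide
  one_mul := by decide
  mul_one := by decide
  mul_comm := by decide
  zero_mul := by decide
  mul_zero := by decide

/-- The partition that joins `i` and `j` (and zero if `i = j`). -/
def pair (i j : Fin 3) : Lab :=
  if i = j then zero
  else if i ≠ 2 ∧ j ≠ 2 then x01 else if i ≠ 1 ∧ j ≠ 1 then x02 else x12

/-- The equivalence relation of a partition. -/
def rel : Lab → Fin 3 → Fin 3 → Bool
  | zero, _, _ => true
  | one, i, j => i = j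
  | top, _, _ => true
  | x01, i, j => i = j ∨ (i ≠ 2 ∧ j ≠ 2)
  | x02, i, j => i = j ∨ (i ≠ 1 ∧ j ≠ 1)
  | x12, i, j => i = j ∨ (i ≠ 0 ∧ j ≠ 0)

/-- The rank of a partition. -/
def rank : Lab → ℕ
  | zero => 0
  | one => 0
  | top => 2
  | _ => 1

/-- This mirrors the criterion `isForest_insert_iff`: if `l` says which cones are connected, a
connection between `i` and `j` closes no cycle exactly if they are not yet connected. -/
theorem mul_pair_ne_zero : ∀ (l : Lab) (i j : Fin 3), l ≠ 0 → (l * pair i j ≠ 0 ↔ l.rel i j = false) := by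
  decide

/-- The counterpart of `joined_insert_iff` for the three cones; together with `mul_pair_ne_zero` it
drives the inductions in `forest_left` and `forest_iff`. -/
theorem rel_mul_pair : ∀ (l : Lab) (i j a b : Fin 3), l * pair i j ≠ 0 →
    ((l * pair i j).rel a b = true ↔ l.rel a b = true ∨ (l.rel a i = true ∧ l.rel j b = true) ∨
      (l.rel a j = true ∧ l.rel i b = true)) := by
  decide

theorem pair_comm : ∀ i j : Fin 3, pair i j = pair j i := by decide

theorem rank_mul : ∀ a b : Lab, a * b ≠ 0 → (a * b).rank = a.rank + b.rank := by decide

end Lab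

/-- Real linear combinations of the partitions of a set of three points. -/
@[ext] structure Tri where
  -- The coefficients of `one`, `x01`, `x02`, `x12` and `top`; the label `zero` becomes the number
  -- zero.
  r : ℝ
  a : ℝ
  b : ℝ
  c : ℝ
  y : ℝ

namespace Tri

instance : Add Tri := ⟨fun u v => ⟨u.r + v.r, u.a + v.a, u.b + v.b, u.c + v.c, u.y + v.y⟩⟩
instance : Zero Tri := ⟨⟨0, 0, 0, 0, 0⟩⟩
instance : One Tri := ⟨⟨1, 0, 0, 0, 0⟩⟩
instance : Neg Tri := ⟨fun u => ⟨-u.r, -u.a, -u.b, -u.c, -u.y⟩⟩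
instance : Mul Tri := ⟨fun u v => ⟨u.r * v.r, u.r * v.a + u.a * v.r, u.r * v.b + u.b * v.r,
  u.r * v.c + u.c * v.r, u.r * v.y + u.y * v.r + u.a * v.b + u.b * v.a + u.a * v.c + u.c * v.a +
    u.b * v.c + u.c * v.b⟩⟩

@[simp] theorem add_r (u v : Tri) : (u + v).r = u.r + v.r := rfl
@[simp] theorem add_a (u v : Tri) : (u + v).a = u.a + v.a := rfl
@[simp] theorem add_b (u v : Tri) : (u + v).b = u.b + v.b := rfl
@[simp] theorem add_c (u v : Tri) : (u + v).c = u.c + v.c := rfl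
@[simp] theorem add_y (u v : Tri) : (u + v).y = u.y + v.y := rfl
@[simp] theorem mul_r (u v : Tri) : (u * v).r = u.r * v.r := rfl
@[simp] theorem mul_a (u v : Tri) : (u * v).a = u.r * v.a + u.a * v.r := rfl
@[simp] theorem mul_b (u v : Tri) : (u * v).b = u.r * v.b + u.b * v.r := rfl
@[simp] theorem mul_c (u v : Tri) : (u * v).c = u.r * v.c + u.c * v.r := rfl
@[simp] theorem mul_y (u v : Tri) : (u * v).y = u.r * v.y + u.y * v.r + u.a * v.b + u.b * v.a +
  u.a * v.c + u.c * v.a + u.b * v.c + u.c * v.b := rfl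
@[simp] theorem zero_r : (0 : Tri).r = 0 := rfl
@[simp] theorem zero_a : (0 : Tri).a = 0 := rfl
@[simp] theorem zero_b : (0 : Tri).b = 0 := rfl
@[simp] theorem zero_c : (0 : Tri).c = 0 := rfl
@[simp] theorem zero_y : (0 : Tri).y = 0 := rfl
@[simp] theorem one_r : (1 : Tri).r = 1 := rfl
@[simp] theorem one_a : (1 : Tri).a = 0 := rfl
@[simp] theorem one_b : (1 : Tri).b = 0 := rfl
@[simp] theorem one_c : (1 : Tri).c = 0 := rfl
@[simp] theorem one_y : (1 : Tri).y = 0 := rfl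
@[simp] theorem neg_r (u : Tri) : (-u).r = -u.r := rfl
@[simp] theorem neg_a (u : Tri) : (-u).a = -u.a := rfl
@[simp] theorem neg_b (u : Tri) : (-u).b = -u.b := rfl
@[simp] theorem neg_c (u : Tri) : (-u).c = -u.c := rfl
@[simp] theorem neg_y (u : Tri) : (-u).y = -u.y := rfl

instance : CommRing Tri where
  add_assoc u v w := by ext <;> simp <;> ring
  zero_add u := by ext <;> simp
  add_zero u := by ext <;> simp
  add_comm u v := by ext <;> simp <;> ring
  neg_add_cancel u := by ext <;> simp
  mul_assoc u v w := by ext <;> simp <;> ring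
  one_mul u := by ext <;> simp
  mul_one u := by ext <;> simp
  mul_comm u v := by ext <;> simp <;> ring
  left_distrib u v w := by ext <;> simp <;> ring
  right_distrib u v w := by ext <;> simp <;> ring
  zero_mul u := by ext <;> simp
  mul_zero u := by ext <;> simp
  nsmul := nsmulRec
  zsmul := zsmulRec

/-- Real numbers as multiples of the identity. -/
def C : ℝ →+* Tri where
  toFun x := ⟨x, 0, 0, 0, 0⟩
  map_one' := rfl
  map_zero' := rfl
  map_mul' x y := by ext <;> simp
  map_add' x y := by ext <;> simp

@[simp] theorem C_r (x : ℝ) : (C x).r = x := rfl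
@[simp] theorem C_a (x : ℝ) : (C x).a = 0 := rfl
@[simp] theorem C_b (x : ℝ) : (C x).b = 0 := rfl
@[simp] theorem C_c (x : ℝ) : (C x).c = 0 := rfl
@[simp] theorem C_y (x : ℝ) : (C x).y = 0 := rfl

/-- The basis vector of a label. -/
def vec : Lab → Tri
  | .zero => 0
  | .one => 1
  | .x01 => ⟨0, 1, 0, 0, 0⟩
  | .x02 => ⟨0, 0, 1, 0, 0⟩
  | .x12 => ⟨0, 0, 0, 1, 0⟩
  | .top => ⟨0, 0, 0, 0, 1⟩

/-- The basis vectors multiply like the labels. -/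
def ofLab : Lab →* Tri where
  toFun := vec
  map_one' := rfl
  map_mul' l m := by
    change vec (Lab.mul l m) = vec l * vec m
    cases l <;> cases m <;> simp only [Lab.mul, vec] <;> ext <;> simp

/-- The sum of all coefficients. -/
def total : Tri →+ ℝ where
  toFun u := u.r + u.a + u.b + u.c + u.y
  map_zero' := by simp
  map_add' u v := by simp; ring

theorem total_C_mul (x : ℝ) (u : Tri) : total (C x * u) = x * total u := by
  simp [total]; ring

theorem total_ofLab (l : Lab) : total (ofLab l) = if l ≠ 0 then 1 else 0 := by
  change (vec l).r + (vec l).a + (vec l).b + (vec l).c + (vec l).y = if l ≠ Lab.zero then 1 else 0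
  cases l <;> simp [vec]

/-- The substitution that relates forests to weighted forests. -/
def theta (t : ℝ) : Tri →+* Tri where
  -- Rank `k` is scaled by `(1 - t) ^ k`, and `x12` also receives the multiple `t * (1 - t)` of
  -- `top`. The extra term does not spoil multiplicativity, since `top` times anything of positive
  -- rank is zero. Only `x12` is treated this way because the base edges 01 and 02 are always
  -- present.
  toFun u := ⟨u.r, (1 - t) * u.a, (1 - t) * u.b, (1 - t) * u.c,
    (1 - t) ^ 2 * u.y + t * (1 - t) * u.c⟩
  map_one' := by ext <;> simp
  map_zero' := by ext <;> simp
  map_mul' u v := by ext <;> simp <;> ring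
  map_add' u v := by ext <;> simp <;> ring

end Tri

/-! ### The h-polynomial as a sum over independent sets -/

namespace Matroid

variable {β : Type*} [LinearOrder β] {M : Matroid β}

/-- Two bases that contain `I` and have all passive elements in `I` are equal. -/
theorem IsBase.eq_of_passive_subset {I B₁ B₂ : Set β} (hE : M.E.Finite)
    (h₁ : M.IsBase B₁) (h₂ : M.IsBase B₂) (hI₁ : I ⊆ B₁) (hI₂ : I ⊆ B₂)
    (hp₁ : ∀ e, M.IsPassive B₁ e → e ∈ I) (hp₂ : ∀ e, M.IsPassive B₂ e → e ∈ I) : B₁ = B₂ := by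
  by_contra hne
  have key : ∀ {B₁ B₂ : Set β}, M.IsBase B₁ → M.IsBase B₂ → I ⊆ B₂ →
      (∀ e, M.IsPassive B₁ e → e ∈ I) → ∀ e ∈ B₁ \ B₂, ∃ f ∈ B₂ \ B₁, e < f := by
    intro B₁ B₂ h₁ h₂ hI₂ hp₁ e he
    obtain ⟨f, hf, hb⟩ := h₁.exchange h₂ he
    refine ⟨f, hf, ?_⟩
    by_contra hlt
    have hef : f ≠ e := by rintro rfl; exact hf.2 he.1
    exact he.2 (hI₂ (hp₁ e ⟨he.1, f, lt_of_le_of_ne (not_lt.1 hlt) hef, hb⟩))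
  have hfin : ((B₁ \ B₂) ∪ (B₂ \ B₁)).Finite :=
    hE.subset (Set.union_subset (Set.sdiff_subset.trans h₁.subset_ground)
      (Set.sdiff_subset.trans h₂.subset_ground))
  have hnon : ((B₁ \ B₂) ∪ (B₂ \ B₁)).Nonempty := by
    rw [Set.nonempty_iff_ne_empty]
    intro h
    rw [Set.union_empty_iff, Set.sdiff_eq_empty, Set.sdiff_eq_empty] at h
    exact hne (h.1.antisymm h.2)
  -- By `key`, each element of the symmetric difference has a larger one on the other side: an
  -- exchange for a smaller element would make it passive, hence an element of `I` and of both
  -- bases. The largest element contradicts this.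
  obtain ⟨e, he, hmax⟩ := hfin.exists_maximalFor id _ hnon
  rcases he with he | he
  · obtain ⟨f, hf, hlt⟩ := key h₁ h₂ hI₂ hp₁ e he
    exact absurd (hmax (Or.inr hf) hlt.le) (not_le.2 hlt)
  · obtain ⟨f, hf, hlt⟩ := key h₂ h₁ hI₁ hp₂ e he
    exact absurd (hmax (Or.inl hf) hlt.le) (not_le.2 hlt)

/-- Every independent set is contained in a base all of whose further elements are active. -/
theorem Indep.exists_isBase_passive_subset {I : Set β} (hE : M.E.Finite) (hI : M.Indep I) :
    ∃ B, M.IsBase B ∧ I ⊆ B ∧ ∀ e, M.IsPassive B e → e ∈ I := by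
  classical
  -- The weight of an element is its position in the order. A base over `I` of minimal total weight
  -- has no passive element outside `I`, since exchanging it for a smaller element would lower the
  -- weight.
  let w : β → ℕ := fun e => {x ∈ M.E | x < e}.ncard
  have hfin : {B | M.IsBase B ∧ I ⊆ B}.Finite :=
    hE.finite_subsets.subset fun B hB => hB.1.subset_ground
  obtain ⟨B₀, hB₀, hIB₀⟩ := hI.exists_isBase_superset
  obtain ⟨B, ⟨hB, hIB⟩, hmin⟩ := hfin.exists_minimalFor
    (fun B => ∑ᶠ e ∈ B, w e) _ ⟨B₀, hB₀, hIB₀⟩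
  refine ⟨B, hB, hIB, fun e he => ?_⟩
  by_contra heI
  obtain ⟨heB, f, hfe, hb⟩ := he
  have hBfin : B.Finite := hE.subset hB.subset_ground
  have hfB : f ∉ B \ {e} := by
    intro hf
    rw [Set.insert_eq_of_mem hf] at hb
    have := hb.eq_of_subset_isBase hB Set.sdiff_subset
    rw [← this] at heB
    exact heB.2 rfl
  have hfE : f ∈ M.E := hb.subset_ground (Set.mem_insert _ _)
  have hw : w f < w e := by
    apply Set.ncard_lt_ncard
    · refine ⟨fun x hx => ⟨hx.1, hx.2.trans hfe⟩, fun h => ?_⟩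
      exact lt_irrefl f (h ⟨hfE, hfe⟩ : f ∈ M.E ∧ f < f).2
    · exact hE.subset fun x hx => hx.1
  have h1 : ∑ᶠ x ∈ insert f (B \ {e}), w x = w f + ∑ᶠ x ∈ B \ {e}, w x :=
    finsum_mem_insert _ hfB hBfin.sdiff
  have h2 : ∑ᶠ x ∈ B, w x = w e + ∑ᶠ x ∈ B \ {e}, w x := by
    rw [← finsum_mem_insert w (fun h : e ∈ B \ {e} => h.2 rfl) hBfin.sdiff,
      Set.insert_sdiff_singleton,
      Set.insert_eq_of_mem heB]
  have h3 := hmin (j := insert f (B \ {e}))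
    ⟨hb, fun x hx => Or.inr ⟨hIB hx, fun h => heI (h ▸ hx)⟩⟩ (by
      simp only [h1, h2]; omega)
  simp only [h1, h2] at h3
  omega

open Classical in
/-- The independent sets of a finite matroid. -/
noncomputable def finsetIndeps {β : Type*} {M : Matroid β} (hE : M.E.Finite) : Finset (Finset β) :=
  hE.toFinset.powerset.filter fun I : Finset β => M.Indep (I : Set β)

open Classical in
/-- The bases of a finite matroid. -/
noncomputable def finsetBases {β : Type*} {M : Matroid β} (hE : M.E.Finite) : Finset (Finset β) :=
  hE.toFinset.powerset.filter fun I : Finset β => M.IsBase (I : Set β)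

theorem mem_finsetIndeps {β : Type*} {M : Matroid β} {hE : M.E.Finite} {I : Finset β} :
    I ∈ finsetIndeps hE ↔ M.Indep (I : Set β) := by
  classical
  rw [finsetIndeps, Finset.mem_filter, Finset.mem_powerset, and_iff_right_iff_imp]
  exact fun h x hx => hE.mem_toFinset.2 (h.subset_ground hx)

theorem mem_finsetBases {β : Type*} {M : Matroid β} {hE : M.E.Finite} {I : Finset β} :
    I ∈ finsetBases hE ↔ M.IsBase (I : Set β) := by
  classical
  rw [finsetBases, Finset.mem_filter, Finset.mem_powerset, and_iff_right_iff_imp]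
  exact fun h x hx => hE.mem_toFinset.2 (h.subset_ground hx)

open Finset in
/-- The `h`-polynomial in terms of the independent sets. -/
theorem sum_pow_passive (hE : M.E.Finite) (r : ℕ) (hr : ∀ B, M.IsBase B → B.ncard = r) (t : ℝ) :
    ∑ B ∈ finsetBases hE, t ^ {e | M.IsPassive B e}.ncard =
      ∑ I ∈ finsetIndeps hE, t ^ #I * (1 - t) ^ (r - #I) := by
  classical
  let P : Finset β → Finset β := fun B => B.filter fun e => M.IsPassive B e
  have hP : ∀ B : Finset β, {e | M.IsPassive (B : Set β) e} = (P B : Set β) := by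
    intro B; ext e; simp only [P, coe_filter, Set.mem_ofPred_eq]
    exact ⟨fun h => ⟨h.1, h⟩, fun h => h.2⟩
  -- Over the interval from `P B` to `B` the sum is `t ^ #(P B)` times a binomial expansion of `(t +
  -- (1 - t)) ^ n = 1`.
  have hB : ∀ B : Finset β, M.IsBase (B : Set β) →
      ∑ I ∈ Icc (P B) B, t ^ #I * (1 - t) ^ (r - #I) = t ^ #(P B) := by
    intro B hB
    have hPB : P B ⊆ B := filter_subset _ _
    have hBr : #B = r := by rw [← hr B hB, Set.ncard_coe_finset]
    have h1 : Icc (P B) B = (B \ P B).powerset.image (P B ∪ ·) := Icc_eq_image_powerset hPB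
    rw [h1, sum_image]
    · have h2 : ∀ J ∈ (B \ P B).powerset, t ^ #(P B ∪ J) * (1 - t) ^ (r - #(P B ∪ J)) =
          t ^ #(P B) * (t ^ #J * (1 - t) ^ (#(B \ P B) - #J)) := by
        intro J hJ
        have hd : Disjoint (P B) J :=
          disjoint_of_subset_right (mem_powerset.1 hJ) disjoint_sdiff
        rw [card_union_of_disjoint hd, card_sdiff_of_subset hPB, hBr, pow_add, Nat.sub_sub, mul_assoc]
      rw [sum_congr rfl h2, ← mul_sum, sum_pow_mul_eq_add_pow]
      simp
    · intro J hJ K hK hJK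
      have e : ∀ L ∈ (B \ P B).powerset, (P B ∪ L) \ P B = L := by
        intro L hL
        rw [union_sdiff_left, Finset.sdiff_eq_self_iff_disjoint]
        exact disjoint_of_subset_left (mem_powerset.1 hL) sdiff_disjoint
      rw [← e J hJ, ← e K hK]; exact congrArg (· \ P B) hJK
  symm
  -- Each independent set lies in exactly one interval `Icc (P B) B`, by the two preceding lemmas on
  -- bases; then the order of summation is exchanged.
  calc ∑ I ∈ finsetIndeps hE, t ^ #I * (1 - t) ^ (r - #I)
      = ∑ I ∈ finsetIndeps hE,
          ∑ B ∈ finsetBases hE,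
            if I ∈ Icc (P B) B then t ^ #I * (1 - t) ^ (r - #I) else 0 := by
        refine sum_congr rfl fun I hI => ?_
        obtain ⟨B, hB, hIB, hp⟩ := (mem_finsetIndeps.1 hI).exists_isBase_passive_subset hE
        lift B to Finset β using hE.subset hB.subset_ground
        rw [sum_eq_single B]
        · rw [if_pos]
          rw [mem_Icc]
          exact ⟨fun e he => hp e (mem_filter.1 he).2, hIB⟩
        · intro B' hB' hne
          rw [if_neg]
          rw [mem_Icc]
          rintro ⟨h1, h2⟩
          refine hne (coe_injective ?_)
          exact IsBase.eq_of_passive_subset hE (mem_finsetBases.1 hB') hB h2 hIB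
            (fun e he => h1 (mem_filter.2 ⟨he.1, he⟩)) hp
        · intro h; exact absurd (mem_finsetBases.2 hB) h
    _ = ∑ B ∈ finsetBases hE,
          ∑ I ∈ Icc (P B) B, t ^ #I * (1 - t) ^ (r - #I) := by
        rw [sum_comm]
        refine sum_congr rfl fun B hB' => ?_
        rw [mem_finsetBases] at hB'
        rw [← sum_filter]
        refine sum_congr ?_ fun _ _ => rfl
        ext I
        simp only [mem_filter, mem_finsetIndeps, mem_Icc]
        refine ⟨fun h => h.2, fun h => ⟨?_, h⟩⟩
        exact hB'.indep.subset (coe_subset.2 h.2)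
    _ = _ := by
        refine sum_congr rfl fun B hB' => ?_
        rw [hB B (mem_finsetBases.1 hB'), hP, Set.ncard_coe_finset]

/-- A sequence is the `h`-vector if its generating function is the `h`-polynomial. -/
theorem hVector_eq_of_sum (hE : M.E.Finite) (r : ℕ) (hr : ∀ B, M.IsBase B → B.ncard = r)
    {ι : Type*} (X : Finset ι) (deg : ι → ℕ)
    (h : ∀ t : ℝ, 0 < t → t < 1 → ∑ m ∈ X, t ^ deg m =
      ∑ I ∈ finsetIndeps hE, t ^ I.card * (1 - t) ^ (r - I.card))
    (i : ℕ) : M.hVector i = (X.filter fun m => deg m = i).card := by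
  classical
  let S := finsetBases hE
  let d : Finset β → ℕ := fun B => {e | M.IsPassive (B : Set β) e}.ncard
  have hpoly : ∑ B ∈ S, (Polynomial.X : Polynomial ℝ) ^ d B = ∑ m ∈ X, Polynomial.X ^ deg m := by
    -- Agreement on the open interval from 0 to 1 suffices, so the division by `1 - t` used later is
    -- harmless.
    refine Polynomial.eq_of_infinite_eval_eq _ _ ((Set.Ioo_infinite (zero_lt_one' ℝ)).mono ?_)
    rintro t ⟨h0, h1⟩
    simp only [Set.mem_ofPred_eq, Polynomial.eval_finsetSum, Polynomial.eval_pow,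
      Polynomial.eval_X]
    rw [h t h0 h1, ← sum_pow_passive hE r hr t]
  have hc := congrArg (fun p => Polynomial.coeff p i) hpoly
  simp only [Polynomial.finsetSum_coeff, Polynomial.coeff_X_pow, Finset.sum_boole] at hc
  have hc' : (S.filter fun B => i = d B).card = (X.filter fun m => i = deg m).card := by
    exact_mod_cast hc
  have he : {B : Set β | M.IsBase B ∧ {e | M.IsPassive B e}.ncard = i} =
      (fun B : Finset β => (B : Set β)) '' (S.filter fun B => i = d B : Finset (Finset β)) := by
    ext B
    simp only [Set.mem_ofPred_eq, Set.mem_image, Finset.coe_filter, S, d, mem_finsetBases]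
    constructor
    · rintro ⟨hB, hi⟩
      lift B to Finset β using hE.subset hB.subset_ground
      exact ⟨B, ⟨hB, hi.symm⟩, rfl⟩
    · rintro ⟨B, ⟨hB, hi⟩, rfl⟩
      exact ⟨hB, hi.symm⟩
  rw [Matroid.hVector, he, Set.ncard_image_of_injective _ Finset.coe_injective,
    Set.ncard_coe_finset, hc']
  congr 1
  ext m
  simp [eq_comm]

end Matroid

/-! ### Distances in forests -/

namespace Graph

variable {α β : Type*} {G : Graph α β} {F F' : Set β} {x y z u v w : α} {e f g : β}

theorem Joined.rfl' {G : Graph α β} {F : Set β} {x : α} : G.Joined F x x := Relation.ReflTransGen.refl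

theorem Joined.trans {G : Graph α β} {F : Set β} {x y z : α} (h : G.Joined F x y)
    (h' : G.Joined F y z) : G.Joined F x z := Relation.ReflTransGen.trans h h'

theorem joined_insert_iff (hl : G.IsLink e u v) :
    G.Joined (insert e F) x y ↔ G.Joined F x y ∨ (G.Joined F x u ∧ G.Joined F v y) ∨
      (G.Joined F x v ∧ G.Joined F u y) := by
  have hs : insert e F \ {e} ⊆ F := by
    rintro g ⟨hg | hg, hg'⟩
    · exact absurd hg hg'
    · exact hg
  have hs' : F ⊆ insert e F := Set.subset_insert _ _
  have he : G.Joined (insert e F) u v := Joined.of_link (Set.mem_insert _ _) hl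
  constructor
  · intro h
    rcases h.split hl with h | h | h
    · exact Or.inl (h.mono hs)
    · exact Or.inr (Or.inl ⟨h.1.mono hs, h.2.mono hs⟩)
    · exact Or.inr (Or.inr ⟨h.1.mono hs, h.2.mono hs⟩)
  · rintro (h | h | h)
    · exact h.mono hs'
    · exact ((h.1.mono hs').trans he).trans (h.2.mono hs')
    · exact ((h.1.mono hs').trans he.symm).trans (h.2.mono hs')

theorem isForest_insert_iff (hl : G.IsLink e u v) (he : e ∉ F) :
    G.IsForest (insert e F) ↔ G.IsForest F ∧ ¬ G.Joined F u v := by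
  refine ⟨fun h => ⟨h.subset (Set.subset_insert _ _), fun hj => ?_⟩, fun h => h.1.insertEdge hl h.2⟩
  refine h.2 e (Set.mem_insert _ _) u v hl (hj.mono fun g hg => ⟨Or.inr hg, ?_⟩)
  rintro rfl
  exact he hg

theorem isForest_empty : G.IsForest ∅ :=
  ⟨Set.empty_subset _, fun _ he => absurd he (Set.notMem_empty _)⟩

theorem joined_empty : G.Joined ∅ x y ↔ x = y := by
  constructor
  · intro h
    induction h with
    | refl => rfl
    | tail _ h _ => obtain ⟨e, he, _⟩ := h; exact absurd he (Set.notMem_empty _)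
  · rintro rfl; exact Joined.rfl'

theorem IsForest.ne_of_link (hF : G.IsForest F) (he : e ∈ F) (hl : G.IsLink e x y) : x ≠ y := by
  rintro rfl
  exact hF.2 e he _ _ hl Joined.rfl'

/-- A forest has no parallel edges. -/
theorem IsForest.eq_of_link (hF : G.IsForest F) (he : e ∈ F) (hl : G.IsLink e x y) (hf : f ∈ F)
    (hl' : G.IsLink f x y) : e = f := by
  by_contra hne
  exact hF.2 e he _ _ hl (Joined.of_link ⟨hf, fun h => hne h.symm⟩ hl')

/-- The distance function of a forest. -/
structure IsDist (G : Graph α β) (F : Set β) (d : α → α → ℕ) : Prop where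
  self : ∀ x, d x x = 0
  symm : ∀ x y, d x y = d y x
  link : ∀ e ∈ F, ∀ x y, G.IsLink e x y → d x y = 1
  step : ∀ x y, G.Joined F x y → x ≠ y → ∃ e ∈ F, ∃ z, G.IsLink e x z ∧ d z y + 1 = d x y
  -- The four-point condition of a tree metric. With parity it turns arguments about the shape of
  -- subtrees into linear arithmetic for `omega`.
  four : ∀ a b c e, G.Joined F a b → G.Joined F a c → G.Joined F a e →
    d a b + d c e ≤ max (d a c + d b e) (d a e + d b c)
  parity : ∀ a b c, G.Joined F a b → G.Joined F a c → (d a b + d b c + d a c) % 2 = 0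

/-- Induction on the edges: a new edge joins two components, and distances across it are the
distances to its two ends plus one. Four-point condition and parity are checked according to the
side on which each vertex lies. -/
theorem IsForest.exists_isDist (hF : G.IsForest F) (hfin : F.Finite) : ∃ d, G.IsDist F d := by
  classical
  induction F, hfin using Set.Finite.induction_on with
  | empty =>
    refine ⟨fun _ _ => 0, fun _ => rfl, fun _ _ => rfl, fun _ h => absurd h (Set.notMem_empty _),
      fun x y h hne => absurd (joined_empty.1 h) hne, fun _ _ _ _ _ _ _ => by simp,
      fun _ _ _ _ _ => rfl⟩
  | @insert g F hg hfin ih =>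
    obtain ⟨a, b, hl⟩ := G.exists_isLink_of_mem_edgeSet (hF.1 (Set.mem_insert g F))
    obtain ⟨hF0, hab⟩ := (isForest_insert_iff hl hg).1 hF
    obtain ⟨d, hd⟩ := ih hF0
    let d' : α → α → ℕ := fun x y => if G.Joined F x y then d x y else
      if G.Joined F x a ∧ G.Joined F y b then d x a + 1 + d y b else
      if G.Joined F x b ∧ G.Joined F y a then d x b + 1 + d y a else 0
    have d0 : ∀ x y, G.Joined F x y → d' x y = d x y := fun x y h => if_pos h
    have d1 : ∀ x y, G.Joined F x a → G.Joined F y b → d' x y = d x a + 1 + d y b := by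
      intro x y hx hy
      have h : ¬ G.Joined F x y := fun h => hab ((hx.symm.trans h).trans hy)
      simp only [d', if_neg h, if_pos (And.intro hx hy)]
    have d2 : ∀ x y, G.Joined F x b → G.Joined F y a → d' x y = d x b + 1 + d y a := by
      intro x y hx hy
      have h : ¬ G.Joined F x y := fun h => hab ((hy.symm.trans h.symm).trans hx)
      have h' : ¬ (G.Joined F x a ∧ G.Joined F y b) := fun h => hab (h.1.symm.trans hx)
      simp only [d', if_neg h, if_neg h', if_pos (And.intro hx hy)]
    have hj : ∀ x y, G.Joined (insert g F) x y → ¬ (G.Joined F x a ∨ G.Joined F x b) →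
        G.Joined F x y := by
      intro x y h hx
      rcases (joined_insert_iff hl).1 h with h | h | h
      · exact h
      · exact absurd (Or.inl h.1) hx
      · exact absurd (Or.inr h.1) hx
    have hj' : ∀ x y, G.Joined (insert g F) x y → (G.Joined F x a ∨ G.Joined F x b) →
        (G.Joined F y a ∨ G.Joined F y b) := by
      intro x y h hx
      rcases (joined_insert_iff hl).1 h with h | h | h
      · exact hx.imp h.symm.trans h.symm.trans
      · exact Or.inr h.2.symm
      · exact Or.inl h.2.symm
    -- positions relative to the new edge
    obtain ⟨s, hs0, hs1⟩ : ∃ s : α → α, (∀ x, G.Joined F x a → s x = a) ∧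
        (∀ x, G.Joined F x b → s x = b) := by
      refine ⟨fun x => if G.Joined F x a then a else b, fun x h => if_pos h, fun x h => if_neg ?_⟩
      exact fun h' => hab (h'.symm.trans h)
    have hne : a ≠ b := by rintro rfl; exact hab Joined.rfl'
    have hsj : ∀ x, (G.Joined F x a ∨ G.Joined F x b) → (s x = a ∨ s x = b) ∧ G.Joined F x (s x) := by
      rintro x (h | h)
      · rw [hs0 x h]; exact ⟨Or.inl rfl, h⟩
      · rw [hs1 x h]; exact ⟨Or.inr rfl, h⟩
    -- `A x` is the distance from `x` to the end `s x` of the new edge on its own side, so that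
    -- distances across the edge are `A x + 1 + A y`.
    obtain ⟨A, hA⟩ : ∃ A : α → ℕ, ∀ x, A x = d x (s x) := ⟨_, fun _ => rfl⟩
    have dS : ∀ x y, (G.Joined F x a ∨ G.Joined F x b) → (G.Joined F y a ∨ G.Joined F y b) →
        (s x = s y → d' x y = d x y ∧ G.Joined F x y) ∧
        (s x ≠ s y → d' x y = A x + 1 + A y) := by
      intro x y hx hy
      refine ⟨fun h => ?_, fun h => ?_⟩
      · have : G.Joined F x y := by
          have h1 := (hsj x hx).2
          rw [h] at h1
          exact h1.trans (hsj y hy).2.symm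
        exact ⟨d0 x y this, this⟩
      · rcases hx with hx | hx <;> rcases hy with hy | hy
        · exact absurd ((hs0 x hx).trans (hs0 y hy).symm) h
        · rw [d1 x y hx hy, hA, hA, hs0 x hx, hs1 y hy]
        · rw [d2 x y hx hy, hA, hA, hs1 x hx, hs0 y hy]
        · exact absurd ((hs1 x hx).trans (hs1 y hy).symm) h
    have hT : ∀ x y z, G.Joined F x y → G.Joined F x z → d y z ≤ d x y + d x z := by
      intro x y z hy hz
      have h1 := hd.four y z x x (hy.symm.trans hz) hy.symm hy.symm
      have h2 := hd.self x
      have h3 := hd.symm x y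
      have h4 := hd.symm x z
      omega
    have t2 : ∀ x y, (G.Joined F x a ∨ G.Joined F x b) → (G.Joined F y a ∨ G.Joined F y b) →
        s x = s y → d x y ≤ A x + A y ∧ A x ≤ d x y + A y ∧ A y ≤ d x y + A x ∧
          (d x y + A x + A y) % 2 = 0 := by
      intro x y hx hy h
      have h1 := (dS x y hx hy).1 h
      have h2 := (hsj x hx).2
      have h3 := hT (s x) x y h2.symm (h2.symm.trans h1.2)
      have h4 := hT x (s x) y h2 h1.2
      have h5 := hT y (s x) x (h1.2.symm.trans h2) h1.2.symm
      have h6 := hd.parity x y (s x) h1.2 h2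
      have h7 := hd.symm x y
      have h8 := hd.symm x (s x)
      have h9 := hd.symm y (s x)
      rw [hA, hA, ← h]
      omega
    have t3 : ∀ x y z, (G.Joined F x a ∨ G.Joined F x b) → (G.Joined F y a ∨ G.Joined F y b) →
        (G.Joined F z a ∨ G.Joined F z b) → s x = s y → s x = s z →
        d x y + A z ≤ max (d x z + A y) (A x + d y z) ∧
        d x z + A y ≤ max (d x y + A z) (A x + d y z) ∧
        A x + d y z ≤ max (d x z + A y) (d x y + A z) := by
      intro x y z hx hy hz h h'
      have h1 := (dS x y hx hy).1 h
      have h2 := (dS x z hx hz).1 h'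
      have h3 := (hsj x hx).2
      have h4 := hd.four x y z (s x) h1.2 h2.2 h3
      have h5 := hd.four x z y (s x) h2.2 h1.2 h3
      have h6 := hd.four x (s x) y z h3 h1.2 h2.2
      have h7 := hd.symm y z
      have h8 := hd.symm y (s x)
      have h9 := hd.symm z (s x)
      rw [hA, hA, hA, ← h, ← h']
      omega
    refine ⟨d', fun x => ?_, fun x y => ?_, fun e he x y hxy => ?_, fun x y h hne => ?_, ?_, ?_⟩
    · rw [d0 x x Joined.rfl', hd.self]
    · by_cases h : G.Joined F x y
      · rw [d0 x y h, d0 y x h.symm, hd.symm]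
      by_cases h1 : G.Joined F x a ∧ G.Joined F y b
      · rw [d1 x y h1.1 h1.2, d2 y x h1.2 h1.1]; omega
      by_cases h2 : G.Joined F x b ∧ G.Joined F y a
      · rw [d2 x y h2.1 h2.2, d1 y x h2.2 h2.1]; omega
      simp only [d', if_neg h, if_neg h1, if_neg h2, if_neg fun h' => h (Joined.symm h'),
        if_neg fun h' => h1 (And.symm h'), if_neg fun h' => h2 (And.symm h')]
    · rcases he with rfl | he
      · rcases hxy.eq_and_eq_or_eq_and_eq hl with ⟨rfl, rfl⟩ | ⟨rfl, rfl⟩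
        · rw [d1 x y Joined.rfl' Joined.rfl', hd.self, hd.self]
        · rw [d2 x y Joined.rfl' Joined.rfl', hd.self, hd.self]
      · rw [d0 x y (Joined.of_link he hxy), hd.link e he x y hxy]
    · rcases (joined_insert_iff hl).1 h with h | ⟨hx, hy⟩ | ⟨hx, hy⟩
      · obtain ⟨e, he, z, hz, hdz⟩ := hd.step x y h hne
        refine ⟨e, Or.inr he, z, hz, ?_⟩
        rw [d0 x y h, d0 z y ((Joined.of_link he hz).symm.trans h), hdz]
      · by_cases hxa : x = a
        · subst hxa
          refine ⟨g, Or.inl rfl, b, hl, ?_⟩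
          rw [d0 b y hy, d1 x y hx hy.symm, hd.self, hd.symm b y]; omega
        · obtain ⟨e, he, z, hz, hdz⟩ := hd.step x a hx hxa
          refine ⟨e, Or.inr he, z, hz, ?_⟩
          rw [d1 x y hx hy.symm, d1 z y ((Joined.of_link he hz).symm.trans hx) hy.symm]; omega
      · by_cases hxb : x = b
        · subst hxb
          refine ⟨g, Or.inl rfl, a, hl.symm, ?_⟩
          rw [d0 a y hy, d2 x y hx hy.symm, hd.self, hd.symm a y]; omega
        · obtain ⟨e, he, z, hz, hdz⟩ := hd.step x b hx hxb
          refine ⟨e, Or.inr he, z, hz, ?_⟩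
          rw [d2 x y hx hy.symm, d2 z y ((Joined.of_link he hz).symm.trans hx) hy.symm]; omega
    · intro p q r m hq hr hm
      by_cases hp : G.Joined F p a ∨ G.Joined F p b
      · have kq := hj' _ _ hq hp
        have kr := hj' _ _ hr hp
        have km := hj' _ _ hm hp
        have spq := dS p q hp kq
        have spr := dS p r hp kr
        have spm := dS p m hp km
        have sqr := dS q r kq kr
        have sqm := dS q m kq km
        have srm := dS r m kr km
        have tpq := t2 p q hp kq
        have tpr := t2 p r hp kr
        have tpm := t2 p m hp km
        have tqr := t2 q r kq kr
        have tqm := t2 q m kq km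
        have trm := t2 r m kr km
        have t1 := t3 q r m kq kr km
        have t2 := t3 p r m hp kr km
        have t4 := t3 p q m hp kq km
        have t5 := t3 p q r hp kq kr
        have t6 := hd.four p q r m
        obtain ⟨hsp, -⟩ := hsj p hp
        obtain ⟨hsq, -⟩ := hsj q kq
        obtain ⟨hsr, -⟩ := hsj r kr
        obtain ⟨hsm, -⟩ := hsj m km
        clear hsj dS hj hj' d0 d1 d2 hs0 hs1 hA
        -- Sixteen distributions of four vertices over the two sides; in each, the relevant facts
        -- are the four-point condition on at most four vertices of one side, where an end of the
        -- new edge may be one of them.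
        rcases hsp with hsp | hsp <;> rcases hsq with hsq | hsq <;> rcases hsr with hsr | hsr <;>
          rcases hsm with hsm | hsm <;>
          simp only [hsp, hsq, hsr, hsm, hne, hne.symm, ne_eq, not_true_eq_false, not_false_eq_true,
            true_implies, false_implies, and_true, true_and] at * <;>
          simp only [spq, spr, spm, sqr, sqm, srm, true_implies] at * <;> omega
      · have hq' := hj _ _ hq hp
        have hr' := hj _ _ hr hp
        have hm' := hj _ _ hm hp
        rw [d0 p q hq', d0 p r hr', d0 p m hm', d0 r m (hr'.symm.trans hm'),
          d0 q m (hq'.symm.trans hm'), d0 q r (hq'.symm.trans hr')]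
        exact hd.four p q r m hq' hr' hm'
    · intro p q r hq hr
      by_cases hp : G.Joined F p a ∨ G.Joined F p b
      · have kq := hj' _ _ hq hp
        have kr := hj' _ _ hr hp
        have spq := dS p q hp kq
        have spr := dS p r hp kr
        have sqr := dS q r kq kr
        have tpq := t2 p q hp kq
        have tpr := t2 p r hp kr
        have tqr := t2 q r kq kr
        have t6 := hd.parity p q r
        obtain ⟨hsp, -⟩ := hsj p hp
        obtain ⟨hsq, -⟩ := hsj q kq
        obtain ⟨hsr, -⟩ := hsj r kr
        clear hsj dS hj hj' d0 d1 d2 hs0 hs1 hA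
        rcases hsp with hsp | hsp <;> rcases hsq with hsq | hsq <;> rcases hsr with hsr | hsr <;>
          simp only [hsp, hsq, hsr, hne, hne.symm, ne_eq, not_true_eq_false, not_false_eq_true,
            true_implies, false_implies, and_true, true_and] at * <;>
          simp only [spq, spr, sqr, true_implies] at * <;> omega
      · have hq' := hj _ _ hq hp
        have hr' := hj _ _ hr hp
        rw [d0 p q hq', d0 p r hr', d0 q r (hq'.symm.trans hr')]
        exact hd.parity p q r hq' hr'

end Graph

/-! ### First edges of paths, betweenness and exit edges -/

namespace Graph

variable {α β : Type*} {G : Graph α β} {F F' : Set β} {x y z u v w a b : α} {e f g : β}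
  {d : α → α → ℕ}

/-- `e` is the first edge, and `z` the second vertex, of the path from `x` to `y`. -/
def Step (G : Graph α β) (F : Set β) (x y z : α) (e : β) : Prop :=
  e ∈ F ∧ G.IsLink e x z ∧ G.Joined (F \ {e}) z y

/-- `e` is the first edge of the path from `x` to `y`. -/
def First (G : Graph α β) (F : Set β) (x y : α) (e : β) : Prop :=
  ∃ z, G.Step F x y z e

/-- `v` lies on the path from `x` to `y`. -/
def Between (G : Graph α β) (F : Set β) (x v y : α) : Prop :=
  v = x ∨ v = y ∨ ∃ e f, G.First F v x e ∧ G.First F v y f ∧ e ≠ f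

theorem Step.mono (h : G.Step F x y z e) (hF : F ⊆ F') : G.Step F' x y z e :=
  ⟨hF h.1, h.2.1, h.2.2.mono (Set.sdiff_subset_sdiff_left hF)⟩

theorem First.mono (h : G.First F x y e) (hF : F ⊆ F') : G.First F' x y e :=
  h.imp fun _ h => h.mono hF

theorem Between.mono (h : G.Between F x v y) (hF : F ⊆ F') : G.Between F' x v y :=
  h.imp_right fun h => h.imp_right fun ⟨e, f, he, hf, hne⟩ => ⟨e, f, he.mono hF, hf.mono hF, hne⟩

theorem Step.joined (h : G.Step F x y z e) : G.Joined F x y :=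
  (Joined.of_link h.1 h.2.1).trans (h.2.2.mono Set.sdiff_subset)

theorem First.joined (h : G.First F x y e) : G.Joined F x y :=
  let ⟨_, h⟩ := h; h.joined

theorem First.mem (h : G.First F x y e) : e ∈ F := let ⟨_, h⟩ := h; h.1

theorem Step.first (h : G.Step F x y z e) : G.First F x y e := ⟨z, h⟩

namespace IsDist

theorem tri (hd : G.IsDist F d) (hxy : G.Joined F x y) (hxz : G.Joined F x z) :
    d y z ≤ d x y + d x z := by
  have h1 := hd.four y z x x (hxy.symm.trans hxz) hxy.symm hxy.symm
  have h2 := hd.self x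
  have h3 := hd.symm x y
  have h4 := hd.symm x z
  omega

theorem eq_of_zero (hd : G.IsDist F d) (hxy : G.Joined F x y) (h : d x y = 0) : x = y := by
  by_contra hne
  obtain ⟨e, _, z, _, h'⟩ := hd.step x y hxy hne
  omega

/-- Steps towards `y` lower the distance to `y`, so a walk that starts nearer to `y` than `x` never
visits `x`, and hence never crosses the edge `e`. -/
theorem joined_sdiff_of_lt (hd : G.IsDist F d) (hl : G.IsLink e x u)
    (hx : d u y < d x y) (n : ℕ) : ∀ z, d z y ≤ n → d z y < d x y → G.Joined F z y →
    G.Joined (F \ {e}) z y := by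
  induction n with
  | zero =>
    intro z hz _ hj
    rw [hd.eq_of_zero hj (by omega)]
    exact Joined.rfl'
  | succ n ih =>
    intro z hz hlt hj
    by_cases hzy : z = y
    · rw [hzy]; exact Joined.rfl'
    obtain ⟨e', he', w, hl', hw⟩ := hd.step z y hj hzy
    have hw' := ih w (by omega) (by omega) ((Joined.of_link he' hl').symm.trans hj)
    by_cases hee : e' = e
    · subst hee
      rcases hl'.eq_and_eq_or_eq_and_eq hl with ⟨rfl, rfl⟩ | ⟨rfl, rfl⟩
      · omega
      · omega
    · have h1 : G.Joined (F \ {e}) z w := Joined.of_link ⟨he', hee⟩ hl'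
      exact h1.trans hw'

theorem step_of (hd : G.IsDist F d) (he : e ∈ F) (hl : G.IsLink e x z) (hj : G.Joined F x y)
    (h : d z y + 1 = d x y) : G.Step F x y z e :=
  ⟨he, hl, hd.joined_sdiff_of_lt hl (by omega) _ z le_rfl (by omega)
    ((Joined.of_link he hl).symm.trans hj)⟩

/-- By parity the two ends of `e` are not equally far from `y`. If `z` were the farther one, then
`x` would also be joined to `y` without `e`, and the ends of `e` would be joined without `e`. -/
theorem succ_of_step (hd : G.IsDist F d) (hF : G.IsForest F) (h : G.Step F x y z e) :
    d z y + 1 = d x y := by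
  obtain ⟨he, hl, hj⟩ := h
  have hxz := Joined.of_link he hl
  have hzy := hj.mono (Set.sdiff_subset (t := {e}))
  have hxy := hxz.trans hzy
  have h1 := hd.link e he x z hl
  have h2 := hd.parity x z y hxz hxy
  have h3 := hd.tri hxz hxy
  have h4 := hd.tri hxz.symm hzy
  have h5 := hd.symm x z
  by_contra hne
  have h6 := (hd.step_of he hl.symm hzy (by omega)).2.2
  exact hF.2 e he x z hl (h6.trans hj.symm)

theorem exists_step (hd : G.IsDist F d) (hj : G.Joined F x y) (hne : x ≠ y) :
    ∃ z e, G.Step F x y z e := by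
  obtain ⟨e, he, z, hl, h⟩ := hd.step x y hj hne
  exact ⟨z, e, hd.step_of he hl hj h⟩

/-- The neighbour of `x` in direction `y` is unique. -/
theorem eq_of_succ (hd : G.IsDist F d) (hxy : G.Joined F x y) (hu : d x u = 1) (hv : d x v = 1)
    (hju : G.Joined F x u) (hjv : G.Joined F x v)
    (hu' : d u y + 1 = d x y) (hv' : d v y + 1 = d x y) : u = v := by
  refine hd.eq_of_zero (hju.symm.trans hjv) ?_
  have h1 := hd.four u v x y (hju.symm.trans hjv) hju.symm (hju.symm.trans hxy)
  have h2 := hd.symm u x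
  have h3 := hd.symm v x
  omega

theorem step_unique (hd : G.IsDist F d) (hF : G.IsForest F) (h : G.Step F x y z e)
    (h' : G.Step F x y w f) : z = w ∧ e = f := by
  have hzw : z = w := hd.eq_of_succ h.joined (hd.link _ h.1 _ _ h.2.1) (hd.link _ h'.1 _ _ h'.2.1)
    (Joined.of_link h.1 h.2.1) (Joined.of_link h'.1 h'.2.1) (hd.succ_of_step hF h)
    (hd.succ_of_step hF h')
  subst hzw
  exact ⟨rfl, hF.eq_of_link h.1 h.2.1 h'.1 h'.2.1⟩

theorem first_unique (hd : G.IsDist F d) (hF : G.IsForest F) (h : G.First F x y e)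
    (h' : G.First F x y f) : e = f :=
  let ⟨_, h⟩ := h; let ⟨_, h'⟩ := h'; (hd.step_unique hF h h').2

theorem exists_first (hd : G.IsDist F d) (hj : G.Joined F x y) (hne : x ≠ y) :
    ∃ e, G.First F x y e :=
  let ⟨z, e, h⟩ := hd.exists_step hj hne; ⟨e, z, h⟩

theorem ne_of_step (hd : G.IsDist F d) (hF : G.IsForest F) (h : G.Step F x y z e) : x ≠ y := by
  rintro rfl
  have := hd.succ_of_step hF h
  rw [hd.self] at this
  omega

theorem ne_of_first (hd : G.IsDist F d) (hF : G.IsForest F) (h : G.First F x y e) : x ≠ y :=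
  let ⟨_, h⟩ := h; hd.ne_of_step hF h

/-- The definition through first edges is stable under enlarging the forest; the metric form is the
one used in computations. -/
theorem between_iff (hd : G.IsDist F d) (hF : G.IsForest F) (hxv : G.Joined F x v)
    (hxy : G.Joined F x y) : G.Between F x v y ↔ d x v + d v y = d x y := by
  have hvy := hxv.symm.trans hxy
  constructor
  · rintro (rfl | rfl | ⟨e, f, ⟨z, hz⟩, ⟨w, hw⟩, hne⟩)
    · rw [hd.self]; omega
    · rw [hd.self]; omega
    · have hvz := Joined.of_link hz.1 hz.2.1
      have hvw := Joined.of_link hw.1 hw.2.1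
      have h1 := hd.succ_of_step hF hz
      have h2 := hd.succ_of_step hF hw
      have h3 := hd.link _ hz.1 _ _ hz.2.1
      have h4 : d z y + 1 ≠ d v y := fun h =>
        hne (hd.step_unique hF (hd.step_of hz.1 hz.2.1 hvy h) hw).2
      have h5 := hd.tri hvz hvy
      have h6 := hd.tri hvz.symm (hvz.symm.trans hvy)
      have h7 := hd.parity v z y hvz hvy
      have h8 := hd.four v x z y hxv.symm hvz hvy
      have h9 := hd.symm v x
      have h10 := hd.symm x z
      have h11 := hd.tri hxv.symm hvy
      have h12 := hd.symm v z
      omega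
  · intro h
    by_cases h1 : v = x
    · exact Or.inl h1
    by_cases h2 : v = y
    · exact Or.inr (Or.inl h2)
    obtain ⟨z, e, hz⟩ := hd.exists_step hxv.symm h1
    obtain ⟨w, f, hw⟩ := hd.exists_step hvy h2
    refine Or.inr (Or.inr ⟨e, f, hz.first, hw.first, ?_⟩)
    rintro rfl
    have hzw := hz.2.1.right_unique hw.2.1
    subst hzw
    have h3 := hd.succ_of_step hF hz
    have h4 := hd.succ_of_step hF hw
    have hvz := Joined.of_link hz.1 hz.2.1
    have h5 := hd.tri (hvz.symm.trans hxv.symm) (hvz.symm.trans hvy)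
    have h6 := hd.symm x v
    omega

end IsDist

/-- Paths in the larger forest are unique, so if the ends are already joined in the smaller forest,
its path is the same one. -/
theorem Step.restrict (hF' : G.IsForest F') (hfin : F'.Finite) (hFF : F ⊆ F')
    (h : G.Step F' x y z e) (hj : G.Joined F x y) : G.Step F x y z e := by
  obtain ⟨d', hd'⟩ := hF'.exists_isDist hfin
  obtain ⟨d, hd⟩ := (hF'.subset hFF).exists_isDist (hfin.subset hFF)
  obtain ⟨w, f, hw⟩ := hd.exists_step hj (hd'.ne_of_step hF' h)
  obtain ⟨rfl, rfl⟩ := hd'.step_unique hF' h (hw.mono hFF)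
  exact hw

theorem First.restrict (hF' : G.IsForest F') (hfin : F'.Finite) (hFF : F ⊆ F')
    (h : G.First F' x y e) (hj : G.Joined F x y) : G.First F x y e :=
  let ⟨z, h⟩ := h; ⟨z, h.restrict hF' hfin hFF hj⟩

/-- The first edge after `v`, on the path from `v` to `t`, that enters a vertex whose colour is
not `k`. -/
inductive Exit {κ : Type*} (G : Graph α β) (F : Set β) (c : α → κ) (k : κ) (t : α) : α → β → Prop
  | leave {v w : α} {e : β} : G.Step F v t w e → c w ≠ k → Exit G F c k t v e
  | go {v w : α} {e f : β} : G.Step F v t w e → c w = k → Exit G F c k t w f → Exit G F c k t v f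

variable {κ : Type*} {c : α → κ} {k : κ} {t : α}

theorem Exit.mono (h : G.Exit F c k t v e) (hF : F ⊆ F') : G.Exit F' c k t v e := by
  induction h with
  | leave h hc => exact .leave (h.mono hF) hc
  | go h hc _ ih => exact .go (h.mono hF) hc ih

theorem Exit.joined (h : G.Exit F c k t v e) : G.Joined F v t := by
  cases h with
  | leave h _ => exact h.joined
  | go h _ _ => exact h.joined

theorem Exit.restrict (hF' : G.IsForest F') (hfin : F'.Finite) (hFF : F ⊆ F')
    (h : G.Exit F' c k t v e) (hj : G.Joined F v t) : G.Exit F c k t v e := by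
  induction h with
  | leave h hc => exact .leave (h.restrict hF' hfin hFF hj) hc
  | go h hc _ ih =>
    have h' := h.restrict hF' hfin hFF hj
    exact .go h' hc (ih ((Joined.of_link h'.1 h'.2.1).symm.trans hj))

namespace IsDist

/-- The path leaves colour `k` at the latest on arriving at `t`. -/
theorem exists_exit (hd : G.IsDist F d) (hF : G.IsForest F) (ht : c t ≠ k) (n : ℕ) :
    ∀ v, d v t = n → G.Joined F v t → v ≠ t → ∃ e, G.Exit F c k t v e := by
  induction n with
  | zero => exact fun v h hj hne => absurd (hd.eq_of_zero hj h) hne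
  | succ n ih =>
    intro v h hj hne
    obtain ⟨w, e, hw⟩ := hd.exists_step hj hne
    by_cases hc : c w = k
    · have := hd.succ_of_step hF hw
      obtain ⟨f, hf⟩ := ih w (by omega) ((Joined.of_link hw.1 hw.2.1).symm.trans hj)
        (by rintro rfl; exact ht hc)
      exact ⟨f, .go hw hc hf⟩
    · exact ⟨e, .leave hw hc⟩

/-- The exit edge: it is a step of the path, entered through vertices of colour `k` only. -/
theorem exit_spec (hd : G.IsDist F d) (hF : G.IsForest F) (h : G.Exit F c k t v e) :
    ∃ p q, G.Step F p t q e ∧ c q ≠ k ∧ d v p + d p t = d v t ∧ (p = v ∨ c p = k) ∧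
      G.Joined F v p ∧ ∀ w, G.Joined F v w → d v w + d w t = d v t → d q t < d w t →
        w = v ∨ c w = k := by
  induction h with
  | @leave v q e h hc =>
    refine ⟨v, q, h, hc, by rw [hd.self]; omega, Or.inl rfl, Joined.rfl', fun w hj hw hlt => ?_⟩
    have := hd.succ_of_step hF h
    exact Or.inl (hd.eq_of_zero hj (by omega)).symm
  | @go v x e f h hc h' ih =>
    obtain ⟨p, q, hs, hq, hp, hpk, hjp, hall⟩ := ih
    have hvx := Joined.of_link h.1 h.2.1
    have h1 := hd.succ_of_step hF h
    have h2 := hd.link _ h.1 _ _ h.2.1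
    have hvt := h.joined
    have hvp : G.Joined F v p := Relation.ReflTransGen.trans hvx hjp
    have h3 := hd.tri hvx hvp
    have h4 := hd.tri hvx.symm hjp
    have h5 := hd.tri hvp.symm hs.joined
    have h6 := hd.symm v p
    have h7 := hd.symm v x
    refine ⟨p, q, hs, hq, by omega, Or.inr ?_, hvp, fun w hj hw hlt => ?_⟩
    · rcases hpk with rfl | h
      · exact hc
      · exact h
    · by_cases hwv : w = v
      · exact Or.inl hwv
      obtain ⟨y, g, hy⟩ := hd.exists_step hj (Ne.symm hwv)
      have hvy := Joined.of_link hy.1 hy.2.1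
      have h8 := hd.succ_of_step hF hy
      have h9 := hd.tri (hvy.symm.trans hj) (hvy.symm.trans hvt)
      have h10 := hd.tri hvy hvt
      have h11 := hd.link _ hy.1 _ _ hy.2.1
      have h12 := hd.tri hvy.symm (hvy.symm.trans hvt)
      have h13 := hd.symm v y
      have h14 := hd.tri (hj.symm.trans hvy) (hj.symm.trans hvt)
      have h15 := hd.symm w y
      have hyx : y = x := hd.eq_of_succ hvt h11 h2 hvy hvx (by omega) h1
      subst hyx
      rcases hall w (hvx.symm.trans hj) (by omega) hlt with rfl | h
      · exact Or.inr hc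
      · exact Or.inr h

end IsDist

end Graph

theorem Multiset.eq_of_add_singleton_eq_triple {β : Type*} {ρ : Multiset β} {l e f g : β}
    (h : ρ + {l} = {e, f, g}) : ρ = {e, f} ∨ ρ = {e, g} ∨ ρ = {f, g} := by
  have hl : l ∈ ({e, f, g} : Multiset β) := by rw [← h]; simp
  simp only [Multiset.insert_eq_cons, Multiset.mem_cons, Multiset.mem_singleton] at hl
  rcases hl with rfl | rfl | rfl
  · refine Or.inr (Or.inr (add_right_cancel (b := {l}) (h.trans ?_)))
    change l ::ₘ f ::ₘ g ::ₘ 0 = f ::ₘ g ::ₘ l ::ₘ 0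
    rw [Multiset.cons_swap l f, Multiset.cons_swap l g]
  · refine Or.inr (Or.inl (add_right_cancel (b := {l}) (h.trans ?_)))
    change e ::ₘ l ::ₘ g ::ₘ 0 = e ::ₘ g ::ₘ l ::ₘ 0
    rw [Multiset.cons_swap l g]
  · exact Or.inl (add_right_cancel (b := {l}) h)

/-! ### Pairs and triples of marked edges -/

namespace Graph

variable {α β : Type*} {G : Graph α β} {F F' : Set β} {x y z u v w a b s t s' t' u' v' w' : α}
  {e f g : β} {d : α → α → ℕ} {σ τ : Multiset β}

/-- The pair of the first and the last edge of the path from `u` to `v`. -/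
def IsPair (G : Graph α β) (F : Set β) (u v : α) (σ : Multiset β) : Prop :=
  ∃ e f, G.First F u v e ∧ G.First F v u f ∧ σ = {e, f}

/-- The three end edges of the subtree spanned by `u, v, w`, none of which is between the others. -/
def IsTripod (G : Graph α β) (F : Set β) (u v w : α) (σ : Multiset β) : Prop :=
  ∃ e f g, G.First F u v e ∧ G.First F u w e ∧ G.First F v u f ∧ G.First F v w f ∧
    G.First F w u g ∧ G.First F w v g ∧ σ = {e, f, g}

/-- The first and the last edge of the path from `s` to `t`, with the exit edge of `v`. -/
def IsPathTriple (G : Graph α β) (F : Set β) (c : α → Fin 3) (s v t : α) (σ : Multiset β) : Prop :=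
  ∃ e f g, G.First F s t e ∧ G.First F t s f ∧ G.Exit F c (c s) t v g ∧ G.Between F s v t ∧
    σ = {e, f, g}

/-- The admissible colourings of a path with a marked vertex. -/
def GoodPath (c : α → Fin 3) (s v t : α) : Prop :=
  -- The colours of the two ends determine the direction: an end of colour 0 is `t`, and otherwise
  -- `s` has colour 1. The last alternative, with `v = s`, supplies the additional triples, one for
  -- each pair of vertices of colours 1 and 2.
  (c s = 1 ∧ c v = 2 ∧ c t = 0) ∨ (c s = 2 ∧ c v = 1 ∧ c t = 0) ∨
    (c s = 1 ∧ c v = 0 ∧ c t = 2) ∨ (c s = 1 ∧ v = s ∧ c t = 2)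

/-- The admissible triples of edges. -/
def IsTriple (G : Graph α β) (F : Set β) (c : α → Fin 3) (σ : Multiset β) : Prop :=
  (∃ u v w, c u = 0 ∧ c v = 1 ∧ c w = 2 ∧ G.IsTripod F u v w σ) ∨
    ∃ s v t, GoodPath c s v t ∧ G.IsPathTriple F c s v t σ

theorem IsPair.card (h : G.IsPair F u v σ) : Multiset.card σ = 2 := by
  obtain ⟨e, f, -, -, rfl⟩ := h; rfl

theorem IsTripod.card (h : G.IsTripod F u v w σ) : Multiset.card σ = 3 := by
  obtain ⟨e, f, g, -, -, -, -, -, -, rfl⟩ := h; rfl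

theorem IsPathTriple.card {c : α → Fin 3} (h : G.IsPathTriple F c s v t σ) :
    Multiset.card σ = 3 := by
  obtain ⟨e, f, g, -, -, -, -, rfl⟩ := h; rfl

theorem IsTriple.card {c : α → Fin 3} (h : G.IsTriple F c σ) : Multiset.card σ = 3 := by
  obtain ⟨u, v, w, -, -, -, h⟩ | ⟨s, v, t, -, h⟩ := h
  · exact h.card
  · exact h.card

theorem IsPair.symm (h : G.IsPair F u v σ) : G.IsPair F v u σ := by
  obtain ⟨e, f, he, hf, rfl⟩ := h
  exact ⟨f, e, hf, he, Multiset.pair_comm e f⟩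

theorem IsPair.joined (h : G.IsPair F u v σ) : G.Joined F u v := by
  obtain ⟨e, f, he, hf, rfl⟩ := h; exact he.joined

theorem IsPair.mono (h : G.IsPair F u v σ) (hF : F ⊆ F') : G.IsPair F' u v σ := by
  obtain ⟨e, f, he, hf, rfl⟩ := h
  exact ⟨e, f, he.mono hF, hf.mono hF, rfl⟩

theorem IsTriple.mono {c : α → Fin 3} (h : G.IsTriple F c σ) (hF : F ⊆ F') :
    G.IsTriple F' c σ := by
  obtain ⟨u, v, w, hu, hv, hw, e, f, g, h1, h2, h3, h4, h5, h6, h⟩ |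
    ⟨s, v, t, hg, e, f, g, h1, h2, h3, h4, h⟩ := h
  · exact Or.inl ⟨u, v, w, hu, hv, hw, e, f, g, h1.mono hF, h2.mono hF, h3.mono hF, h4.mono hF,
      h5.mono hF, h6.mono hF, h⟩
  · exact Or.inr ⟨s, v, t, hg, e, f, g, h1.mono hF, h2.mono hF, h3.mono hF, h4.mono hF, h⟩

/-- The edges of `σ` lie on the path from `u` to `v`, and include its first and its last edge. -/
def Spans (G : Graph α β) (F : Set β) (d : α → α → ℕ) (u v : α) (σ : Multiset β) : Prop :=
  G.Joined F u v ∧ (∀ e ∈ σ, ∀ x, G.Inc e x → G.Joined F u x ∧ d u x + d x v = d u v) ∧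
    (∃ e ∈ σ, G.Inc e u) ∧ ∃ e ∈ σ, G.Inc e v

namespace IsDist

variable (hd : G.IsDist F d) (hF : G.IsForest F)

include hd

/-- The ends of each path are ends of marked edges, so they lie on the other path; two such paths
have the same pair of ends. Thus the marks determine the path up to direction. -/
theorem spans_unique (h : G.Spans F d u v σ) (h' : G.Spans F d s t σ) :
    (s = u ∧ t = v) ∨ (s = v ∧ t = u) := by
  obtain ⟨huv, h1, ⟨e, he, heu⟩, ⟨f, hf, hfv⟩⟩ := h
  obtain ⟨hst, h1', ⟨e', he', heu'⟩, ⟨f', hf', hfv'⟩⟩ := h'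
  obtain ⟨j1, k1⟩ := h1 e' he' s heu'
  obtain ⟨j2, k2⟩ := h1 f' hf' t hfv'
  obtain ⟨j3, k3⟩ := h1' e he u heu
  obtain ⟨j4, k4⟩ := h1' f hf v hfv
  have h2 := hd.four u v s t huv j1 j2
  have h3 := hd.symm s u
  have h4 := hd.symm t u
  have h5 := hd.symm s v
  have h6 := hd.symm t v
  have h7 : (d u s = 0 ∧ d v t = 0) ∨ (d v s = 0 ∧ d u t = 0) := by omega
  rcases h7 with ⟨h7, h8⟩ | ⟨h7, h8⟩
  · exact Or.inl ⟨(hd.eq_of_zero j1 h7).symm, (hd.eq_of_zero (huv.symm.trans j2) h8).symm⟩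
  · exact Or.inr ⟨(hd.eq_of_zero (huv.symm.trans j1) h7).symm, (hd.eq_of_zero j2 h8).symm⟩

include hF

theorem first_on_path (h : G.First F u v e) (hx : G.Inc e x) :
    G.Joined F u x ∧ d u x + d x v = d u v := by
  obtain ⟨z, hz⟩ := h
  obtain ⟨y, hy⟩ := hx
  have h1 := hd.succ_of_step hF hz
  have h2 := hd.link _ hz.1 _ _ hz.2.1
  have h3 := hd.self u
  rcases hy.eq_and_eq_or_eq_and_eq hz.2.1 with ⟨rfl, rfl⟩ | ⟨rfl, rfl⟩
  · exact ⟨Joined.rfl', by omega⟩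
  · exact ⟨Joined.of_link hz.1 hz.2.1, by omega⟩

theorem last_on_path (h : G.First F v u e) (hx : G.Inc e x) :
    G.Joined F u x ∧ d u x + d x v = d u v := by
  obtain ⟨h1, h2⟩ := hd.first_on_path hF h hx
  refine ⟨h.joined.symm.trans h1, ?_⟩
  rw [hd.symm u x, hd.symm u v, hd.symm x v]; omega

theorem pair_spans (h : G.IsPair F u v σ) : G.Spans F d u v σ := by
  obtain ⟨e, f, he, hf, rfl⟩ := h
  refine ⟨he.joined, fun g hg x hx => ?_, ⟨e, by simp, he.imp fun _ h => h.2.1⟩,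
    ⟨f, by simp, hf.imp fun _ h => h.2.1⟩⟩
  rcases Multiset.mem_cons.1 hg with rfl | hg
  · exact hd.first_on_path hF he hx
  · rw [Multiset.mem_singleton.1 hg] at hx
    exact hd.last_on_path hF hf hx

theorem pair_inj (h : G.IsPair F u v σ) (h' : G.IsPair F s t σ) :
    (s = u ∧ t = v) ∨ (s = v ∧ t = u) :=
  hd.spans_unique (hd.pair_spans hF h) (hd.pair_spans hF h')

theorem pair_unique (h : G.IsPair F u v σ) (h' : G.IsPair F u v τ) : σ = τ := by
  obtain ⟨e, f, he, hf, rfl⟩ := h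
  obtain ⟨e', f', he', hf', rfl⟩ := h'
  rw [hd.first_unique hF he he', hd.first_unique hF hf hf']

theorem exists_pair (hj : G.Joined F u v) (hne : u ≠ v) : ∃ σ, G.IsPair F u v σ := by
  obtain ⟨e, he⟩ := hd.exists_first hj hne
  obtain ⟨f, hf⟩ := hd.exists_first hj.symm hne.symm
  exact ⟨_, e, f, he, hf, rfl⟩

/-- Points of the path from `s` to `t` are linearly ordered. -/
theorem dist_on_path (hst : G.Joined F s t) (hx : G.Joined F s x) (hy : G.Joined F s y)
    (hx' : d s x + d x t = d s t) (hy' : d s y + d y t = d s t) :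
    d s x + d x y = d s y ∨ d s y + d x y = d s x := by
  have h1 := hd.four s t x y hst hx hy
  have h2 := hd.symm t x
  have h3 := hd.symm t y
  have h4 := hd.tri hx hy
  have h5 := hd.tri hx.symm (hx.symm.trans hy)
  have h6 := hd.tri hy.symm (hy.symm.trans hx)
  have h7 := hd.symm s x
  have h8 := hd.symm s y
  have h9 := hd.symm y x
  omega

theorem exit_on_path {c : α → Fin 3} {k : Fin 3} (hsv : G.Joined F s v) (hst : G.Joined F s t)
    (hv : d s v + d v t = d s t) (h : G.Exit F c k t v g) (hx : G.Inc g x) :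
    G.Joined F s x ∧ d s x + d x t = d s t := by
  obtain ⟨p, q, hs, hq, hp, hpk, hjp, hall⟩ := hd.exit_spec hF h
  have h1 : ∀ x, G.Joined F v x → d v x + d x t = d v t → G.Joined F s x ∧
      d s x + d x t = d s t := by
    intro x hx h
    refine ⟨hsv.trans hx, ?_⟩
    have h1 := hd.tri hsv.symm hx
    have h2 := hd.tri (hsv.trans hx).symm (hx.symm.trans (hsv.symm.trans hst))
    have h3 := hd.symm s v
    have h4 := hd.symm s x
    omega
  have h2 := hd.succ_of_step hF hs
  have h3 := hd.link _ hs.1 _ _ hs.2.1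
  have hpq := Joined.of_link hs.1 hs.2.1
  have hvt := hsv.symm.trans hst
  have h4 := hd.tri hjp.symm hpq
  have h5 := hd.tri (hjp.trans hpq).symm ((hjp.trans hpq).symm.trans hvt)
  have h6 := hd.symm v p
  have h7 := hd.symm v q
  obtain ⟨y, hy⟩ := hx
  rcases hy.eq_and_eq_or_eq_and_eq hs.2.1 with ⟨rfl, rfl⟩ | ⟨rfl, rfl⟩
  · exact h1 _ hjp hp
  · exact h1 _ (hjp.trans hpq) (by omega)

theorem pathTriple_spans {c : α → Fin 3} (h : G.IsPathTriple F c s v t σ) :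
    G.Spans F d s t σ := by
  obtain ⟨e, f, g, he, hf, hg, hb, rfl⟩ := h
  have hst := he.joined
  have hsv : G.Joined F s v := hst.trans hg.joined.symm
  have hb' := (hd.between_iff hF hsv hst).1 hb
  refine ⟨hst, fun k hk x hx => ?_, ⟨e, by simp, he.imp fun _ h => h.2.1⟩,
    ⟨f, by simp, hf.imp fun _ h => h.2.1⟩⟩
  simp only [Multiset.insert_eq_cons, Multiset.mem_cons, Multiset.mem_singleton] at hk
  rcases hk with rfl | rfl | rfl
  · exact hd.first_on_path hF he hx
  · exact hd.last_on_path hF hf hx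
  · exact hd.exit_on_path hF hsv hst hb' hg hx

/-- Suppose that `w` is at least as near to `t` as `v`. On its way from `v` to the common exit edge
the path passes through `w`, so `w = v` or `w` has colour `c s`. In the second case `w = s` by
assumption, and as `v` is no farther from `s`, again `v = w`. -/
theorem exit_inj {c : α → Fin 3} (hst : G.Joined F s t)
    (hsv : G.Joined F s v) (hsw : G.Joined F s w)
    (hv : d s v + d v t = d s t) (hw : d s w + d w t = d s t) (hcv : c v = c s → v = s)
    (hcw : c w = c s → w = s)
    (h : G.Exit F c (c s) t v g) (h' : G.Exit F c (c s) t w g) : v = w := by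
  obtain ⟨p, q, hs, hq, hp, hpk, hjp, hall⟩ := hd.exit_spec hF h
  obtain ⟨p', q', hs', hq', hp', hpk', hjp', hall'⟩ := hd.exit_spec hF h'
  have h1 := hd.succ_of_step hF hs
  have h2 := hd.succ_of_step hF hs'
  have hpp : p = p' ∧ q = q' := by
    rcases hs.2.1.eq_and_eq_or_eq_and_eq hs'.2.1 with h | ⟨rfl, rfl⟩
    · exact h
    · omega
  obtain ⟨rfl, rfl⟩ := hpp
  have hvw := hsv.symm.trans hsw
  have h3 := hd.dist_on_path hF hst hsv hsw hv hw
  have h4 := hd.symm v w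
  have h5 := hd.self s
  rcases le_total (d w t) (d v t) with h6 | h6
  · rcases hall w hvw (by omega) (by omega) with h | h
    · exact h.symm
    · have h7 := hcw h
      have : d s w = 0 := by rw [h7, hd.self]
      exact hd.eq_of_zero hvw (by omega)
  · rcases hall' v hvw.symm (by omega) (by omega) with h | h
    · exact h
    · have h7 := hcv h
      have : d s v = 0 := by rw [h7, hd.self]
      exact hd.eq_of_zero hvw (by omega)

/-- The path is recovered from its marks up to direction, the direction from the colours of its
ends, and `v` from its exit edge. Since the multisets agree and so do the two end edges, the third
edges agree, even if they coincide with an end edge. -/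
theorem pathTriple_inj {c : α → Fin 3} (h : G.IsPathTriple F c s v t σ) (hg : GoodPath c s v t)
    (h' : G.IsPathTriple F c s' v' t' σ) (hg' : GoodPath c s' v' t') :
    s = s' ∧ v = v' ∧ t = t' := by
  have hst : s' = s ∧ t' = t := by
    rcases hd.spans_unique (hd.pathTriple_spans hF h) (hd.pathTriple_spans hF h') with h | ⟨h1, h2⟩
    · exact h
    · rw [h1, h2] at hg'
      exfalso
      rcases hg with h | h | h | h <;> rcases hg' with h' | h' | h' | h' <;>
        simp_all
  obtain ⟨rfl, rfl⟩ := hst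
  refine ⟨rfl, ?_, rfl⟩
  obtain ⟨e, f, g, he, hf, hx, hb, rfl⟩ := h
  obtain ⟨e', f', g', he', hf', hx', hb', heq⟩ := h'
  rw [hd.first_unique hF he he', hd.first_unique hF hf hf'] at heq
  simp only [Multiset.insert_eq_cons, Multiset.cons_inj_right, Multiset.singleton_inj] at heq
  subst heq
  have hst := he.joined
  have hsv := hst.trans hx.joined.symm
  have hsv' := hst.trans hx'.joined.symm
  refine hd.exit_inj hF hst hsv hsv' ((hd.between_iff hF hsv hst).1 hb)
    ((hd.between_iff hF hsv' hst).1 hb') ?_ ?_ hx hx'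
  · intro h
    rcases hg with h' | h' | h' | h' <;> simp_all
  · intro h
    rcases hg' with h' | h' | h' | h' <;> simp_all

/-- The two paths from `v` share their first edge, so the detour through `v` wastes that edge twice.
-/
theorem lt_of_first (h : G.First F v u f) (h' : G.First F v w f) : d u w + 2 ≤ d v u + d v w := by
  obtain ⟨z, hz⟩ := h
  obtain ⟨y, hy⟩ := h'
  have := hz.2.1.right_unique hy.2.1
  subst this
  have h1 := hd.succ_of_step hF hz
  have h2 := hd.succ_of_step hF hy
  have hvz := Joined.of_link hz.1 hz.2.1
  have h3 := hd.tri (hvz.symm.trans hz.joined) (hvz.symm.trans hy.joined)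
  omega

/-- Of three vertices on a path one is between the other two, while in a tripod all triangle
inequalities are strict. -/
theorem tripod_not_spans (h : G.IsTripod F u v w σ) : ¬ G.Spans F d s t σ := by
  rintro ⟨hst, hs, -, -⟩
  obtain ⟨e, f, g, h1, h2, h3, h4, h5, h6, rfl⟩ := h
  obtain ⟨ju, ku⟩ := hs e (by simp) u (h1.imp fun _ h => h.2.1)
  obtain ⟨jv, kv⟩ := hs f (by simp) v (h3.imp fun _ h => h.2.1)
  obtain ⟨jw, kw⟩ := hs g (by simp) w (h5.imp fun _ h => h.2.1)
  have l1 := hd.lt_of_first hF h1 h2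
  have l2 := hd.lt_of_first hF h3 h4
  have l3 := hd.lt_of_first hF h5 h6
  have m1 := hd.dist_on_path hF hst ju jv ku kv
  have m2 := hd.dist_on_path hF hst ju jw ku kw
  have m3 := hd.dist_on_path hF hst jv jw kv kw
  have n1 := hd.symm u v
  have n2 := hd.symm u w
  have n3 := hd.symm v w
  omega

theorem tripod_inj (h : G.IsTripod F u v w σ) (h' : G.IsTripod F u' v' w' σ) :
    (u' = u ∨ u' = v ∨ u' = w) ∧ (v' = u ∨ v' = v ∨ v' = w) ∧ (w' = u ∨ w' = v ∨ w' = w) := by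
  obtain ⟨e, f, g, h1, h2, h3, h4, h5, h6, rfl⟩ := h
  obtain ⟨e', f', g', h1', h2', h3', h4', h5', h6', heq⟩ := h'
  -- Any two of the three edges of a tripod are the end edges of a path, and a pair of end edges
  -- determines the ends.
  have key : ∀ a b k k' l, G.First F a b k → G.First F b a k' → ({k, k', l} : Multiset β) = {e, f, g} →
      (a = u ∨ a = v ∨ a = w) ∧ (b = u ∨ b = v ∨ b = w) := by
    intro a b k k' l ha hb heq
    have hp : G.IsPair F a b {k, k'} := ⟨k, k', ha, hb, rfl⟩
    rcases Multiset.eq_of_add_singleton_eq_triple (ρ := {k, k'}) (l := l) heq with h | h | h <;>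
      rw [h] at hp
    · rcases hd.pair_inj hF ⟨e, f, h1, h3, rfl⟩ hp with ⟨rfl, rfl⟩ | ⟨rfl, rfl⟩ <;> simp
    · rcases hd.pair_inj hF ⟨e, g, h2, h5, rfl⟩ hp with ⟨rfl, rfl⟩ | ⟨rfl, rfl⟩ <;> simp
    · rcases hd.pair_inj hF ⟨f, g, h4, h6, rfl⟩ hp with ⟨rfl, rfl⟩ | ⟨rfl, rfl⟩ <;> simp
  obtain ⟨k1, k2⟩ := key u' v' e' f' g' h1' h3' heq.symm
  obtain ⟨-, k3⟩ := key u' w' e' g' f' h2' h5' (by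
    rw [heq]
    change e' ::ₘ g' ::ₘ f' ::ₘ 0 = e' ::ₘ f' ::ₘ g' ::ₘ 0
    rw [Multiset.cons_swap g' f'])
  exact ⟨k1, k2, k3⟩

end IsDist

end Graph

/-! ### Labels of the marks in a component -/

namespace Graph

variable {α β : Type*} {G : Graph α β} {F F' : Set β} {x y z u v w a b s t s' t' u' v' w' : α}
  {e f g : β} {d : α → α → ℕ} {σ τ ρ : Multiset β} {c : α → Fin 3} {l l' : Lab}

namespace IsDist

variable (hd : G.IsDist F d) (hF : G.IsForest F)

include hd hF

theorem first_of_on_path (h : G.First F s t e) (hq : G.Joined F s x) (hx : d s x + d x t = d s t)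
    (hne : x ≠ s) : G.First F s x e := by
  obtain ⟨z, hz⟩ := h
  have h1 := hd.succ_of_step hF hz
  have h2 := hd.link _ hz.1 _ _ hz.2.1
  have hsz := Joined.of_link hz.1 hz.2.1
  have h3 := hd.dist_on_path hF hz.joined hsz hq (by omega) hx
  have h4 : d s x ≠ 0 := fun h => hne (hd.eq_of_zero hq h).symm
  exact ⟨z, hd.step_of hz.1 hz.2.1 hq (by omega)⟩

/-- Each pair inside a triple consists of the end edges of a bicoloured path. This is clear for a
tripod. For a path triple with exit edge `p q`, the three pairs belong to `s, t`, to `s, q` and to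
`t, p`. Here `q` does not have colour `c s` by definition of the exit edge, while `p` has colour `c
s` or is `v`, and neither is the colour of `t`. This is the reason for defining exits through the
colour of `s`. -/
theorem pair_of_le_triple (h : G.IsTriple F c σ) (hρ : ρ ≤ σ) (hc : Multiset.card ρ = 2) :
    ∃ a b, G.IsPair F a b ρ ∧ c a ≠ c b := by
  obtain ⟨l, hl⟩ : ∃ l, ρ + {l} = σ := by
    obtain ⟨κ, rfl⟩ := Multiset.le_iff_exists_add.1 hρ
    have h3 := h.card
    rw [Multiset.card_add, hc] at h3
    obtain ⟨l, rfl⟩ := Multiset.card_eq_one.1 (show Multiset.card κ = 1 by omega)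
    exact ⟨l, rfl⟩
  obtain ⟨u, v, w, hu, hv, hw, e, f, g, h1, h2, h3, h4, h5, h6, rfl⟩ |
    ⟨s, v, t, hg, e, f, g, he, hf, hx, hb, rfl⟩ := h
  · rcases Multiset.eq_of_add_singleton_eq_triple hl with rfl | rfl | rfl
    · exact ⟨u, v, ⟨e, f, h1, h3, rfl⟩, by rw [hu, hv]; decide⟩
    · exact ⟨u, w, ⟨e, g, h2, h5, rfl⟩, by rw [hu, hw]; decide⟩
    · exact ⟨v, w, ⟨f, g, h4, h6, rfl⟩, by rw [hv, hw]; decide⟩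
  · have hst := he.joined
    have hsv := hst.trans hx.joined.symm
    have hbv := (hd.between_iff hF hsv hst).1 hb
    obtain ⟨p, q, hs, hq, hp, hpk, hjp, hall⟩ := hd.exit_spec hF hx
    obtain ⟨jp, kp⟩ := hd.exit_on_path hF hsv hst hbv hx (x := p) ⟨q, hs.2.1⟩
    obtain ⟨jq, kq⟩ := hd.exit_on_path hF hsv hst hbv hx (x := q) ⟨p, hs.2.1.symm⟩
    have h1 := hd.succ_of_step hF hs
    have h2 := hd.link _ hs.1 _ _ hs.2.1
    have hcs : c t ≠ c s := by
      rcases hg with h | h | h | h <;> (obtain ⟨h1, -, h2⟩ := h; rw [h1, h2]; decide)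
    have hcv : c t ≠ c v := by
      rcases hg with h | h | h | h <;> (obtain ⟨h1, h3, h2⟩ := h)
      · rw [h3, h2]; decide
      · rw [h3, h2]; decide
      · rw [h3, h2]; decide
      · rw [h3, h1, h2]; decide
    rcases Multiset.eq_of_add_singleton_eq_triple hl with rfl | rfl | rfl
    · exact ⟨s, t, ⟨e, f, he, hf, rfl⟩, hcs.symm⟩
    · have hqs : q ≠ s := by rintro rfl; exact hq rfl
      refine ⟨s, q, ⟨e, g, hd.first_of_on_path hF he jq kq hqs, ?_, rfl⟩, hq.symm⟩
      refine ⟨p, hd.step_of hs.1 hs.2.1.symm jq.symm ?_⟩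
      have h3 := hd.symm p s
      have h4 := hd.symm q s
      omega
    · have hpt : p ≠ t := hd.ne_of_step hF hs
      have h3 := hd.symm s p
      have h4 := hd.symm p t
      have h5 := hd.symm s t
      refine ⟨t, p, ⟨f, g, hd.first_of_on_path hF hf (hst.symm.trans jp) (by omega) hpt, hs.first,
        rfl⟩, ?_⟩
      rcases hpk with rfl | h
      · exact hcv
      · rwa [h]

end IsDist

/-- The label of a multiset of edges in one component of the forest. -/
inductive HasLab (G : Graph α β) (F : Set β) (c : α → Fin 3) : Multiset β → Lab → Prop
  | one {σ : Multiset β} : Multiset.card σ ≤ 1 → HasLab G F c σ 1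
  | pair {σ : Multiset β} {u v : α} : G.IsPair F u v σ → c u ≠ c v →
      HasLab G F c σ (Lab.pair (c u) (c v))
  | top {σ : Multiset β} : G.IsTriple F c σ → HasLab G F c σ Lab.top

open Classical in
/-- The label of a multiset of edges, zero if it is not admissible. -/
noncomputable def lab (G : Graph α β) (F : Set β) (c : α → Fin 3) (σ : Multiset β) : Lab :=
  if h : ∃ l, G.HasLab F c σ l then h.choose else 0

theorem IsDist.hasLab_unique (hd : G.IsDist F d) (hF : G.IsForest F) (h : G.HasLab F c σ l)
    (h' : G.HasLab F c σ l') : l = l' := by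
  cases h with
  | one h =>
    cases h' with
    | one => rfl
    | pair h' => rw [h'.card] at h; omega
    | top h' => rw [h'.card] at h; omega
  | pair h hc =>
    cases h' with
    | one h' => rw [h.card] at h'; omega
    | pair h' hc' =>
      rcases hd.pair_inj hF h h' with ⟨rfl, rfl⟩ | ⟨rfl, rfl⟩
      · rfl
      · exact Lab.pair_comm _ _
    | top h' => have := h.card; rw [h'.card] at this; omega
  | top h =>
    cases h' with
    | one h' => rw [h.card] at h'; omega
    | pair h' => have := h.card; rw [h'.card] at this; omega
    | top => rfl

theorem Lab.pair_ne_zero : ∀ {i j : Fin 3}, i ≠ j → Lab.pair i j ≠ 0 := by decide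

theorem HasLab.ne_zero (h : G.HasLab F c σ l) : l ≠ 0 := by
  cases h with
  | one => decide
  | pair _ h => exact Lab.pair_ne_zero h
  | top => decide

theorem hasLab_lab (h : G.lab F c σ ≠ 0) : G.HasLab F c σ (G.lab F c σ) := by
  unfold lab at h ⊢
  split_ifs with h'
  · exact h'.choose_spec
  · rw [dif_neg h'] at h; exact absurd rfl h

theorem IsDist.lab_eq (hd : G.IsDist F d) (hF : G.IsForest F) (h : G.HasLab F c σ l) :
    G.lab F c σ = l := by
  have h' : ∃ l, G.HasLab F c σ l := ⟨l, h⟩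
  rw [lab, dif_pos h']
  exact hd.hasLab_unique hF h'.choose_spec h

/-- The rank of the label counts the marks after the first one. -/
theorem HasLab.card (h : G.HasLab F c σ l) : Multiset.card σ = min (Multiset.card σ) 1 + l.rank := by
  cases h with
  | one h => rw [min_eq_left h]; rfl
  | pair h hc =>
    have : ∀ i j : Fin 3, i ≠ j → (Lab.pair i j).rank = 1 := by decide
    rw [this _ _ hc, h.card]; rfl
  | top h => rw [h.card]; rfl

theorem HasLab.mono (h : G.HasLab F c σ l) (hF : F ⊆ F') : G.HasLab F' c σ l := by
  cases h with
  | one h => exact .one h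
  | pair h hc => exact .pair (h.mono hF) hc
  | top h => exact .top (h.mono hF)

/-- The edges of `σ` are in the component of `x`. -/
def InComp (G : Graph α β) (F : Set β) (x : α) (σ : Multiset β) : Prop :=
  ∀ e ∈ σ, e ∈ F ∧ ∃ y, G.Inc e y ∧ G.Joined F x y

theorem InComp.joined (h : G.InComp F x σ) (he : e ∈ σ) (hy : G.Inc e y) : G.Joined F x y := by
  obtain ⟨heF, z, ⟨z', hz⟩, hj⟩ := h e he
  obtain ⟨y', hy⟩ := hy
  rcases hy.eq_and_eq_or_eq_and_eq hz with ⟨rfl, rfl⟩ | ⟨rfl, rfl⟩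
  · exact hj
  · exact hj.trans (Joined.of_link heF hz)

theorem First.inc (h : G.First F u v e) : G.Inc e u := h.imp fun _ h => h.2.1

theorem IsPair.restrict (hF' : G.IsForest F') (hfin : F'.Finite) (hFF : F ⊆ F')
    (h : G.IsPair F' u v σ) (hσ : G.InComp F x σ) : G.IsPair F u v σ ∧ G.Joined F x u := by
  obtain ⟨e, f, he, hf, rfl⟩ := h
  have ju := hσ.joined (by simp) he.inc
  have jv := hσ.joined (by simp) hf.inc
  have juv := ju.symm.trans jv
  exact ⟨⟨e, f, he.restrict hF' hfin hFF juv, hf.restrict hF' hfin hFF juv.symm, rfl⟩, ju⟩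

theorem Between.restrict (hF' : G.IsForest F') (hfin : F'.Finite) (hFF : F ⊆ F')
    (h : G.Between F' x v y) (hx : G.Joined F v x) (hy : G.Joined F v y) :
    G.Between F x v y :=
  h.imp_right fun h => h.imp_right fun ⟨e, f, he, hf, hne⟩ =>
    ⟨e, f, he.restrict hF' hfin hFF hx, hf.restrict hF' hfin hFF hy, hne⟩

/-- A path in the larger forest between vertices of one component stays in the component. -/
theorem joined_of_on_path (hF' : G.IsForest F') (hfin : F'.Finite) (hFF : F ⊆ F')
    (hd : G.IsDist F' d) (n : ℕ) : ∀ s, d s t = n → G.Joined F s t → G.Joined F' s v →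
      d s v + d v t = d s t → G.Joined F s v := by
  induction n with
  | zero =>
    intro s hn hst hsv hv
    rw [hd.eq_of_zero hsv (by omega)]; exact Joined.rfl'
  | succ n ih =>
    intro s hn hst hsv hv
    by_cases hvs : v = s
    · rw [hvs]; exact Joined.rfl'
    obtain ⟨e, he⟩ := hd.exists_first (hst.mono hFF) (by
      rintro rfl; rw [hd.self] at hn; omega)
    obtain ⟨z, hz⟩ := hd.first_of_on_path hF' he hsv hv hvs
    obtain ⟨y, hy⟩ := he
    have := hz.2.1.right_unique hy.2.1
    subst this
    have h1 := hd.succ_of_step hF' hz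
    have h2 := hd.succ_of_step hF' hy
    obtain ⟨heF, -, -⟩ := hy.restrict hF' hfin hFF hst
    have hsz := Joined.of_link heF hz.2.1
    exact hsz.trans (ih z (by omega) (hsz.symm.trans hst) ((hsz.symm.mono hFF).trans hsv) (by omega))

/-- The ends of the marked edges lie in one component of the smaller forest. For a path triple the
vertex `v` need not be an end of a marked edge, but it lies on the path between two such vertices.
-/
theorem IsTriple.restrict (hF' : G.IsForest F') (hfin : F'.Finite) (hFF : F ⊆ F')
    (h : G.IsTriple F' c σ) (hσ : G.InComp F x σ) : G.IsTriple F c σ := by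
  obtain ⟨d, hd⟩ := hF'.exists_isDist hfin
  obtain ⟨u, v, w, hu, hv, hw, e, f, g, h1, h2, h3, h4, h5, h6, rfl⟩ |
    ⟨s, v, t, hg, e, f, g, he, hf, hx, hb, rfl⟩ := h
  · have ju := hσ.joined (by simp) h1.inc
    have jv := hσ.joined (by simp) h3.inc
    have jw := hσ.joined (by simp) h5.inc
    have r : ∀ {a b k}, G.Joined F x a → G.Joined F x b → G.First F' a b k → G.First F a b k :=
      fun ha hb h => h.restrict hF' hfin hFF (ha.symm.trans hb)
    exact Or.inl ⟨u, v, w, hu, hv, hw, e, f, g, r ju jv h1, r ju jw h2, r jv ju h3, r jv jw h4,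
      r jw ju h5, r jw jv h6, rfl⟩
  · have js := hσ.joined (by simp) he.inc
    have jt := hσ.joined (by simp) hf.inc
    have jst := js.symm.trans jt
    have hsv := he.joined.trans hx.joined.symm
    have jsv := joined_of_on_path hF' hfin hFF hd _ s rfl jst hsv
      ((hd.between_iff hF' hsv he.joined).1 hb)
    exact Or.inr ⟨s, v, t, hg, e, f, g, he.restrict hF' hfin hFF jst,
      hf.restrict hF' hfin hFF jst.symm, hx.restrict hF' hfin hFF (jsv.symm.trans jst),
      hb.restrict hF' hfin hFF jsv.symm (jsv.symm.trans jst), rfl⟩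

theorem Lab.pair_dvd_top : ∀ {i j : Fin 3}, i ≠ j → ∃ k, Lab.top = Lab.pair i j * k := by decide

/-- Smaller multisets in smaller forests have smaller labels. -/
theorem HasLab.dvd (hF' : G.IsForest F') (hfin : F'.Finite) (hFF : F ⊆ F')
    (h : G.HasLab F' c σ l) (hτ : τ ≤ σ) (hτc : G.InComp F x τ) :
    ∃ l', G.HasLab F c τ l' ∧ l' ∣ l := by
  obtain ⟨d, hd⟩ := hF'.exists_isDist hfin
  by_cases h1 : Multiset.card τ ≤ 1
  · exact ⟨1, .one h1, one_dvd _⟩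
  have hle := Multiset.card_le_card hτ
  cases h with
  | one h => omega
  | pair h hc =>
    have : τ = σ := Multiset.eq_of_le_of_card_le hτ (by rw [h.card]; omega)
    subst this
    exact ⟨_, .pair (h.restrict hF' hfin hFF hτc).1 hc, dvd_rfl⟩
  | top h =>
    by_cases h2 : Multiset.card τ = 2
    · obtain ⟨a, b, hp, hc⟩ := hd.pair_of_le_triple hF' h hτ h2
      exact ⟨_, .pair (hp.restrict hF' hfin hFF hτc).1 hc, Lab.pair_dvd_top hc⟩
    · have h3 := h.card
      have : τ = σ := Multiset.eq_of_le_of_card_le hτ (by omega)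
      subst this
      exact ⟨_, .top (h.restrict hF' hfin hFF hτc), dvd_rfl⟩

end Graph

theorem Finset.card_eq_of_rel {A B : Type*} {S : Finset A} {T : Finset B} (R : A → B → Prop)
    (h1 : ∀ a ∈ S, ∃ b ∈ T, R a b) (h2 : ∀ b ∈ T, ∃ a ∈ S, R a b)
    (h3 : ∀ a ∈ S, ∀ a' ∈ S, ∀ b, R a b → R a' b → a = a')
    (h4 : ∀ a ∈ S, ∀ b b', R a b → R a b' → b = b') : S.card = T.card := by
  choose φ hφ using h1
  refine Finset.card_bij (fun a ha => φ a ha) (fun a ha => (hφ a ha).1) ?_ ?_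
  · intro a ha a' ha' h
    exact h3 a ha a' ha' _ (hφ a ha).2 (by rw [h]; exact (hφ a' ha').2)
  · intro b hb
    obtain ⟨a, ha, hab⟩ := h2 b hb
    exact ⟨a, ha, h4 a ha _ _ (hφ a ha).2 hab⟩

/-! ### Counting pairs and triples by colours -/

namespace Graph

variable {α β : Type*} {G : Graph α β} {F F' : Set β} {x y z u v w a b s t s' t' u' v' w' : α}
  {e f g : β} {d : α → α → ℕ} {σ τ ρ : Multiset β} {c : α → Fin 3} {l l' : Lab}

namespace IsDist

variable (hd : G.IsDist F d) (hF : G.IsForest F)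

include hd hF

theorem exit_unique {k : Fin 3} (h : G.Exit F c k t v e) (h' : G.Exit F c k t v f) : e = f := by
  induction h with
  | leave h hc =>
    cases h' with
    | leave h' hc' => exact (hd.step_unique hF h h').2
    | go h' hc' _ => rw [(hd.step_unique hF h h').1] at hc; exact absurd hc' hc
  | go h hc _ ih =>
    cases h' with
    | leave h' hc' => rw [(hd.step_unique hF h h').1] at hc; exact absurd hc hc'
    | go h' hc' h'' => rw [(hd.step_unique hF h h').1] at ih; exact ih h''

theorem pathTriple_unique (h : G.IsPathTriple F c s v t σ) (h' : G.IsPathTriple F c s v t τ) :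
    σ = τ := by
  obtain ⟨e, f, g, h1, h2, h3, h4, rfl⟩ := h
  obtain ⟨e', f', g', h1', h2', h3', h4', rfl⟩ := h'
  rw [hd.first_unique hF h1 h1', hd.first_unique hF h2 h2', hd.exit_unique hF h3 h3']

theorem tripod_unique (h : G.IsTripod F u v w σ) (h' : G.IsTripod F u v w τ) : σ = τ := by
  obtain ⟨e, f, g, h1, h2, h3, h4, h5, h6, rfl⟩ := h
  obtain ⟨e', f', g', h1', h2', h3', h4', h5', h6', rfl⟩ := h'
  rw [hd.first_unique hF h1 h1', hd.first_unique hF h3 h3', hd.first_unique hF h5 h5']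

theorem pathTriple_dist (h : G.IsPathTriple F c s v t σ) : d s v + d v t = d s t := by
  obtain ⟨e, f, g, h1, h2, h3, h4, rfl⟩ := h
  exact (hd.between_iff hF (h1.joined.trans h3.joined.symm) h1.joined).1 h4

theorem tripod_dist (h : G.IsTripod F u v w σ) :
    d u v < d u w + d w v ∧ d u w < d u v + d v w ∧ d v w < d v u + d u w := by
  obtain ⟨e, f, g, h1, h2, h3, h4, h5, h6, rfl⟩ := h
  have l1 := hd.lt_of_first hF h1 h2
  have l2 := hd.lt_of_first hF h3 h4
  have l3 := hd.lt_of_first hF h5 h6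
  have n1 := hd.symm u v
  have n2 := hd.symm u w
  have n3 := hd.symm v w
  omega

theorem exists_pathTriple (hst : G.Joined F s t) (hc : c t ≠ c s) (hb : G.Between F s v t)
    (hsv : G.Joined F s v) (hvt : v ≠ t) : ∃ σ, G.IsPathTriple F c s v t σ := by
  have hne : s ≠ t := by rintro rfl; exact hc rfl
  obtain ⟨e, he⟩ := hd.exists_first hst hne
  obtain ⟨f, hf⟩ := hd.exists_first hst.symm hne.symm
  obtain ⟨g, hg⟩ := hd.exists_exit (c := c) (k := c s) hF hc _ v rfl (hsv.symm.trans hst) hvt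
  exact ⟨_, e, f, g, he, hf, hg, hb, rfl⟩

theorem exists_tripod (huv : G.Joined F u v) (huw : G.Joined F u w) (h1 : ¬ G.Between F v u w)
    (h2 : ¬ G.Between F w v u) (h3 : ¬ G.Between F v w u) : ∃ σ, G.IsTripod F u v w σ := by
  have hvw := huv.symm.trans huw
  simp only [Between, not_or, not_exists, not_and, not_not] at h1 h2 h3
  obtain ⟨e, he⟩ := hd.exists_first huv h1.1
  obtain ⟨e', he'⟩ := hd.exists_first huw h1.2.1
  obtain ⟨f, hf⟩ := hd.exists_first hvw h2.1
  obtain ⟨f', hf'⟩ := hd.exists_first huv.symm h2.2.1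
  obtain ⟨g, hg⟩ := hd.exists_first hvw.symm h3.1
  obtain ⟨g', hg'⟩ := hd.exists_first huw.symm h3.2.1
  obtain rfl := h1.2.2 _ _ he he'
  obtain rfl := h2.2.2 _ _ hf hf'
  obtain rfl := h3.2.2 _ _ hg hg'
  exact ⟨_, e, f, g, he, he', hf', hf, hg', hg, rfl⟩

end IsDist

/-- The triple of edges that belongs to three vertices of different colours. -/
def TripleRel (G : Graph α β) (F : Set β) (c : α → Fin 3) (u v w : α) (σ : Multiset β) : Prop :=
  G.IsTripod F u v w σ ∨ G.IsPathTriple F c v w u σ ∨ G.IsPathTriple F c w v u σ ∨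
    G.IsPathTriple F c v u w σ

section Counting

variable {C : Finset α} {EC : Finset β} {O : Finset (Multiset β)}

/-- With `x` as root, every other vertex of the tree corresponds to its first edge towards `x`. -/
theorem card_edges_add_one (hF : G.IsForest F) (hfin : F.Finite)
    (hC : ∀ y, y ∈ C ↔ G.Joined F x y)
    (hEC : ∀ e, e ∈ EC ↔ e ∈ F ∧ ∃ y, G.Inc e y ∧ G.Joined F x y) : EC.card + 1 = C.card := by
  classical
  obtain ⟨d, hd⟩ := hF.exists_isDist hfin
  have hx : x ∈ C := (hC x).2 Joined.rfl'
  rw [← Finset.card_erase_add_one hx]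
  congr 1
  refine (Finset.card_eq_of_rel (fun y e => G.First F y x e) ?_ ?_ ?_ ?_).symm
  · intro y hy
    rw [Finset.mem_erase, hC] at hy
    obtain ⟨e, he⟩ := hd.exists_first hy.2.symm hy.1
    exact ⟨e, (hEC e).2 ⟨he.mem, y, he.inc, hy.2⟩, he⟩
  · intro e he
    obtain ⟨heF, y, ⟨z, hl⟩, hj⟩ := (hEC e).1 he
    have h1 := hd.link e heF y z hl
    have hyz := Joined.of_link heF hl
    have h2 := hd.parity y z x hyz hj.symm
    have h3 := hd.tri hyz hj.symm
    have h4 := hd.tri hyz.symm (hyz.symm.trans hj.symm)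
    have h5 := hd.symm y z
    have h6 := hd.self x
    by_cases h : d z x + 1 = d y x
    · refine ⟨y, ?_, z, hd.step_of heF hl hj.symm h⟩
      rw [Finset.mem_erase, hC]
      exact ⟨by rintro rfl; omega, hj⟩
    · refine ⟨z, ?_, y, hd.step_of heF hl.symm (hyz.symm.trans hj.symm) (by omega)⟩
      rw [Finset.mem_erase, hC]
      exact ⟨by rintro rfl; omega, hj.trans hyz⟩
  · rintro y - y' - e ⟨z, h⟩ ⟨z', h'⟩
    have h1 := hd.succ_of_step hF h
    have h2 := hd.succ_of_step hF h'
    rcases h.2.1.eq_and_eq_or_eq_and_eq h'.2.1 with h3 | ⟨rfl, rfl⟩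
    · exact h3.1
    · omega
  · intro y _ e e' h h'
    exact hd.first_unique hF h h'

theorem inComp_of_isPair (h : G.IsPair F u v σ) (hj : G.Joined F x u) : G.InComp F x σ := by
  obtain ⟨e, f, he, hf, rfl⟩ := h
  intro g hg
  rcases Multiset.mem_cons.1 hg with rfl | hg
  · exact ⟨he.mem, u, he.inc, hj⟩
  · rw [Multiset.mem_singleton.1 hg]
    exact ⟨hf.mem, v, hf.inc, hj.trans he.joined⟩

theorem inComp_of_tripod (h : G.IsTripod F u v w σ) (hj : G.Joined F x u) : G.InComp F x σ := by
  obtain ⟨e, f, g, h1, h2, h3, h4, h5, h6, rfl⟩ := h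
  intro k hk
  simp only [Multiset.insert_eq_cons, Multiset.mem_cons, Multiset.mem_singleton] at hk
  rcases hk with rfl | rfl | rfl
  · exact ⟨h1.mem, u, h1.inc, hj⟩
  · exact ⟨h3.mem, v, h3.inc, hj.trans h1.joined⟩
  · exact ⟨h5.mem, w, h5.inc, hj.trans h2.joined⟩

theorem inComp_of_pathTriple (hF : G.IsForest F) (hfin : F.Finite)
    (h : G.IsPathTriple F c s v t σ) (hj : G.Joined F x s) : G.InComp F x σ := by
  obtain ⟨d, hd⟩ := hF.exists_isDist hfin
  have hs := (hd.pathTriple_spans hF h).2.1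
  obtain ⟨e, f, g, h1, h2, h3, h4, rfl⟩ := h
  obtain ⟨p, q, hpq, -⟩ := hd.exit_spec hF h3
  intro k hk
  have hmem := hk
  simp only [Multiset.insert_eq_cons, Multiset.mem_cons, Multiset.mem_singleton] at hk
  rcases hk with rfl | rfl | rfl
  · exact ⟨h1.mem, s, h1.inc, hj⟩
  · exact ⟨h2.mem, t, h2.inc, hj.trans h1.joined⟩
  · exact ⟨hpq.1, p, ⟨q, hpq.2.1⟩, hj.trans (hs _ hmem p ⟨q, hpq.2.1⟩).1⟩

/-- A pair of marks determines its two ends, and as these have different colours they can be ordered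
by colour. The hypothesis `hl` says that the label determines the two colours. -/
theorem card_pairs (hF : G.IsForest F) (hfin : F.Finite) (hC : ∀ y, y ∈ C ↔ G.Joined F x y)
    (hO : ∀ σ, σ ∈ O ↔ G.InComp F x σ ∧ G.lab F c σ ≠ 0) {i j : Fin 3} (hij : i ≠ j)
    (hl : ∀ i' j' : Fin 3, Lab.pair i' j' = Lab.pair i j → i' ≠ j' →
      (i' = i ∧ j' = j) ∨ (i' = j ∧ j' = i)) :
    (O.filter fun σ => G.lab F c σ = Lab.pair i j).card =
      (C.filter fun y => c y = i).card * (C.filter fun y => c y = j).card := by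
  classical
  obtain ⟨d, hd⟩ := hF.exists_isDist hfin
  rw [← Finset.card_product]
  symm
  refine Finset.card_eq_of_rel (fun p σ => G.IsPair F p.1 p.2 σ) ?_ ?_ ?_ ?_
  · rintro ⟨u, v⟩ h
    simp only [Finset.mem_product, Finset.mem_filter, hC] at h
    obtain ⟨⟨hu, rfl⟩, hv, rfl⟩ := h
    obtain ⟨σ, hσ⟩ := hd.exists_pair hF (hu.symm.trans hv) (by rintro rfl; exact hij rfl)
    have := hd.lab_eq hF (.pair hσ hij)
    refine ⟨σ, Finset.mem_filter.2 ⟨(hO σ).2 ⟨inComp_of_isPair hσ hu, ?_⟩, this⟩, hσ⟩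
    rw [this]; exact Lab.pair_ne_zero hij
  · intro σ hσ
    rw [Finset.mem_filter, hO] at hσ
    obtain ⟨⟨hc, hne⟩, he⟩ := hσ
    have h := hasLab_lab hne
    generalize hm : G.lab F c σ = m at h he
    cases h with
    | one h => exact absurd he ((by decide : ∀ i j : Fin 3, (1 : Lab) ≠ Lab.pair i j) i j)
    | @pair u v h hc' =>
      have ju := (h.restrict hF hfin le_rfl hc).2
      have jv := ju.trans h.joined
      rcases hl _ _ he hc' with ⟨h1, h2⟩ | ⟨h1, h2⟩
      · refine ⟨(u, v), ?_, h⟩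
        simp only [Finset.mem_product, Finset.mem_filter, hC]
        exact ⟨⟨ju, h1⟩, jv, h2⟩
      · refine ⟨(v, u), ?_, h.symm⟩
        simp only [Finset.mem_product, Finset.mem_filter, hC]
        exact ⟨⟨jv, h2⟩, ju, h1⟩
    | top h => exact absurd he ((by decide : ∀ i j : Fin 3, Lab.top ≠ Lab.pair i j) i j)
  · rintro ⟨u, v⟩ h ⟨u', v'⟩ h' σ hσ hσ'
    simp only [Finset.mem_product, Finset.mem_filter] at h h'
    rcases hd.pair_inj hF hσ hσ' with ⟨h1, h2⟩ | ⟨h1, h2⟩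
    · exact Prod.ext h1.symm h2.symm
    · refine absurd ?_ hij
      simp only at h1 h2
      rw [← h'.1.2, h1, h.2.2]
  · rintro ⟨u, v⟩ - σ τ h h'
    exact hd.pair_unique hF h h'

/-- The triple of edges that belongs to three vertices of different colours, or to two vertices of
colours `1` and `2`. -/
def TripleRel' (G : Graph α β) (F : Set β) (c : α → Fin 3) :
    (α × α × α) ⊕ (α × α) → Multiset β → Prop
  | .inl q, σ => G.TripleRel F c q.1 q.2.1 q.2.2 σ
  | .inr q, σ => G.IsPathTriple F c q.1 q.1 q.2 σ

open Classical in
/-- The triples of vertices of colours `0, 1, 2` and the pairs of vertices of colours `1, 2`. -/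
noncomputable def colourTriples (c : α → Fin 3) (C : Finset α) :
    Finset ((α × α × α) ⊕ (α × α)) :=
  ((C.filter fun y => c y = 0) ×ˢ ((C.filter fun y => c y = 1) ×ˢ (C.filter fun y => c y = 2))).disjSum
      ((C.filter fun y => c y = 1) ×ˢ (C.filter fun y => c y = 2))

theorem inl_mem_colourTriples : Sum.inl (u, v, w) ∈ colourTriples c C ↔
    (u ∈ C ∧ c u = 0) ∧ (v ∈ C ∧ c v = 1) ∧ w ∈ C ∧ c w = 2 := by
  simp only [colourTriples, Finset.inl_mem_disjSum, Finset.mem_product, Finset.mem_filter]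

theorem inr_mem_colourTriples : Sum.inr (v, w) ∈ colourTriples c C ↔
    (v ∈ C ∧ c v = 1) ∧ w ∈ C ∧ c w = 2 := by
  simp only [colourTriples, Finset.inr_mem_disjSum, Finset.mem_product, Finset.mem_filter]

/-- Of three vertices with different colours either one lies between the other two, and the matching
alternative of `GoodPath` applies, or they form a tripod. A pair of colours 1 and 2 gives the
degenerate path triple with `v = s`. -/
theorem exists_triple (hF : G.IsForest F) (hfin : F.Finite) (hC : ∀ y, y ∈ C ↔ G.Joined F x y)
    (hO : ∀ σ, σ ∈ O ↔ G.InComp F x σ ∧ G.lab F c σ ≠ 0) :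
    ∀ p ∈ colourTriples c C, ∃ σ ∈ O.filter fun σ => G.lab F c σ = Lab.top,
      G.TripleRel' F c p σ := by
  obtain ⟨d, hd⟩ := hF.exists_isDist hfin
  have hmem : ∀ σ, G.InComp F x σ → G.IsTriple F c σ →
      σ ∈ O.filter fun σ => G.lab F c σ = Lab.top := by
    intro σ h h'
    have := hd.lab_eq hF (.top h')
    refine Finset.mem_filter.2 ⟨(hO σ).2 ⟨h, ?_⟩, this⟩
    rw [this]; decide
  rintro (⟨u, v, w⟩ | ⟨v, w⟩) h
  · simp only [inl_mem_colourTriples, hC] at h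
    obtain ⟨⟨ju, hu⟩, ⟨jv, hv⟩, jw, hw⟩ := h
    have huv := ju.symm.trans jv
    have huw := ju.symm.trans jw
    have hvw := jv.symm.trans jw
    have nuv : u ≠ v := by rintro rfl; rw [hu] at hv; exact absurd hv (by decide)
    have nuw : u ≠ w := by rintro rfl; rw [hu] at hw; exact absurd hw (by decide)
    have nvw : v ≠ w := by rintro rfl; rw [hv] at hw; exact absurd hw (by decide)
    by_cases h1 : G.Between F v u w
    · obtain ⟨σ, h⟩ := hd.exists_pathTriple (c := c) hF hvw (by rw [hv, hw]; decide) h1 huv.symm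
        nuw
      exact ⟨σ, hmem σ (inComp_of_pathTriple hF hfin h jv)
        (Or.inr ⟨v, u, w, Or.inr (Or.inr (Or.inl ⟨hv, hu, hw⟩)), h⟩), Or.inr (Or.inr (Or.inr h))⟩
    by_cases h2 : G.Between F w v u
    · obtain ⟨σ, h⟩ := hd.exists_pathTriple (c := c) hF huw.symm (by rw [hu, hw]; decide) h2
        hvw.symm nuv.symm
      exact ⟨σ, hmem σ (inComp_of_pathTriple hF hfin h jw)
        (Or.inr ⟨w, v, u, Or.inr (Or.inl ⟨hw, hv, hu⟩), h⟩), Or.inr (Or.inr (Or.inl h))⟩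
    by_cases h3 : G.Between F v w u
    · obtain ⟨σ, h⟩ := hd.exists_pathTriple (c := c) hF huv.symm (by rw [hu, hv]; decide) h3
        hvw nuw.symm
      exact ⟨σ, hmem σ (inComp_of_pathTriple hF hfin h jv)
        (Or.inr ⟨v, w, u, Or.inl ⟨hv, hw, hu⟩, h⟩), Or.inr (Or.inl h)⟩
    obtain ⟨σ, h⟩ := hd.exists_tripod hF huv huw h1 h2 h3
    exact ⟨σ, hmem σ (inComp_of_tripod h ju) (Or.inl ⟨u, v, w, hu, hv, hw, h⟩), Or.inl h⟩
  · simp only [inr_mem_colourTriples, hC] at h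
    obtain ⟨⟨jv, hv⟩, jw, hw⟩ := h
    have nvw : v ≠ w := by rintro rfl; rw [hv] at hw; exact absurd hw (by decide)
    obtain ⟨σ, h⟩ := hd.exists_pathTriple (c := c) hF (jv.symm.trans jw) (by rw [hv, hw]; decide)
      (Or.inl rfl) Joined.rfl' nvw
    exact ⟨σ, hmem σ (inComp_of_pathTriple hF hfin h jv)
        (Or.inr ⟨v, v, w, Or.inr (Or.inr (Or.inr ⟨hv, rfl, hw⟩)), h⟩), h⟩

theorem exists_colourTriple (hC : ∀ y, y ∈ C ↔ G.Joined F x y)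
    (hO : ∀ σ, σ ∈ O ↔ G.InComp F x σ ∧ G.lab F c σ ≠ 0) :
    ∀ σ ∈ O.filter fun σ => G.lab F c σ = Lab.top, ∃ p ∈ colourTriples c C,
      G.TripleRel' F c p σ := by
  intro σ hσ
  rw [Finset.mem_filter, hO] at hσ
  obtain ⟨⟨hc, hne⟩, he⟩ := hσ
  have h := hasLab_lab hne
  rw [he] at h
  have ht : G.IsTriple F c σ := by
    generalize hm : Lab.top = m at h
    cases h with
    | one h => exact absurd hm (by decide)
    | @pair u v h hc' =>
      exact absurd hm ((by decide : ∀ i j : Fin 3, Lab.top ≠ Lab.pair i j) _ _)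
    | top h => exact h
  obtain ⟨u, v, w, hu, hv, hw, h⟩ | ⟨s, v, t, hg, h⟩ := ht
  · refine ⟨Sum.inl (u, v, w), ?_, Or.inl h⟩
    have h' := h
    obtain ⟨e, f, g, h1, h2, h3, h4, h5, h6, rfl⟩ := h'
    simp only [inl_mem_colourTriples, hC]
    exact ⟨⟨hc.joined (by simp) h1.inc, hu⟩, ⟨hc.joined (by simp) h3.inc, hv⟩,
      hc.joined (by simp) h5.inc, hw⟩
  · have h' := h
    obtain ⟨e, f, g, h1, h2, h3, h4, rfl⟩ := h'
    have js := hc.joined (by simp) h1.inc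
    have jt := hc.joined (by simp) h2.inc
    have jv : G.Joined F x v := jt.trans h3.joined.symm
    rcases hg with ⟨c1, c2, c3⟩ | ⟨c1, c2, c3⟩ | ⟨c1, c2, c3⟩ | ⟨c1, rfl, c3⟩
    · refine ⟨Sum.inl (t, s, v), ?_, Or.inr (Or.inl h)⟩
      simp only [inl_mem_colourTriples, hC]
      exact ⟨⟨jt, c3⟩, ⟨js, c1⟩, jv, c2⟩
    · refine ⟨Sum.inl (t, v, s), ?_, Or.inr (Or.inr (Or.inl h))⟩
      simp only [inl_mem_colourTriples, hC]
      exact ⟨⟨jt, c3⟩, ⟨jv, c2⟩, js, c1⟩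
    · refine ⟨Sum.inl (v, s, t), ?_, Or.inr (Or.inr (Or.inr h))⟩
      simp only [inl_mem_colourTriples, hC]
      exact ⟨⟨jv, c2⟩, ⟨js, c1⟩, jt, c3⟩
    · refine ⟨Sum.inr (v, t), ?_, h⟩
      simp only [inr_mem_colourTriples, hC]
      exact ⟨⟨js, c1⟩, jt, c3⟩

/-- Tripods and path triples are told apart because the edges of a tripod do not lie on a path. Two
path triples with the same edges have the same `s, v, t`; `c a ≠ c b` separates the degenerate ones
from the others. -/
theorem tripleRel_inj (hF : G.IsForest F) (hfin : F.Finite) :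
    ∀ p ∈ colourTriples c C, ∀ p' ∈ colourTriples c C, ∀ σ, G.TripleRel' F c p σ →
      G.TripleRel' F c p' σ → p = p' := by
  obtain ⟨d, hd⟩ := hF.exists_isDist hfin
  have hcol : ∀ u v w : α, Sum.inl (u, v, w) ∈ colourTriples c C →
      c u = 0 ∧ c v = 1 ∧ c w = 2 := by
    intro u v w h
    rw [inl_mem_colourTriples] at h
    exact ⟨h.1.2, h.2.1.2, h.2.2.2⟩
  have hcol' : ∀ v w : α, Sum.inr (v, w) ∈ colourTriples c C → c v = 1 ∧ c w = 2 := by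
    intro v w h
    rw [inr_mem_colourTriples] at h
    exact ⟨h.1.2, h.2.2⟩
  have hpath : ∀ u v w σ, c u = 0 ∧ c v = 1 ∧ c w = 2 → G.TripleRel F c u v w σ →
      G.IsTripod F u v w σ ∨ ∃ a b b', G.IsPathTriple F c a b b' σ ∧ GoodPath c a b b' ∧ c a ≠ c b ∧
        ((a = v ∧ b = w ∧ b' = u) ∨ (a = w ∧ b = v ∧ b' = u) ∨ (a = v ∧ b = u ∧ b' = w)) := by
    rintro u v w σ ⟨hu, hv, hw⟩ (h | h | h | h)
    · exact Or.inl h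
    · exact Or.inr ⟨v, w, u, h, Or.inl ⟨hv, hw, hu⟩, by rw [hv, hw]; decide, by simp⟩
    · exact Or.inr ⟨w, v, u, h, Or.inr (Or.inl ⟨hw, hv, hu⟩), by rw [hv, hw]; decide, by simp⟩
    · exact Or.inr ⟨v, u, w, h, Or.inr (Or.inr (Or.inl ⟨hv, hu, hw⟩)), by rw [hv, hu]; decide, by simp⟩
  rintro (⟨u, v, w⟩ | ⟨v, w⟩) h (⟨u', v', w'⟩ | ⟨v', w'⟩) h' σ hσ hσ'
  · have k := hcol _ _ _ h
    have k' := hcol _ _ _ h'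
    rcases hpath _ _ _ _ k hσ with r | ⟨a, b, b', r, hr, hn, hab⟩
    · rcases hpath _ _ _ _ k' hσ' with r' | ⟨a', b', b'', r', hr', hn', hab'⟩
      · obtain ⟨h1, h2, h3⟩ := hd.tripod_inj hF r r'
        obtain ⟨k1, k2, k3⟩ := k
        obtain ⟨k1', k2', k3'⟩ := k'
        have e1 : u' = u := by
          rcases h1 with rfl | rfl | rfl
          · rfl
          · rw [k2] at k1'; exact absurd k1' (by decide)
          · rw [k3] at k1'; exact absurd k1' (by decide)
        have e2 : v' = v := by
          rcases h2 with rfl | rfl | rfl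
          · rw [k1] at k2'; exact absurd k2' (by decide)
          · rfl
          · rw [k3] at k2'; exact absurd k2' (by decide)
        have e3 : w' = w := by
          rcases h3 with rfl | rfl | rfl
          · rw [k1] at k3'; exact absurd k3' (by decide)
          · rw [k2] at k3'; exact absurd k3' (by decide)
          · rfl
        rw [e1, e2, e3]
      · exact absurd (hd.pathTriple_spans hF r') (hd.tripod_not_spans hF r)
    · rcases hpath _ _ _ _ k' hσ' with r' | ⟨a', b2, b'', r', hr', hn', hab'⟩
      · exact absurd (hd.pathTriple_spans hF r) (hd.tripod_not_spans hF r')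
      · obtain ⟨rfl, rfl, rfl⟩ := hd.pathTriple_inj hF r hr r' hr'
        obtain ⟨k1, k2, k3⟩ := k
        obtain ⟨k1', k2', k3'⟩ := k'
        rcases hab with ⟨rfl, rfl, rfl⟩ | ⟨rfl, rfl, rfl⟩ | ⟨rfl, rfl, rfl⟩ <;>
          rcases hab' with ⟨rfl, rfl, rfl⟩ | ⟨rfl, rfl, rfl⟩ | ⟨rfl, rfl, rfl⟩ <;>
          first
          | rfl
          | exact absurd (k1.symm.trans k2') (by decide)
          | exact absurd (k1.symm.trans k3') (by decide)
          | exact absurd (k2.symm.trans k3') (by decide)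
  · have k := hcol _ _ _ h
    have k' := hcol' _ _ h'
    rcases hpath _ _ _ _ k hσ with r | ⟨a, b, b', r, hr, hn, hab⟩
    · exact absurd (hd.pathTriple_spans hF hσ') (hd.tripod_not_spans hF r)
    · obtain ⟨q1, q2, -⟩ := hd.pathTriple_inj hF r hr hσ'
        (Or.inr (Or.inr (Or.inr ⟨k'.1, rfl, k'.2⟩)))
      exact absurd (by rw [q1, q2]) hn
  · have k := hcol' _ _ h
    have k' := hcol _ _ _ h'
    rcases hpath _ _ _ _ k' hσ' with r | ⟨a, b, b', r, hr, hn, hab⟩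
    · exact absurd (hd.pathTriple_spans hF hσ) (hd.tripod_not_spans hF r)
    · obtain ⟨q1, q2, -⟩ := hd.pathTriple_inj hF r hr hσ
        (Or.inr (Or.inr (Or.inr ⟨k.1, rfl, k.2⟩)))
      exact absurd (by rw [q1, q2]) hn
  · have k := hcol' _ _ h
    have k' := hcol' _ _ h'
    obtain ⟨h1, h2, h3⟩ := hd.pathTriple_inj hF hσ (Or.inr (Or.inr (Or.inr ⟨k.1, rfl, k.2⟩)))
      hσ' (Or.inr (Or.inr (Or.inr ⟨k'.1, rfl, k'.2⟩)))
    simp only at h1 h3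
    rw [h1, h3]

/-- The four shapes exclude each other: at most one of three distinct vertices is between the
others, and in a tripod none is. -/
theorem tripleRel_unique (hF : G.IsForest F) (hfin : F.Finite) (hC : ∀ y, y ∈ C ↔ G.Joined F x y) :
    ∀ p ∈ colourTriples c C, ∀ σ τ, G.TripleRel' F c p σ → G.TripleRel' F c p τ → σ = τ := by
  obtain ⟨d, hd⟩ := hF.exists_isDist hfin
  rintro (⟨u, v, w⟩ | ⟨v, w⟩) hp σ τ h h'
  · simp only [inl_mem_colourTriples, hC] at hp
    obtain ⟨⟨ju, hu⟩, ⟨jv, hv⟩, jw, hw⟩ := hp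
    have n1 := hd.symm u v
    have n2 := hd.symm u w
    have n3 := hd.symm v w
    have nuv : d u v ≠ 0 := fun h => by
      obtain rfl := hd.eq_of_zero (ju.symm.trans jv) h; rw [hu] at hv; exact absurd hv (by decide)
    have nuw : d u w ≠ 0 := fun h => by
      obtain rfl := hd.eq_of_zero (ju.symm.trans jw) h; rw [hu] at hw; exact absurd hw (by decide)
    have nvw : d v w ≠ 0 := fun h => by
      obtain rfl := hd.eq_of_zero (jv.symm.trans jw) h; rw [hv] at hw; exact absurd hw (by decide)
    change G.TripleRel F c u v w σ at h
    change G.TripleRel F c u v w τ at h'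
    rcases h with h | h | h | h <;> rcases h' with h' | h' | h' | h'
    · exact hd.tripod_unique hF h h'
    · have := hd.tripod_dist hF h; have := hd.pathTriple_dist hF h'; omega
    · have := hd.tripod_dist hF h; have := hd.pathTriple_dist hF h'; omega
    · have := hd.tripod_dist hF h; have := hd.pathTriple_dist hF h'; omega
    · have := hd.tripod_dist hF h'; have := hd.pathTriple_dist hF h; omega
    · exact hd.pathTriple_unique hF h h'
    · have := hd.pathTriple_dist hF h; have := hd.pathTriple_dist hF h'; omega
    · have := hd.pathTriple_dist hF h; have := hd.pathTriple_dist hF h'; omega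
    · have := hd.tripod_dist hF h'; have := hd.pathTriple_dist hF h; omega
    · have := hd.pathTriple_dist hF h; have := hd.pathTriple_dist hF h'; omega
    · exact hd.pathTriple_unique hF h h'
    · have := hd.pathTriple_dist hF h; have := hd.pathTriple_dist hF h'; omega
    · have := hd.tripod_dist hF h'; have := hd.pathTriple_dist hF h; omega
    · have := hd.pathTriple_dist hF h; have := hd.pathTriple_dist hF h'; omega
    · have := hd.pathTriple_dist hF h; have := hd.pathTriple_dist hF h'; omega
    · exact hd.pathTriple_unique hF h h'
  · exact hd.pathTriple_unique hF h h'


theorem card_triples (hF : G.IsForest F) (hfin : F.Finite) (hC : ∀ y, y ∈ C ↔ G.Joined F x y)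
    (hO : ∀ σ, σ ∈ O ↔ G.InComp F x σ ∧ G.lab F c σ ≠ 0) :
    (O.filter fun σ => G.lab F c σ = Lab.top).card =
      (C.filter fun y => c y = 0).card * ((C.filter fun y => c y = 1).card *
        (C.filter fun y => c y = 2).card) +
      (C.filter fun y => c y = 1).card * (C.filter fun y => c y = 2).card := by
  classical
  rw [← Finset.card_product, ← Finset.card_product, ← Finset.card_disjSum]
  symm
  have := Finset.card_eq_of_rel (G.TripleRel' F c) (exists_triple hF hfin hC hO)
    (exists_colourTriple hC hO) (tripleRel_inj hF hfin) (tripleRel_unique hF hfin hC)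
  rw [← this]
  simp only [colourTriples]

end Counting

end Graph

/-! ### The generating function of the marks in a component -/

namespace Graph

variable {α β : Type*} {G : Graph α β} {F F' : Set β} {x y z u v w : α}
  {e f g : β} {σ τ ρ μ : Multiset β} {c : α → Fin 3} {l l' : Lab}

section Component

variable {C : Finset α} {EC : Finset β} {O : Finset (Multiset β)}

open Classical in
/-- The number of vertices of a given colour, as a real number. -/
noncomputable def numColour (c : α → Fin 3) (C : Finset α) (i : Fin 3) : ℝ :=
  (C.filter fun y => c y = i).card

theorem sum_numColour : numColour c C 0 + numColour c C 1 + numColour c C 2 = C.card := by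
  classical
  have h := Finset.card_eq_sum_card_fiberwise (f := c) (s := C) (t := Finset.univ) (by simp)
  rw [Fin.sum_univ_three] at h
  rw [h]
  simp only [numColour]
  push_cast
  congr!

/-- The weighted sum of the labels of the admissible sets of marks in a component with the given
numbers of vertices of each colour. -/
def markGen (a : Fin 3 → ℝ) (t : ℝ) : Tri :=
  ⟨1 + (a 0 + a 1 + a 2 - 1) * t, t ^ 2 * (a 0 * a 1), t ^ 2 * (a 0 * a 2), t ^ 2 * (a 1 * a 2),
    t ^ 3 * (a 0 * (a 1 * a 2) + a 1 * a 2)⟩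

theorem Lab.rank_le : ∀ l : Lab, l.rank ≤ 2 := by decide

theorem card_of_lab (hl : l ≠ 0) (hr : 0 < l.rank) (h : G.lab F c σ = l) :
    Multiset.card σ = 1 + l.rank := by
  subst h
  have := (hasLab_lab hl).card
  omega

/-- The marks are sorted by label, and the classes are counted by `card_edges_add_one`, `card_pairs`
and `card_triples`. A label of positive rank fixes the number of marks, so each such class
contributes a single power of `t`. -/
theorem sum_compMarks (hF : G.IsForest F) (hfin : F.Finite)
    (hC : ∀ y, y ∈ C ↔ G.Joined F x y)
    (hEC : ∀ e, e ∈ EC ↔ e ∈ F ∧ ∃ y, G.Inc e y ∧ G.Joined F x y)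
    (hO : ∀ σ, σ ∈ O ↔ G.InComp F x σ ∧ G.lab F c σ ≠ 0) (t : ℝ) :
    ∑ σ ∈ O, Tri.C (t ^ Multiset.card σ) * Tri.ofLab (G.lab F c σ) =
      markGen (numColour c C) t := by
  classical
  obtain ⟨d, hd⟩ := hF.exists_isDist hfin
  have hconst : ∀ l : Lab, l ≠ 0 → 0 < l.rank →
      ∑ σ ∈ O.filter fun σ => G.lab F c σ = l, Tri.C (t ^ Multiset.card σ) *
        Tri.ofLab (G.lab F c σ) =
      Tri.C ((O.filter fun σ => G.lab F c σ = l).card * t ^ (1 + l.rank)) * Tri.ofLab l := by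
    intro l hl hr
    rw [Finset.sum_congr rfl (g := fun _ => Tri.C (t ^ (1 + l.rank)) * Tri.ofLab l)]
    · rw [Finset.sum_const, map_mul, map_natCast, nsmul_eq_mul, mul_assoc]
    · intro σ hσ
      have h := (Finset.mem_filter.1 hσ).2
      rw [card_of_lab hl hr h, h]
  have hone : ∑ σ ∈ O.filter fun σ => G.lab F c σ = 1, Tri.C (t ^ Multiset.card σ) *
        Tri.ofLab (G.lab F c σ) = Tri.C (1 + EC.card * t) := by
    -- Label `1` belongs to the empty multiset and to the single edges of the component, whence the
    -- coefficient `1 + |EC| * t`.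
    have hset : (O.filter fun σ => G.lab F c σ = 1) =
        insert 0 (EC.image fun e => ({e} : Multiset β)) := by
      ext σ
      rw [Finset.mem_filter, hO, Finset.mem_insert, Finset.mem_image]
      constructor
      · rintro ⟨⟨hc, hne⟩, h1⟩
        have h := (hasLab_lab hne).card
        rw [h1] at h
        have h0 : Lab.rank 1 = 0 := rfl
        rcases Nat.eq_zero_or_pos (Multiset.card σ) with h2 | h2
        · exact Or.inl (Multiset.card_eq_zero.1 h2)
        · obtain ⟨e, rfl⟩ := Multiset.card_eq_one.1 (show Multiset.card σ = 1 by omega)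
          exact Or.inr ⟨e, (hEC e).2 (hc e (by simp)), rfl⟩
      · rintro (rfl | ⟨e, he, rfl⟩)
        · have := hd.lab_eq (c := c) hF (HasLab.one (σ := 0) (by simp))
          refine ⟨⟨by intro e he; simp at he, ?_⟩, this⟩
          rw [this]; decide
        · have := hd.lab_eq (c := c) hF (HasLab.one (σ := {e}) (by simp))
          refine ⟨⟨?_, ?_⟩, this⟩
          · intro f hf
            rw [Multiset.mem_singleton.1 hf]
            exact (hEC e).1 he
          · rw [this]; decide
    rw [Finset.sum_congr rfl (g := fun σ => Tri.C (t ^ Multiset.card σ))]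
    · rw [hset, Finset.sum_insert, Finset.sum_image]
      · simp only [Multiset.card_zero, pow_zero, Multiset.card_singleton, pow_one,
          Finset.sum_const, nsmul_eq_mul, map_add, map_mul, map_natCast]
      · intro e _ f _ h
        exact Multiset.singleton_inj.1 h
      · intro h
        obtain ⟨e, -, h⟩ := Finset.mem_image.1 h
        exact Multiset.singleton_ne_zero e h
    · intro σ hσ
      rw [(Finset.mem_filter.1 hσ).2, map_one, mul_one]
  have hzero : O.filter (fun σ => G.lab F c σ = Lab.zero) = ∅ := by
    rw [Finset.filter_eq_empty_iff]
    intro σ hσ h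
    exact ((hO σ).1 hσ).2 h
  have h01 := card_pairs (c := c) hF hfin hC hO (i := 0) (j := 1) (by decide) (by decide)
  have h02 := card_pairs (c := c) hF hfin hC hO (i := 0) (j := 2) (by decide) (by decide)
  have h12 := card_pairs (c := c) hF hfin hC hO (i := 1) (j := 2) (by decide) (by decide)
  have htop := card_triples (c := c) hF hfin hC hO
  have hcard := card_edges_add_one hF hfin hC hEC
  have hEC' : (EC.card : ℝ) = numColour c C 0 + numColour c C 1 + numColour c C 2 - 1 := by
    rw [sum_numColour, ← hcard]; push_cast; ring
  rw [← Finset.sum_fiberwise (g := fun σ => G.lab F c σ)]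
  change ∑ l ∈ ({Lab.zero, Lab.one, Lab.x01, Lab.x02, Lab.x12, Lab.top} : Finset Lab), _ = _
  rw [Finset.sum_insert (by decide), Finset.sum_insert (by decide), Finset.sum_insert (by decide),
    Finset.sum_insert (by decide), Finset.sum_insert (by decide), Finset.sum_singleton]
  rw [hzero, Finset.sum_empty, hconst Lab.x01 (by decide) (by decide),
    hconst Lab.x02 (by decide) (by decide), hconst Lab.x12 (by decide) (by decide),
    hconst Lab.top (by decide) (by decide)]
  change 0 + (∑ σ ∈ O.filter fun σ => G.lab F c σ = 1, Tri.C (t ^ Multiset.card σ) *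
        Tri.ofLab (G.lab F c σ) + _) = _
  rw [hone, hEC']
  change (O.filter fun σ => G.lab F c σ = Lab.x01).card = _ at h01
  change (O.filter fun σ => G.lab F c σ = Lab.x02).card = _ at h02
  change (O.filter fun σ => G.lab F c σ = Lab.x12).card = _ at h12
  rw [h01, h02, h12, htop]
  change _ + (_ + (_ * Tri.vec Lab.x01 + (_ * Tri.vec Lab.x02 + (_ * Tri.vec Lab.x12 +
    _ * Tri.vec Lab.top)))) = _
  simp only [Lab.rank, Tri.vec, markGen, numColour]
  ext <;> simp only [Tri.add_r, Tri.mul_r, Tri.zero_r, Tri.C_r, Tri.add_a, Tri.mul_a, Tri.zero_a, Tri.C_a,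
    Tri.add_b, Tri.mul_b, Tri.zero_b, Tri.C_b, Tri.add_c, Tri.mul_c, Tri.zero_c, Tri.C_c,
    Tri.add_y, Tri.mul_y, Tri.zero_y, Tri.C_y] <;> push_cast <;> ring

end Component

end Graph

/-! ### Components of a forest and admissible monomials -/

namespace Graph

variable {α β : Type*} {G : Graph α β} {F F' : Set β} {x y z u v w : α}
  {e f g : β} {σ τ ρ μ : Multiset β} {c : α → Fin 3} {l l' : Lab}

/-- Being joined by a walk in `F`. -/
def joinedSetoid (G : Graph α β) (F : Set β) : Setoid α :=
  ⟨G.Joined F, fun _ => Joined.rfl', fun h => h.symm, fun h h' => h.trans h'⟩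

/-- The components of the spanning subgraph with edge set `F`. -/
abbrev Comp (G : Graph α β) (F : Set β) := Quotient (G.joinedSetoid F)

/-- The component of a vertex. -/
def comp (G : Graph α β) (F : Set β) (x : α) : G.Comp F := Quotient.mk _ x

theorem comp_eq_iff : G.comp F x = G.comp F y ↔ G.Joined F x y := Quotient.eq

theorem comp_surjective (q : G.Comp F) : ∃ x, G.comp F x = q := Quotient.exists_rep q

noncomputable instance [Finite α] : Fintype (G.Comp F) := Fintype.ofFinite _

/-- `e` is an edge at the component `q`. -/
def AtComp (G : Graph α β) (F : Set β) (q : G.Comp F) (e : β) : Prop :=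
  ∃ y, G.Inc e y ∧ G.comp F y = q

theorem atComp_unique {q q' : G.Comp F} (he : e ∈ F) (h : G.AtComp F q e)
    (h' : G.AtComp F q' e) : q = q' := by
  obtain ⟨y, ⟨z, hy⟩, rfl⟩ := h
  obtain ⟨y', ⟨z', hy'⟩, rfl⟩ := h'
  rw [comp_eq_iff]
  rcases hy.eq_and_eq_or_eq_and_eq hy' with ⟨rfl, rfl⟩ | ⟨rfl, rfl⟩
  · exact Joined.rfl'
  · exact Joined.of_link he hy

theorem exists_atComp (he : e ∈ G.edgeSet) : ∃ q : G.Comp F, G.AtComp F q e := by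
  obtain ⟨x, y, hl⟩ := G.exists_isLink_of_mem_edgeSet he
  exact ⟨G.comp F x, x, ⟨y, hl⟩, rfl⟩

open Classical in
/-- The part of a multiset of edges in a component. -/
noncomputable def part (G : Graph α β) (F : Set β) (q : G.Comp F) (μ : Multiset β) : Multiset β :=
  μ.filter fun e => G.AtComp F q e

theorem mem_part {q : G.Comp F} : e ∈ G.part F q μ ↔ e ∈ μ ∧ G.AtComp F q e := by
  classical
  rw [part, Multiset.mem_filter]

theorem inComp_part (hμ : ∀ e ∈ μ, e ∈ F) : G.InComp F x (G.part F (G.comp F x) μ) := by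
  intro e he
  obtain ⟨h, y, hy, hq⟩ := mem_part.1 he
  exact ⟨hμ e h, y, hy, comp_eq_iff.1 hq.symm⟩

theorem inComp_iff : G.InComp F x σ ↔ ∀ e ∈ σ, e ∈ F ∧ G.AtComp F (G.comp F x) e := by
  refine forall₂_congr fun e he => and_congr_right fun _ => exists_congr fun y => ?_
  rw [comp_eq_iff]
  exact and_congr_right fun _ => ⟨Joined.symm, Joined.symm⟩

section Finite

variable [Finite α]

theorem sum_part (hF : F ⊆ G.edgeSet) (hμ : ∀ e ∈ μ, e ∈ F) :
    ∑ q : G.Comp F, G.part F q μ = μ := by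
  classical
  ext e
  rw [Multiset.count_sum']
  by_cases he : e ∈ μ
  · obtain ⟨q, hq⟩ := exists_atComp (F := F) (hF (hμ e he))
    rw [Finset.sum_eq_single q]
    · rw [part, Multiset.count_filter_of_pos hq]
    · intro q' _ hne
      rw [part, Multiset.count_filter_of_neg]
      exact fun h => hne (atComp_unique (hμ e he) h hq)
    · exact fun h => absurd (Finset.mem_univ _) h
  · rw [Multiset.count_eq_zero_of_notMem he]
    refine Finset.sum_eq_zero fun q _ => ?_
    exact Multiset.count_eq_zero_of_notMem fun h => he (mem_part.1 h).1

theorem part_sum {p : G.Comp F → Multiset β} (hp : ∀ q, ∀ e ∈ p q, e ∈ F ∧ G.AtComp F q e)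
    (q : G.Comp F) : G.part F q (∑ q', p q') = p q := by
  classical
  ext e
  by_cases he : G.AtComp F q e
  · rw [part, Multiset.count_filter_of_pos he, Multiset.count_sum', Finset.sum_eq_single q]
    · intro q' _ hne
      refine Multiset.count_eq_zero_of_notMem fun h => hne ?_
      exact atComp_unique (hp q' e h).1 (hp q' e h).2 he
    · exact fun h => absurd (Finset.mem_univ _) h
  · rw [part, Multiset.count_filter_of_neg he]
    exact (Multiset.count_eq_zero_of_notMem fun h => he (hp q e h).2).symm

open Classical in
/-- The product of the labels of the parts of a multiset of edges. -/
noncomputable def prodLab (G : Graph α β) (F : Set β) (c : α → Fin 3) (μ : Multiset β) : Lab :=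
  ∏ q : G.Comp F, G.lab F c (G.part F q μ)

end Finite

section Fintype

variable [Fintype β]

open Classical in
/-- The admissible multisets of marks in a component. -/
noncomputable def compMarks (G : Graph α β) (F : Set β) (c : α → Fin 3) (q : G.Comp F) :
    Finset (Multiset β) :=
  -- A multiset with nonzero label has at most three elements, so the bound 3 on multiplicities
  -- excludes nothing.
  (3 • (Finset.univ : Finset β).val).powerset.toFinset.filter fun σ =>
    (∀ e ∈ σ, e ∈ F ∧ G.AtComp F q e) ∧ G.lab F c σ ≠ 0

theorem mem_compMarks {q : G.Comp F} : σ ∈ G.compMarks F c q ↔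
    (∀ e ∈ σ, e ∈ F ∧ G.AtComp F q e) ∧ G.lab F c σ ≠ 0 := by
  classical
  rw [compMarks, Finset.mem_filter, and_iff_right_iff_imp]
  rintro ⟨-, h⟩
  rw [Multiset.mem_toFinset, Multiset.mem_powerset, Multiset.le_iff_count]
  intro e
  have h1 := (hasLab_lab h).card
  have h2 := Lab.rank_le (G.lab F c σ)
  have h3 := Multiset.count_le_card e σ
  rw [Multiset.count_nsmul, Multiset.count_eq_one_of_mem Finset.univ.nodup (Finset.mem_univ _)]
  omega

open Classical in
/-- The numbers of vertices of the colours in a component. -/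
noncomputable def compColour [Fintype α] (G : Graph α β) (F : Set β) (c : α → Fin 3)
    (q : G.Comp F) (i : Fin 3) : ℝ :=
  numColour c (Finset.univ.filter fun y => G.comp F y = q) i

theorem sum_compMarks' [Fintype α] (hF : G.IsForest F) (q : G.Comp F) (t : ℝ) :
    ∑ σ ∈ G.compMarks F c q, Tri.C (t ^ Multiset.card σ) * Tri.ofLab (G.lab F c σ) =
      markGen (G.compColour F c q) t := by
  classical
  obtain ⟨x, rfl⟩ := comp_surjective q
  refine sum_compMarks (x := x) (EC := Finset.univ.filter fun e => e ∈ F ∧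
    ∃ y, G.Inc e y ∧ G.Joined F x y) hF (Set.toFinite F) (fun y => ?_) (fun e => ?_)
    (fun σ => ?_) t
  · rw [Finset.mem_filter, comp_eq_iff]
    exact ⟨fun h => h.2.symm, fun h => ⟨Finset.mem_univ _, h.symm⟩⟩
  · simp
  · rw [mem_compMarks, inComp_iff]

end Fintype

section Monomials

open Classical in
/-- The edge set of a monomial. -/
noncomputable def supp (N : Finset β) (m : Multiset β) : Finset β := N ∪ m.toFinset

open Classical in
/-- The marks of a monomial: all but one of the copies of each edge that is not in `N`. -/
noncomputable def marks (N : Finset β) (m : Multiset β) : Multiset β :=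
  m - (m.toFinset \ N).val

variable {N A : Finset β} {m m' : Multiset β}

theorem mem_supp : e ∈ supp N m ↔ e ∈ N ∨ e ∈ m := by
  classical
  rw [supp, Finset.mem_union, Multiset.mem_toFinset]

theorem subset_supp : N ⊆ supp N m := fun _ h => mem_supp.2 (Or.inl h)

theorem supp_mono (h : m' ≤ m) : supp N m' ⊆ supp N m := fun _ he =>
  mem_supp.2 ((mem_supp.1 he).imp_right (Multiset.mem_of_le h))

theorem mem_supp_of_mem_marks (h : e ∈ marks N m) : e ∈ supp N m := by
  classical
  exact mem_supp.2 (Or.inr (Multiset.mem_of_le (Multiset.sub_le_self _ _) h))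

open Classical in
theorem count_marks : Multiset.count e (marks N m) =
    if e ∈ N then Multiset.count e m else Multiset.count e m - 1 := by
  rw [marks, Multiset.count_sub]
  by_cases h : e ∈ m
  · split_ifs with h'
    · rw [Multiset.count_eq_zero_of_notMem (fun hm => (Finset.mem_sdiff.1 hm).2 h'), tsub_zero]
    · rw [Multiset.count_eq_one_of_mem (Finset.nodup _)
        (Finset.mem_sdiff.2 ⟨Multiset.mem_toFinset.2 h, h'⟩)]
  · rw [Multiset.count_eq_zero_of_notMem h, zero_tsub, zero_tsub, ite_self]

theorem marks_mono (h : m' ≤ m) : marks N m' ≤ marks N m := by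
  classical
  rw [Multiset.le_iff_count]
  intro e
  rw [count_marks, count_marks]
  have := Multiset.count_le_of_le e h
  split_ifs <;> omega

open Classical in
theorem eq_add_marks : m = (supp N m \ N).val + marks N m := by
  have h : supp N m \ N = m.toFinset \ N := by
    ext e; simp only [Finset.mem_sdiff, mem_supp, Multiset.mem_toFinset]; tauto
  rw [h, marks, add_comm, tsub_add_cancel_of_le]
  rw [Multiset.le_iff_count]
  intro e
  by_cases h : e ∈ (m.toFinset \ N).val
  · rw [Multiset.count_eq_one_of_mem (Finset.nodup _) h]
    exact Multiset.one_le_count_iff_mem.2 (Multiset.mem_toFinset.1 (Finset.mem_sdiff.1 h).1)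
  · rw [Multiset.count_eq_zero_of_notMem h]; exact Nat.zero_le _

open Classical in
theorem card_eq_add_marks : Multiset.card m = (supp N m \ N).card + Multiset.card (marks N m) := by
  conv_lhs => rw [eq_add_marks (N := N) (m := m)]
  rw [Multiset.card_add]; rfl

open Classical in
theorem supp_add (hN : N ⊆ A) (hμ : ∀ e ∈ μ, e ∈ A) : supp N ((A \ N).val + μ) = A := by
  ext e
  simp only [mem_supp, Multiset.mem_add, Finset.mem_val, Finset.mem_sdiff]
  constructor
  · rintro (h | h | h)
    exacts [hN h, h.1, hμ e h]
  · intro h; tauto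

open Classical in
theorem marks_add (hN : N ⊆ A) (hμ : ∀ e ∈ μ, e ∈ A) : marks N ((A \ N).val + μ) = μ := by
  have h := eq_add_marks (N := N) (m := (A \ N).val + μ)
  rw [supp_add hN hμ] at h
  exact (add_left_cancel h).symm

/-- The admissible monomials. The second component is the exponent of an additional variable, with
labels `zl`. -/
def Allowed [Finite α] (G : Graph α β) (N : Finset β) (c : α → Fin 3) (zl : ℕ → Lab) (p : Multiset β × ℕ) :
    Prop :=
  G.IsForest (supp N p.1 : Set β) ∧ zl p.2 * G.prodLab (supp N p.1) c (marks N p.1) ≠ 0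

variable [Fintype α] [Fintype β]

open Classical in
/-- The forests that contain `N`. -/
noncomputable def forests (G : Graph α β) (N : Finset β) : Finset (Finset β) :=
  Finset.univ.filter fun A => N ⊆ A ∧ G.IsForest (A : Set β)

open Classical in
-- Expansion of a product of sums: `total` turns each product of labels into 1 or 0, so exactly the
-- choices with nonzero product are counted.
theorem sum_marks (hA : G.IsForest (A : Set β)) (zl : ℕ → Lab) (t : ℝ) :
    ∑ p ∈ (Fintype.piFinset (G.compMarks (A : Set β) c) ×ˢ Finset.range 3).filter
      (fun p => zl p.2 * G.prodLab (A : Set β) c (∑ q, p.1 q) ≠ 0),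
      t ^ (Multiset.card (∑ q, p.1 q) + p.2) =
    Tri.total ((∑ k ∈ Finset.range 3, Tri.C (t ^ k) * Tri.ofLab (zl k)) *
      ∏ q : G.Comp (A : Set β), markGen (G.compColour (A : Set β) c q) t) := by
  simp_rw [← sum_compMarks' hA]
  rw [Finset.prod_univ_sum, Finset.sum_mul_sum, Finset.sum_comm, ← Finset.sum_product', map_sum,
    Finset.sum_filter]
  refine Finset.sum_congr rfl fun p hp => ?_
  have hp' : ∀ q, ∀ e ∈ p.1 q, e ∈ (A : Set β) ∧ G.AtComp A q e := fun q =>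
    (mem_compMarks.1 (Fintype.mem_piFinset.1 (Finset.mem_product.1 hp).1 q)).1
  have h : Tri.C (t ^ p.2) * Tri.ofLab (zl p.2) * ∏ q : G.Comp (A : Set β),
      (Tri.C (t ^ Multiset.card (p.1 q)) * Tri.ofLab (G.lab A c (p.1 q))) =
      Tri.C (t ^ (Multiset.card (∑ q, p.1 q) + p.2)) *
        Tri.ofLab (zl p.2 * G.prodLab (A : Set β) c (∑ q, p.1 q)) := by
    rw [Finset.prod_mul_distrib, ← map_prod, ← map_prod, Finset.prod_pow_eq_pow_sum, map_mul,
      prodLab, Multiset.card_sum, pow_add, map_mul]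
    simp_rw [part_sum hp']
    ring
  rw [h, Tri.total_C_mul, Tri.total_ofLab]
  split_ifs <;> simp

/-- A monomial is the same thing as its edge set `A` together with its marks, and the marks are the
sum of their parts in the components of `A`. The edges of `A` outside `N` contribute `A.card -
N.card` to the degree. -/
theorem exists_allowed (G : Graph α β) (N : Finset β) (c : α → Fin 3) {zl : ℕ → Lab}
    (hzl : ∀ k, zl k ≠ 0 → k < 3) :
    ∃ X : Finset (Multiset β × ℕ), (∀ p, p ∈ X ↔ G.Allowed N c zl p) ∧
      ∀ t : ℝ, ∑ p ∈ X, t ^ (Multiset.card p.1 + p.2) =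
        ∑ A ∈ G.forests N, t ^ (A.card - N.card) *
          Tri.total ((∑ k ∈ Finset.range 3, Tri.C (t ^ k) * Tri.ofLab (zl k)) *
            ∏ q : G.Comp (A : Set β), markGen (G.compColour (A : Set β) c q) t) := by
  classical
  set Q : (A : Finset β) → Finset ((G.Comp (A : Set β) → Multiset β) × ℕ) := fun A =>
    (Fintype.piFinset (G.compMarks (A : Set β) c) ×ˢ Finset.range 3).filter
      (fun p => zl p.2 * G.prodLab (A : Set β) c (∑ q, p.1 q) ≠ 0) with hQ
  have hQA : ∀ A p, p ∈ Q A → ∀ q, ∀ e ∈ p.1 q, e ∈ (A : Set β) ∧ G.AtComp A q e :=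
    fun A p hp q => (mem_compMarks.1 (Fintype.mem_piFinset.1
      (Finset.mem_product.1 (Finset.mem_filter.1 hp).1).1 q)).1
  have hQs : ∀ A p, p ∈ Q A → ∀ e ∈ ∑ q, p.1 q, e ∈ A := by
    intro A p hp e he
    obtain ⟨q, -, he⟩ := Multiset.mem_sum.1 he
    exact (hQA A p hp q e he).1
  have hallowed : ∀ A ∈ G.forests N, ∀ p ∈ Q A,
      G.Allowed N c zl ((A \ N).val + ∑ q, p.1 q, p.2) := by
    intro A hA p hp
    obtain ⟨-, hN, hA⟩ := Finset.mem_filter.1 hA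
    have h := (Finset.mem_filter.1 hp).2
    constructor
    · simp only
      rwa [supp_add hN (hQs A p hp)]
    · simp only
      rwa [supp_add hN (hQs A p hp), marks_add hN (hQs A p hp)]
  have hparts : ∀ p, G.Allowed N c zl p → (fun q => G.part (supp N p.1 : Set β) q (marks N p.1),
      p.2) ∈ Q (supp N p.1) ∧ ∑ q, G.part (supp N p.1 : Set β) q (marks N p.1) = marks N p.1 := by
    rintro p ⟨hp1, hp2⟩
    have hs := sum_part (μ := marks N p.1) hp1.1 (fun e he => mem_supp_of_mem_marks he)
    refine ⟨?_, hs⟩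
    rw [hQ, Finset.mem_filter, Finset.mem_product, Fintype.mem_piFinset, Finset.mem_range]
    refine ⟨⟨fun q => ?_, hzl _ fun h => hp2 (by rw [h, zero_mul])⟩, ?_⟩
    · rw [mem_compMarks]
      refine ⟨fun e he => ?_, fun h => hp2 ?_⟩
      · exact ⟨mem_supp_of_mem_marks (mem_part.1 he).1, (mem_part.1 he).2⟩
      · rw [prodLab, Finset.prod_eq_zero (Finset.mem_univ q) h, mul_zero]
    · simp only
      rwa [hs]
  have hforest : ∀ p, G.Allowed N c zl p → supp N p.1 ∈ G.forests N := fun p hp =>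
    Finset.mem_filter.2 ⟨Finset.mem_univ _, subset_supp, hp.1⟩
  set X : Finset (Multiset β × ℕ) := (G.forests N).biUnion fun A =>
    (Q A).image fun p => ((A \ N).val + ∑ q, p.1 q, p.2) with hX
  have hmem : ∀ p, p ∈ X ↔ G.Allowed N c zl p := by
    intro p
    rw [hX, Finset.mem_biUnion]
    constructor
    · rintro ⟨A, hA, h⟩
      obtain ⟨p', hp', rfl⟩ := Finset.mem_image.1 h
      exact hallowed A hA p' hp'
    · intro h
      refine ⟨supp N p.1, hforest p h, Finset.mem_image.2 ⟨_, (hparts p h).1, ?_⟩⟩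
      refine Prod.ext ?_ rfl
      simp only
      rw [(hparts p h).2]
      exact eq_add_marks.symm
  refine ⟨X, hmem, fun t => ?_⟩
  rw [← Finset.sum_fiberwise_of_maps_to (g := fun p => supp N p.1) (t := G.forests N)
    (fun p hp => hforest p ((hmem p).1 hp))]
  refine Finset.sum_congr rfl fun A hA => ?_
  obtain ⟨-, hN, hAF⟩ := Finset.mem_filter.1 hA
  rw [← sum_marks hAF, Finset.mul_sum]
  symm
  refine Finset.sum_bij (fun p _ => ((A \ N).val + ∑ q, p.1 q, p.2)) ?_ ?_ ?_ ?_
  · intro p hp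
    rw [Finset.mem_filter, hmem]
    exact ⟨hallowed A hA p hp, supp_add hN (hQs A p hp)⟩
  · intro p hp p' hp' h
    obtain ⟨h1, h2⟩ := Prod.ext_iff.1 h
    refine Prod.ext (funext fun q => ?_) h2
    have h1 := add_left_cancel h1
    rw [← part_sum (hQA A p hp) q, h1, part_sum (hQA A p' hp') q]
  · rintro p hp
    rw [Finset.mem_filter, hmem] at hp
    obtain ⟨hp, rfl⟩ := hp
    refine ⟨_, (hparts p hp).1, Prod.ext ?_ rfl⟩
    simp only
    rw [(hparts p hp).2]
    exact eq_add_marks.symm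
  · intro p hp
    simp only
    rw [← pow_add, Multiset.card_add, Finset.card_val, Finset.card_sdiff_of_subset hN, add_assoc]

end Monomials

end Graph

/-! ### The admissible monomials form an order ideal -/

namespace Graph

variable {α β : Type*} {G : Graph α β} {F F' : Set β} {x y z u v w : α}
  {e f g : β} {σ τ ρ μ μ' : Multiset β} {c : α → Fin 3} {l l' : Lab}

theorem lab_eq_one (hF : G.IsForest F) (hfin : F.Finite) (h : Multiset.card σ ≤ 1) :
    G.lab F c σ = 1 := by
  obtain ⟨d, hd⟩ := hF.exists_isDist hfin
  exact hd.lab_eq hF (.one h)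

theorem card_le_three (h : G.lab F c σ ≠ 0) : Multiset.card σ ≤ 3 := by
  have h1 := (hasLab_lab h).card
  have h2 := Lab.rank_le (G.lab F c σ)
  omega

/-- The component of the larger graph that contains a component. -/
def compMap (G : Graph α β) (h : F ⊆ F') : G.Comp F → G.Comp F' :=
  Quotient.map id fun _ _ hj => Joined.mono hj h

theorem compMap_comp (h : F ⊆ F') : G.compMap h (G.comp F x) = G.comp F' x := rfl

theorem AtComp.map (h : F ⊆ F') {q : G.Comp F} (he : G.AtComp F q e) :
    G.AtComp F' (G.compMap h q) e := by
  obtain ⟨y, hy, rfl⟩ := he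
  exact ⟨y, hy, rfl⟩

theorem part_le_part (h : F ⊆ F') (hμ : μ ≤ μ') (q : G.Comp F) :
    G.part F q μ ≤ G.part F' (G.compMap h q) μ' := by
  classical
  unfold part
  exact (Multiset.filter_le_filter _ hμ).trans
    (Multiset.monotone_filter_right _ fun e he => AtComp.map h he)

theorem part_add_part_le (h : F ⊆ F') (hμ : μ ≤ μ') (hμF : ∀ e ∈ μ, e ∈ F) {q q' : G.Comp F}
    (hne : q ≠ q') (hq : G.compMap h q = G.compMap h q') :
    G.part F q μ + G.part F q' μ ≤ G.part F' (G.compMap h q) μ' := by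
  classical
  unfold part
  rw [Multiset.filter_add_filter]
  have h0 : Multiset.filter (fun e => G.AtComp F q e ∧ G.AtComp F q' e) μ = 0 := by
    rw [Multiset.filter_eq_nil]
    exact fun e he h => hne (atComp_unique (hμF e he) h.1 h.2)
  rw [h0, add_zero]
  refine (Multiset.filter_le_filter _ hμ).trans (Multiset.monotone_filter_right _ fun e he => ?_)
  rcases he with he | he
  · exact AtComp.map h he
  · rw [hq]; exact AtComp.map h he

/-- A component of the larger forest may contain several components of the smaller one. As it has at
most three marks, at most one of these has two or more; all the others have label 1, and
`HasLab.dvd` treats the remaining one. -/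
theorem prodLab_dvd [Finite α] [Finite β] (hF' : G.IsForest F') (h : F ⊆ F') (hμ : μ ≤ μ')
    (hμF : ∀ e ∈ μ, e ∈ F) (h0 : G.prodLab F' c μ' ≠ 0) :
    G.prodLab F c μ ∣ G.prodLab F' c μ' := by
  classical
  have hfin := Set.toFinite F'
  have hF := hF'.subset h
  obtain ⟨d, hd⟩ := hF.exists_isDist (Set.toFinite F)
  unfold prodLab
  rw [← Finset.prod_fiberwise (g := G.compMap h)]
  refine Finset.prod_dvd_prod_of_dvd _ _ fun Q _ => ?_
  have hQ : G.lab F' c (G.part F' Q μ') ≠ 0 := fun h1 =>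
    h0 (by rw [prodLab, Finset.prod_eq_zero (Finset.mem_univ Q) h1])
  have h3 := card_le_three hQ
  by_cases hall : ∀ q, G.compMap h q = Q → Multiset.card (G.part F q μ) ≤ 1
  · rw [Finset.prod_eq_one]
    · exact one_dvd _
    · intro q hq
      exact lab_eq_one hF (Set.toFinite F) (hall q (Finset.mem_filter.1 hq).2)
  push Not at hall
  obtain ⟨q, rfl, hq⟩ := hall
  rw [Finset.prod_eq_single q]
  · obtain ⟨x, rfl⟩ := comp_surjective q
    obtain ⟨l', h1, h2⟩ := (hasLab_lab hQ).dvd hF' hfin h (part_le_part h hμ _) (inComp_part hμF)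
    rw [hd.lab_eq hF h1]
    exact h2
  · intro q' hq' hne
    refine lab_eq_one hF (Set.toFinite F) ?_
    have := Multiset.card_le_card (part_add_part_le h hμ hμF hne.symm (Finset.mem_filter.1 hq').2.symm)
    rw [Multiset.card_add] at this
    omega
  · exact fun h1 => (h1 (Finset.mem_filter.2 ⟨Finset.mem_univ q, rfl⟩)).elim

/-- A divisor of a nonzero label is nonzero. -/
theorem Allowed.mono [Finite α] [Finite β] {N : Finset β} {zl : ℕ → Lab} {p p' : Multiset β × ℕ}
    (hzl : ∀ k k', k' ≤ k → zl k' ∣ zl k) (h : G.Allowed N c zl p) (hp : p' ≤ p) :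
    G.Allowed N c zl p' := by
  obtain ⟨h1, h2⟩ := h
  have hs : (supp N p'.1 : Set β) ⊆ supp N p.1 := Finset.coe_subset.2 (supp_mono hp.1)
  refine ⟨h1.subset hs, fun h0 => h2 ?_⟩
  have h3 := prodLab_dvd (c := c) h1 hs (marks_mono hp.1) (fun e he => mem_supp_of_mem_marks he)
    (right_ne_zero_of_mul h2)
  exact zero_dvd_iff.1 (h0 ▸ mul_dvd_mul (hzl _ _ hp.2) h3)

end Graph

theorem Multiset.pair_eq_add {β : Type*} (e f : β) : ({e, f} : Multiset β) = {e} + {f} := rfl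

theorem Multiset.triple_eq_add {β : Type*} (e f g : β) :
    ({e, f, g} : Multiset β) = {e} + {f} + {g} := by
  rw [add_assoc]; rfl

/-! ### Extending a bicoloured pair to a triple -/

namespace Graph

variable {α β : Type*} {G : Graph α β} {F F' : Set β} {x y z u v w p s t : α}
  {e f g : β} {d : α → α → ℕ} {σ τ ρ : Multiset β} {c : α → Fin 3} {i j k : Fin 3}

namespace IsDist

variable (hd : G.IsDist F d) (hF : G.IsForest F)

include hd hF

/-- From `p` the search goes back towards `s` as long as the colour is `k`; this does not change the
exit edge. It stops at a vertex of another colour or at `s`, which is a vertex that the exit edge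
can encode. -/
theorem exists_exit_back (hst : G.Joined F s t) (n : ℕ) : ∀ p, d s p = n → G.Joined F s p →
    d s p + d p t = d s t → G.Exit F c k t p e → ∃ v, G.Joined F s v ∧ d s v + d v t = d s t ∧
      d s v ≤ d s p ∧ (v = s ∨ c v ≠ k) ∧ G.Exit F c k t v e := by
  induction n with
  | zero =>
    intro p hn hsp hp he
    exact ⟨p, hsp, hp, le_rfl, Or.inl (hd.eq_of_zero hsp hn).symm, he⟩
  | succ n ih =>
    intro p hn hsp hp he
    by_cases hk : c p = k
    · obtain ⟨q, f, hq⟩ := hd.exists_step hsp.symm (y := s) (by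
        rintro rfl; rw [hd.self] at hn; omega)
      have h1 := hd.succ_of_step hF hq
      have h2 := hd.symm q s
      have h3 := hd.symm p s
      have hpq := Joined.of_link hq.1 hq.2.1
      have hsq := hsp.trans hpq
      have h4 := hd.tri hsq hst
      have h5 := hd.tri hsq.symm (hsq.symm.trans hst)
      have h6 := hd.link f hq.1 p q hq.2.1
      have h7 := hd.tri hpq (hsp.symm.trans hst)
      have h8 : d p t + 1 = d q t := by omega
      obtain ⟨v, h9, h10, h11, h12⟩ := ih q (by omega) hsq (by omega)
        (.go (hd.step_of hq.1 hq.2.1.symm (hsq.symm.trans hst) h8) hk he)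
      exact ⟨v, h9, h10, by omega, h12⟩
    · exact ⟨p, hsp, hp, le_rfl, Or.inr hk, he⟩

theorem first_of_between (h : G.First F s v e) (hst : G.Joined F s t)
    (hv : d s v + d v t = d s t) : G.First F s t e := by
  obtain ⟨z, hz⟩ := h
  have hsz := Joined.of_link hz.1 hz.2.1
  have h1 := hd.succ_of_step hF hz
  have h2 := hd.link _ hz.1 _ _ hz.2.1
  have h3 := hd.tri (hsz.symm.trans hz.joined).symm (hz.joined.symm.trans hst)
  have h4 := hd.tri hsz.symm (hsz.symm.trans hst)
  have h5 := hd.tri hsz hst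
  have h6 := hd.symm v z
  have h7 := hd.symm z s
  exact ⟨z, hd.step_of hz.1 hz.2.1 hst (by omega)⟩

/-- A bicoloured pair with a vertex of the third colour on its path extends to a triple. -/
theorem exists_triple_of_on_path (he : G.First F u w e) (hf : G.First F w u f)
    (hv : G.Joined F u v) (hb : d u v + d v w = d u w) (hu : c u = 0) (hw : c w = j) (hc : c v = i)
    (hij : (i = 1 ∧ j = 2) ∨ (i = 2 ∧ j = 1)) :
    ∃ g ∈ F, G.AtComp F (G.comp F u) g ∧ G.IsTriple F c ({e, f} + {g}) := by
  have huw := he.joined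
  have hwv := huw.symm.trans hv
  have hne : v ≠ u := by
    rintro rfl
    rcases hij with ⟨rfl, rfl⟩ | ⟨rfl, rfl⟩ <;> rw [hu] at hc <;> exact absurd hc (by decide)
  obtain ⟨g, hg⟩ := hd.exists_exit (c := c) (k := c w) (t := u) hF
    (by rcases hij with ⟨rfl, rfl⟩ | ⟨rfl, rfl⟩ <;> rw [hu, hw] <;> decide) _ v rfl hv.symm hne
  obtain ⟨a, b, hs, -, -, -, hja, -⟩ := hd.exit_spec hF hg
  refine ⟨g, hs.1, ⟨a, ⟨b, hs.2.1⟩, comp_eq_iff.2 (hja.symm.trans hv.symm)⟩, Or.inr ⟨w, v, u, ?_,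
    f, e, g, hf, he, hg, ?_, ?_⟩⟩
  · rcases hij with ⟨rfl, rfl⟩ | ⟨rfl, rfl⟩
    · exact Or.inr (Or.inl ⟨hw, hc, hu⟩)
    · exact Or.inl ⟨hw, hc, hu⟩
  · rw [hd.between_iff hF hwv huw.symm, hd.symm w v, hd.symm v u, hd.symm w u]; omega
  · rw [Multiset.triple_eq_add, Multiset.pair_eq_add]; abel

/-- A bicoloured pair without a vertex of the third colour on its path extends to a triple, by the
first edge from any vertex of the third colour. -/
theorem triple_of_not_on_path (he : G.First F u w e) (hf : G.First F w u f) (hg : G.First F x u g)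
    (hno : ∀ v, G.Joined F u v → d u v + d v w = d u w → c v ≠ i)
    (hu : c u = 0) (hw : c w = j) (hc : c x = i)
    (hij : (i = 1 ∧ j = 2) ∨ (i = 2 ∧ j = 1)) : G.IsTriple F c ({e, f} + {g}) := by
  have huw := he.joined
  have hux := hg.joined.symm
  have hwx := huw.symm.trans hux
  have s1 := hd.symm u w
  have s2 := hd.symm u x
  have s3 := hd.symm w x
  have h1 : ¬ G.Between F u x w := fun h =>
    hno x hux ((hd.between_iff hF hux huw).1 h) hc
  -- Order `x, w, u`: this is a path triple from `x` to `u` with middle vertex `w`, and the exit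
  -- edge of `w` is its first edge `f`, because colour `i` does not occur between `w` and `u`.
  by_cases h2 : G.Between F x w u
  · have k2 := (hd.between_iff hF hwx.symm hux.symm).1 h2
    obtain ⟨z, hz⟩ := hf
    have l1 := hd.succ_of_step hF hz
    have l2 := hd.link _ hz.1 _ _ hz.2.1
    have l3 := hd.symm w z
    have l4 := hd.symm u z
    have hcz : c z ≠ c x := by
      rw [hc]; exact hno z (huw.trans (Joined.of_link hz.1 hz.2.1)) (by omega)
    refine Or.inr ⟨x, w, u, ?_, g, e, f, hg, hd.first_of_between hF he hux (by omega),
      .leave hz hcz, h2, ?_⟩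
    · rcases hij with ⟨rfl, rfl⟩ | ⟨rfl, rfl⟩
      · exact Or.inl ⟨hc, hw, hu⟩
      · exact Or.inr (Or.inl ⟨hc, hw, hu⟩)
    · rw [Multiset.triple_eq_add, Multiset.pair_eq_add]; abel
  -- Order `x, u, w`: the ends have colours 1 and 2, so the direction of the path triple depends on
  -- `i`.
  by_cases h3 : G.Between F x u w
  · have k3 := (hd.between_iff hF hux.symm hwx.symm).1 h3
    obtain ⟨z, hz⟩ := id he
    have l1 := hd.succ_of_step hF hz
    have l2 := hd.link _ hz.1 _ _ hz.2.1
    have l3 := hd.symm w z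
    have l4 := hd.symm u z
    have huz := Joined.of_link hz.1 hz.2.1
    have l5 := hd.tri huz.symm (huz.symm.trans hux)
    have l6 := hd.tri (huw.symm.trans huz).symm (huz.symm.trans hux)
    have hgxw := hd.first_of_between hF hg hwx.symm k3
    have hfwx := hd.first_of_between hF hf hwx (by omega)
    have hcz : c z ≠ i := hno z huz (by omega)
    rcases hij with ⟨rfl, rfl⟩ | ⟨rfl, rfl⟩
    · refine Or.inr ⟨x, u, w, Or.inr (Or.inr (Or.inl ⟨hc, hu, hw⟩)), g, f, e, hgxw, hfwx,
        .leave hz (by rw [hc]; exact hcz), h3, ?_⟩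
      rw [Multiset.triple_eq_add, Multiset.pair_eq_add]; abel
    · have hwz := huw.symm.trans huz
      have hzx := huz.symm.trans hux
      have l7 := hd.tri huz hux
      -- Here the triple runs from `w` to `x`, and `e` is the exit edge of the neighbour `z` of `u`.
      -- Going back from `z` leads to a vertex of colour 0, or to `w` itself; the second outcome is
      -- the case in which the degenerate triples are needed.
      have hex : G.Exit F c 1 x z e := .leave (hd.step_of hz.1 hz.2.1.symm hzx (by omega))
        (by rw [hu]; decide)
      obtain ⟨v, hjv, m1, m2, m3, m4⟩ := hd.exists_exit_back hF hwx _ z rfl hwz (by omega) hex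
      have l8 := hd.dist_on_path hF hwx hjv hwz m1 (by omega)
      have l9 := hd.tri (hjv.symm.trans hwz).symm huz.symm
      have l10 := hd.tri hjv.symm (hjv.symm.trans huw.symm)
      have l11 := hd.symm z v
      have l12 := hd.symm w v
      have l13 := hd.symm v u
      refine Or.inr ⟨w, v, x, ?_, f, g, e, hfwx, hgxw, by rw [hw]; exact m4,
        (hd.between_iff hF hjv hwx).2 m1, ?_⟩
      · rcases m3 with rfl | m3
        · exact Or.inr (Or.inr (Or.inr ⟨hw, rfl, hc⟩))
        · have := hno v (huw.trans hjv) (by omega)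
          exact Or.inr (Or.inr (Or.inl ⟨hw, by omega, hc⟩))
      · rw [Multiset.triple_eq_add, Multiset.pair_eq_add]; abel
  · have h4 : ¬ G.Between F w x u := by
      rw [hd.between_iff hF hwx huw.symm]
      rw [hd.between_iff hF hux huw] at h1
      omega
    have h5 : ¬ G.Between F w u x := by
      rw [hd.between_iff hF huw.symm hwx]
      rw [hd.between_iff hF hux.symm hwx.symm] at h3
      omega
    have h6 : ¬ G.Between F u w x := by
      rw [hd.between_iff hF huw hux]
      rw [hd.between_iff hF hwx.symm hux.symm] at h2
      omega
    rcases hij with ⟨rfl, rfl⟩ | ⟨rfl, rfl⟩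
    · obtain ⟨σ, h⟩ := hd.exists_tripod hF hux huw h3 h4 h2
      have h' := h
      obtain ⟨e', g', f', q1, q2, q3, q4, q5, q6, rfl⟩ := h
      obtain rfl := hd.first_unique hF q2 he
      obtain rfl := hd.first_unique hF q3 hg
      obtain rfl := hd.first_unique hF q5 hf
      refine Or.inl ⟨u, x, w, hu, hc, hw, ?_⟩
      convert h' using 1
      rw [Multiset.triple_eq_add, Multiset.pair_eq_add]; abel
    · obtain ⟨σ, h⟩ := hd.exists_tripod hF huw hux h5 h2 h4
      have h' := h
      obtain ⟨e', f', g', q1, q2, q3, q4, q5, q6, rfl⟩ := h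
      obtain rfl := hd.first_unique hF q1 he
      obtain rfl := hd.first_unique hF q3 hf
      obtain rfl := hd.first_unique hF q5 hg
      refine Or.inl ⟨u, w, x, hu, hw, hc, ?_⟩
      rw [Multiset.pair_eq_add, ← Multiset.triple_eq_add]
      exact h'

end IsDist

end Graph

/-! ### Labels after adding one mark or one edge -/

namespace Lab

theorem eq_one_of_mul : ∀ a b : Lab, a * b = 1 → a = 1 ∧ b = 1 := by decide

theorem eq_pair_of_mul : ∀ (i j : Fin 3) (a b : Lab), i ≠ j → a * b = pair i j →
    (a = pair i j ∧ b = 1) ∨ (a = 1 ∧ b = pair i j) := by decide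

variable {ι : Type*} {f : ι → Lab}

theorem prod_eq_one (s : Finset ι) (h : ∏ q ∈ s, f q = 1) : ∀ q ∈ s, f q = 1 := by
  classical
  intro q hq
  rw [← Finset.mul_prod_erase s f hq] at h
  exact (eq_one_of_mul _ _ h).1

theorem prod_eq_pair (s : Finset ι) {i j : Fin 3} (hij : i ≠ j) (h : ∏ q ∈ s, f q = pair i j) :
    ∃ q ∈ s, f q = pair i j ∧ ∀ q' ∈ s, q' ≠ q → f q' = 1 := by
  classical
  induction s using Finset.induction_on with
  | empty =>
    rw [Finset.prod_empty] at h
    exact absurd h ((by decide : ∀ i j : Fin 3, (1 : Lab) ≠ pair i j) i j)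
  | insert a s ha ih =>
    rw [Finset.prod_insert ha] at h
    rcases eq_pair_of_mul i j _ _ hij h with ⟨h1, h2⟩ | ⟨h1, h2⟩
    · refine ⟨a, Finset.mem_insert_self _ _, h1, fun q hq hne => ?_⟩
      exact prod_eq_one s h2 q (Finset.mem_of_mem_insert_of_ne hq hne)
    · obtain ⟨q, hq, h3, h4⟩ := ih h2
      refine ⟨q, Finset.mem_insert_of_mem hq, h3, fun q' hq' hne => ?_⟩
      rcases Finset.mem_insert.1 hq' with rfl | hq'
      · exact h1
      · exact h4 q' hq' hne

end Lab

namespace Graph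

variable {α β : Type*} {G : Graph α β} {F F' : Set β} {x y z u v w p s t : α}
  {e f g : β} {d : α → α → ℕ} {σ τ ρ μ : Multiset β} {c : α → Fin 3} {i j k : Fin 3}

/-- The label of marks inside one component does not change when the component becomes part of a
larger tree. -/
theorem lab_eq_of_subset (hF' : G.IsForest F') (hfin : F'.Finite) (h : F ⊆ F')
    (hσ : G.InComp F x σ) : G.lab F' c σ = G.lab F c σ := by
  obtain ⟨d', hd'⟩ := hF'.exists_isDist hfin
  obtain ⟨d, hd⟩ := (hF'.subset h).exists_isDist (hfin.subset h)
  by_cases h0 : G.lab F c σ = 0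
  · rw [h0]
    by_contra hne
    obtain ⟨l, hl, -⟩ := (hasLab_lab hne).dvd hF' hfin h le_rfl hσ
    rw [hd.lab_eq (hF'.subset h) hl] at h0
    exact hl.ne_zero h0
  · exact hd'.lab_eq hF' ((hasLab_lab h0).mono h)

theorem atComp_map_iff (h : F ⊆ F') {Q : G.Comp F'} :
    G.AtComp F' Q e ↔ ∃ q, G.compMap h q = Q ∧ G.AtComp F q e := by
  constructor
  · rintro ⟨y, hy, rfl⟩
    exact ⟨G.comp F y, rfl, y, hy, rfl⟩
  · rintro ⟨q, rfl, hq⟩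
    exact hq.map h

theorem part_add_singleton_self {q : G.Comp F} (h : G.AtComp F q g) :
    G.part F q (μ + {g}) = G.part F q μ + {g} := by
  classical
  rw [part, part, Multiset.filter_add, Multiset.filter_singleton, if_pos h]

theorem part_add_singleton_of_not {q : G.Comp F} (h : ¬ G.AtComp F q g) :
    G.part F q (μ + {g}) = G.part F q μ := by
  classical
  rw [part, part, Multiset.filter_add, Multiset.filter_singleton, if_neg h]
  exact add_zero _

variable [Finite α]

open Classical in
theorem prodLab_eq_mul (q : G.Comp F) : G.prodLab F c μ =
    G.lab F c (G.part F q μ) * ∏ q' ∈ Finset.univ.erase q, G.lab F c (G.part F q' μ) := by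
  rw [prodLab, ← Finset.mul_prod_erase _ _ (Finset.mem_univ q)]

open Classical in
theorem prodLab_add_singleton (hg : g ∈ F) {q : G.Comp F} (hq : G.AtComp F q g) :
    G.prodLab F c (μ + {g}) = G.lab F c (G.part F q μ + {g}) *
      ∏ q' ∈ Finset.univ.erase q, G.lab F c (G.part F q' μ) := by
  rw [prodLab_eq_mul q, part_add_singleton_self hq]
  congr 1
  refine Finset.prod_congr rfl fun q' hq' => ?_
  rw [part_add_singleton_of_not]
  exact fun h => (Finset.mem_erase.1 hq').1 (atComp_unique hg h hq)

open Classical in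
-- The components of `x` and `y` merge and their marks are combined; the other components correspond
-- bijectively and keep their labels.
theorem prodLab_insert [Finite β] (hF : G.IsForest F) (hl : G.IsLink e x y)
    (hxy : ¬ G.Joined F x y) (hμ : ∀ e ∈ μ, e ∈ F) : G.prodLab (insert e F) c μ =
    G.lab (insert e F) c (G.part F (G.comp F x) μ + G.part F (G.comp F y) μ) *
      ∏ q ∈ (Finset.univ.erase (G.comp F x)).erase (G.comp F y), G.lab F c (G.part F q μ) := by
  have h : F ⊆ insert e F := Set.subset_insert e F
  have hF' := hF.insertEdge hl hxy
  have hne : G.comp F x ≠ G.comp F y := fun h => hxy (comp_eq_iff.1 h)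
  have hmap : ∀ q q', G.compMap h q = G.compMap h q' → q = q' ∨
      ((q = G.comp F x ∨ q = G.comp F y) ∧ (q' = G.comp F x ∨ q' = G.comp F y)) := by
    intro q q' hq
    obtain ⟨a, rfl⟩ := comp_surjective q
    obtain ⟨b, rfl⟩ := comp_surjective q'
    rw [compMap_comp, compMap_comp, comp_eq_iff, joined_insert_iff hl] at hq
    simp only [comp_eq_iff]
    rcases hq with hq | hq | hq
    · exact Or.inl hq
    · exact Or.inr ⟨Or.inl hq.1, Or.inr hq.2.symm⟩
    · exact Or.inr ⟨Or.inr hq.1, Or.inl hq.2.symm⟩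
  have hxy' : G.compMap h (G.comp F x) = G.compMap h (G.comp F y) := by
    rw [compMap_comp, compMap_comp, comp_eq_iff]
    exact Joined.of_link (Set.mem_insert _ _) hl
  have hpart : G.part (insert e F) (G.compMap h (G.comp F x)) μ =
      G.part F (G.comp F x) μ + G.part F (G.comp F y) μ := by
    unfold part
    rw [Multiset.filter_add_filter]
    have h0 : Multiset.filter (fun e => G.AtComp F (G.comp F x) e ∧ G.AtComp F (G.comp F y) e) μ
        = 0 := by
      rw [Multiset.filter_eq_nil]
      exact fun e he h => hne (atComp_unique (hμ e he) h.1 h.2)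
    rw [h0, add_zero]
    refine Multiset.filter_congr fun f hf => ?_
    rw [atComp_map_iff h]
    constructor
    · rintro ⟨q, hq, hf'⟩
      rcases hmap q _ hq with rfl | ⟨rfl | rfl, -⟩
      exacts [Or.inl hf', Or.inl hf', Or.inr hf']
    · rintro (hf' | hf')
      exacts [⟨_, rfl, hf'⟩, ⟨_, hxy'.symm, hf'⟩]
  rw [prodLab_eq_mul (G.compMap h (G.comp F x)), hpart]
  congr 1
  symm
  refine Finset.prod_bij (fun q _ => G.compMap h q) ?_ ?_ ?_ ?_
  · intro q hq
    simp only [Finset.mem_erase, Finset.mem_univ, and_true] at hq ⊢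
    intro hq'
    rcases hmap _ _ hq' with h1 | ⟨h1 | h1, -⟩
    exacts [hq.2 h1, hq.2 h1, hq.1 h1]
  · intro q hq q' hq' h1
    simp only [Finset.mem_erase, Finset.mem_univ, and_true] at hq
    rcases hmap _ _ h1 with h1 | ⟨h1 | h1, -⟩
    exacts [h1, absurd h1 hq.2, absurd h1 hq.1]
  · intro Q hQ
    obtain ⟨a, rfl⟩ := comp_surjective Q
    simp only [Finset.mem_erase, Finset.mem_univ, and_true] at hQ
    refine ⟨G.comp F a, ?_, rfl⟩
    simp only [Finset.mem_erase, Finset.mem_univ, and_true]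
    refine ⟨fun h1 => hQ ?_, fun h1 => hQ ?_⟩
    · rw [← compMap_comp h, h1, hxy']
    · rw [← compMap_comp h, h1]
  · intro q hq
    simp only [Finset.mem_erase, Finset.mem_univ, and_true] at hq
    have hp : G.part (insert e F) (G.compMap h q) μ = G.part F q μ := by
      refine Multiset.filter_congr fun f hf => ?_
      rw [atComp_map_iff h]
      constructor
      · rintro ⟨q', hq', hf'⟩
        rcases hmap q' _ hq' with rfl | ⟨-, h1 | h1⟩
        exacts [hf', absurd h1 hq.2, absurd h1 hq.1]
      · exact fun hf' => ⟨q, rfl, hf'⟩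
    obtain ⟨a, rfl⟩ := comp_surjective q
    rw [hp, lab_eq_of_subset hF' (Set.toFinite _) h (inComp_part hμ)]

end Graph

/-! ### The additional variable -/

/-- The labels of the powers of the additional variable, if there is one. -/
def zlab : Bool → ℕ → Lab
  | false, 0 => 1
  | false, _ + 1 => 0
  | true, 0 => 1
  | true, 1 => Lab.x12
  | true, 2 => Lab.top
  | true, _ + 3 => 0

theorem zlab_zero (b : Bool) : zlab b 0 = 1 := by cases b <;> rfl

theorem zlab_dvd (b : Bool) (k k' : ℕ) (h : k' ≤ k) : zlab b k' ∣ zlab b k := by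
  match b, k, h with
  | b, 0, h => rw [Nat.le_zero.1 h]
  | false, k + 1, _ => exact dvd_zero (zlab false k')
  | true, 1, h => interval_cases k' <;> simp only [zlab, one_dvd, dvd_refl]
  | true, 2, h =>
    interval_cases k'
    · exact one_dvd _
    · exact ⟨Lab.x01, rfl⟩
    · exact dvd_rfl
  | true, k + 3, _ => exact dvd_zero (zlab true k')

theorem rank_zlab (b : Bool) (k : ℕ) (h : zlab b k ≠ 0) : (zlab b k).rank = k := by
  match b, k, h with
  | b, 0, h => cases b <;> rfl
  | false, k + 1, h => exact (h rfl).elim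
  | true, 1, h => rfl
  | true, 2, h => rfl
  | true, k + 3, h => exact (h rfl).elim

theorem lt_of_zlab_ne_zero (b : Bool) (k : ℕ) (h : zlab b k ≠ 0) : k < 3 := by
  have := Graph.Lab.rank_le (zlab b k)
  rw [rank_zlab b k h] at this
  omega

theorem zlab_false {k : ℕ} (h : zlab false k ≠ 0) : k = 0 := by
  cases k with
  | zero => rfl
  | succ k => exact (h rfl).elim

/-! ### Maximal admissible monomials -/

namespace Graph

variable {α β : Type*} {G : Graph α β} {F F' A : Set β} {x y z u v w p s t a b x' y' : α}
  {e f g : β} {d : α → α → ℕ} {σ τ ρ μ μ' : Multiset β} {c : α → Fin 3} {i j : Fin 3} {k k' : ℕ}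

/-- The only edges at `x` are loops. -/
def Isolated (G : Graph α β) (x : α) : Prop := ∀ e y, G.IsLink e x y → y = x

theorem Isolated.eq_of_joined (h : G.Isolated x) (hj : G.Joined F x y) : y = x := by
  induction hj with
  | refl => rfl
  | tail _ hs ih =>
    obtain ⟨e, -, hl⟩ := hs
    rw [ih] at hl
    exact h e _ hl

theorem exists_first_of_atComp (hF : G.IsForest F) (hfin : F.Finite) (hg : g ∈ F)
    (hx : G.AtComp F (G.comp F x) g) : ∃ u, G.First F u x g := by
  obtain ⟨d, hd⟩ := hF.exists_isDist hfin
  obtain ⟨y, ⟨z, hl⟩, hq⟩ := hx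
  have hj : G.Joined F y x := comp_eq_iff.1 hq
  have h1 := hd.link g hg y z hl
  have hyz := Joined.of_link hg hl
  have h2 := hd.parity y z x hyz hj
  have h3 := hd.tri hyz hj
  have h4 := hd.tri hyz.symm (hyz.symm.trans hj)
  have h5 := hd.symm y z
  by_cases h : d z x + 1 = d y x
  · exact ⟨y, z, hd.step_of hg hl hj h⟩
  · exact ⟨z, y, hd.step_of hg hl.symm (hyz.symm.trans hj) (by omega)⟩

theorem Joined.sdiff_of_not_joined (hg : g ∈ F) (hl : G.IsLink g u v) (hn : ¬ G.Joined F y u)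
    (h : G.Joined F y z) : G.Joined (F \ {g}) y z := by
  rcases h.split hl with h1 | ⟨h1, -⟩ | ⟨h1, -⟩
  · exact h1
  · exact absurd (h1.mono Set.sdiff_subset) hn
  · exact absurd ((h1.mono Set.sdiff_subset).trans (Joined.of_link hg hl).symm) hn

/-- An edge that starts the path to `x` also starts the path to everything reached through the new
edge at `x`. -/
theorem First.insert_link (h : G.First F u x g) (hl : G.IsLink e x y) (hxy : ¬ G.Joined F x y)
    (hy : G.Joined F y v) : G.First (insert e F) u v g := by
  obtain ⟨z, hg, hz, hj⟩ := h
  have hge : e ≠ g := by rintro rfl; exact hxy (Joined.of_link hg hl)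
  have hsub : F \ {g} ⊆ insert e F \ {g} := Set.sdiff_subset_sdiff_left (Set.subset_insert _ _)
  have hzx := hj.mono (Set.sdiff_subset (t := {g}))
  have hyz : ¬ G.Joined F y z := fun h => hxy (h.trans hzx).symm
  have hl' : G.Joined (insert e F \ {g}) x y := Joined.of_link ⟨Set.mem_insert _ _, hge⟩ hl
  exact ⟨z, Set.mem_insert_of_mem _ hg, hz, (hj.mono hsub).trans
    (hl'.trans ((hy.sdiff_of_not_joined hg hz.symm hyz).mono hsub))⟩

/-- Otherwise every vertex on the side of `b` has the value of `a`, and every vertex on the side of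
`a` has the value of `b`. Taking `b` itself shows that `χ` is constant on the component. -/
theorem exists_first_of_ne {κ : Type*} {χ : α → κ} (hl : G.IsLink g a b) (hg : g ∈ F)
    (hu : G.Joined F a u) (hv : G.Joined F a v) (hne : χ u ≠ χ v) :
    ∃ u' v', G.First F u' v' g ∧ χ u' ≠ χ v' := by
  by_contra! hcon
  have h1 : ∀ w, G.Joined (F \ {g}) b w → χ a = χ w := fun w hw => hcon a w ⟨b, hg, hl, hw⟩
  have h2 : ∀ w, G.Joined (F \ {g}) a w → χ b = χ w := fun w hw => hcon b w ⟨a, hg, hl.symm, hw⟩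
  have h3 : ∀ w, G.Joined F a w → χ w = χ a := by
    intro w hw
    rcases hw.split hl with h | ⟨-, h⟩ | ⟨-, h⟩
    · rw [← h2 w h, h1 b Joined.rfl']
    · exact (h1 w h).symm
    · rw [← h2 w h, h1 b Joined.rfl']
  exact hne ((h3 u hu).trans (h3 v hv).symm)

theorem exists_link_ne {κ : Type*} {χ : α → κ} (h : G.Joined F u v) (hne : χ u ≠ χ v) :
    ∃ e ∈ F, ∃ x y, G.IsLink e x y ∧ χ x ≠ χ y := by
  by_contra! hcon
  refine hne ?_
  induction h with
  | refl => rfl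
  | @tail p q _ hs ih =>
    obtain ⟨e, he, hl⟩ := hs
    by_cases h : χ u = χ p
    · exact h.trans (hcon e he _ _ hl)
    · exact absurd (ih h) h

theorem card_le_one_of_lab (h : G.lab F c σ = 1) : Multiset.card σ ≤ 1 := by
  have h1 : G.lab F c σ ≠ 0 := by rw [h]; decide
  have h2 := (hasLab_lab h1).card
  rw [h] at h2
  have h3 : Lab.rank 1 = 0 := rfl
  omega

theorem eq_zero_or_singleton_of_lab (h : G.lab F c σ = 1) : σ = 0 ∨ ∃ g, σ = {g} := by
  have := card_le_one_of_lab h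
  rcases Nat.eq_zero_or_pos (Multiset.card σ) with h1 | h1
  · exact Or.inl (Multiset.card_eq_zero.1 h1)
  · exact Or.inr (Multiset.card_eq_one.1 (by omega))

/-- If both components have one mark, these become the first and the last edge of a path across the
new edge, and its ends have different colours by `hcol`. With fewer marks the label stays trivial.
-/
theorem lab_merge (hF : G.IsForest F) (hfin : F.Finite) (hl : G.IsLink e x y)
    (hxy : ¬ G.Joined F x y) (hσ : G.InComp F x σ) (hτ : G.InComp F y τ) (h1 : G.lab F c σ = 1)
    (h2 : G.lab F c τ = 1)
    (hcol : ∀ x' y', G.Joined F x x' → G.Joined F y y' → c x' ≠ c y') :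
    G.lab (insert e F) c (σ + τ) = 1 ∨ ∃ x' y', G.Joined F x x' ∧ G.Joined F y y' ∧
      G.lab (insert e F) c (σ + τ) = Lab.pair (c x') (c y') := by
  have hF' := hF.insertEdge hl hxy
  have hfin' := hfin.insert e
  obtain ⟨d, hd⟩ := hF'.exists_isDist hfin'
  rcases eq_zero_or_singleton_of_lab h1 with rfl | ⟨g, rfl⟩
  · refine Or.inl (lab_eq_one hF' hfin' ?_)
    rw [zero_add]; exact card_le_one_of_lab h2
  rcases eq_zero_or_singleton_of_lab h2 with rfl | ⟨f, rfl⟩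
  · refine Or.inl (lab_eq_one hF' hfin' ?_)
    rw [add_zero]; exact card_le_one_of_lab h1
  right
  obtain ⟨hg, hg'⟩ : g ∈ F ∧ G.AtComp F (G.comp F x) g := inComp_iff.1 hσ g (by simp)
  obtain ⟨hf, hf'⟩ : f ∈ F ∧ G.AtComp F (G.comp F y) f := inComp_iff.1 hτ f (by simp)
  obtain ⟨x', hx'⟩ := exists_first_of_atComp hF hfin hg hg'
  obtain ⟨y', hy'⟩ := exists_first_of_atComp hF hfin hf hf'
  have jx := hx'.joined.symm
  have jy := hy'.joined.symm
  exact ⟨x', y', jx, jy, hd.lab_eq hF' (.pair ⟨g, f, hx'.insert_link hl hxy jy,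
    hy'.insert_link hl.symm (fun h => hxy h.symm) jx, rfl⟩ (hcol _ _ jx jy))⟩

section Stuck

variable [Finite α] [Finite β]

/-- A set of marks on a forest, with an exponent of the additional variable, that is maximal. -/
structure Stuck (G : Graph α β) (c : α → Fin 3) (b : Bool) (A : Set β) (μ : Multiset β) (k : ℕ) :
    Prop where
  forest : G.IsForest A
  supp : ∀ e ∈ μ, e ∈ A
  ne : zlab b k * G.prodLab A c μ ≠ 0
  mark : ∀ g ∈ A, zlab b k * G.prodLab A c (μ + {g}) = 0
  edge : ∀ e ∉ A, G.IsForest (insert e A) → zlab b k * G.prodLab (insert e A) c μ = 0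
  var : zlab b (k + 1) * G.prodLab A c μ = 0

namespace Stuck

variable {b : Bool} (hs : G.Stuck c b A μ k)

include hs

/-- An unmarked component with an edge could receive a mark there. An unmarked single vertex with an
edge to another vertex could be attached to the component of that vertex. Neither changes the label.
-/
theorem part_ne_zero (hx : ¬ G.Isolated x) : G.part A (G.comp A x) μ ≠ 0 := by
  classical
  intro h0
  have hone : G.lab A c 0 = 1 := lab_eq_one hs.forest (Set.toFinite A) (by simp)
  have hne := hs.ne
  by_cases h : ∃ f ∈ A, G.AtComp A (G.comp A x) f
  · obtain ⟨f, hf, hf'⟩ := h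
    have h1 := hs.mark f hf
    rw [prodLab_add_singleton hf hf', h0, zero_add,
      lab_eq_one hs.forest (Set.toFinite A) (by simp)] at h1
    rw [prodLab_eq_mul (G.comp A x), h0, hone] at hne
    exact hne h1
  push Not at h
  unfold Isolated at hx
  push Not at hx
  obtain ⟨e, y, hl, hyx⟩ := hx
  have hxy : ¬ G.Joined A x y := by
    intro hj
    obtain ⟨d, hd⟩ := hs.forest.exists_isDist (Set.toFinite A)
    obtain ⟨f, z, hz⟩ := hd.exists_first hj hyx.symm
    exact h f hz.1 ⟨x, ⟨z, hz.2.1⟩, rfl⟩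
  have heA : e ∉ A := fun he => hxy (Joined.of_link he hl)
  have hF' := hs.forest.insertEdge hl hxy
  have h1 := hs.edge e heA hF'
  have hne' : G.comp A y ≠ G.comp A x := fun h => hxy (comp_eq_iff.1 h).symm
  rw [prodLab_insert hs.forest hl hxy hs.supp, h0, zero_add,
    lab_eq_of_subset hF' (Set.toFinite _) (Set.subset_insert e A) (inComp_part hs.supp),
    Finset.mul_prod_erase _ (fun q => G.lab A c (G.part A q μ))
      (Finset.mem_erase.2 ⟨hne', Finset.mem_univ _⟩)] at h1
  rw [prodLab_eq_mul (G.comp A x), h0, hone, one_mul] at hne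
  exact hne h1

theorem isolated_iff : G.Isolated x ↔ G.part A (G.comp A x) μ = 0 := by
  constructor
  · intro h
    refine Multiset.eq_zero_of_forall_notMem fun e he => ?_
    obtain ⟨he, y, ⟨z, hl⟩, hq⟩ := mem_part.1 he
    have hy := h.eq_of_joined (comp_eq_iff.1 hq).symm
    rw [hy] at hl
    have hz := h e z hl
    rw [hz] at hl
    exact hs.forest.ne_of_link (hs.supp e he) hl rfl
  · intro h
    by_contra hx
    exact hs.part_ne_zero hx h

/-- When all other labels are trivial, completing a triple gives the total label `top`, which is
nonzero, against maximality. -/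
theorem exists_isTriple_contra {q : G.Comp A} (hz : zlab b k = 1)
    (hq : ∀ q', q' ≠ q → G.lab A c (G.part A q' μ) = 1) (hg : g ∈ A) (hgq : G.AtComp A q g)
    (h : G.IsTriple A c (G.part A q μ + {g})) : False := by
  classical
  obtain ⟨d, hd⟩ := hs.forest.exists_isDist (Set.toFinite A)
  have h1 := hs.mark g hg
  rw [prodLab_add_singleton hg hgq, hz, hd.lab_eq hs.forest (.top h), Finset.prod_eq_one] at h1
  · exact absurd h1 (by decide)
  · exact fun q' hq' => hq q' (Finset.mem_erase.1 hq').1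

/-- A component that has two values of `χ` can get a second mark. -/
theorem exists_pair_mark {κ : Type*} {χ : α → κ} (huv : G.Joined A u v) (hne : χ u ≠ χ v)
    (hχ : ∀ x y, χ x ≠ χ y → c x ≠ c y) (h1 : G.lab A c (G.part A (G.comp A u) μ) = 1) :
    ∃ f ∈ A, G.AtComp A (G.comp A u) f ∧ ∃ u' v', χ u' ≠ χ v' ∧
      G.lab A c (G.part A (G.comp A u) μ + {f}) = Lab.pair (c u') (c v') := by
  obtain ⟨d, hd⟩ := hs.forest.exists_isDist (Set.toFinite A)
  have hiso : ¬ G.Isolated u := fun h => hne (by rw [h.eq_of_joined huv])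
  obtain h | ⟨g, hg⟩ := eq_zero_or_singleton_of_lab h1
  · exact absurd h (hs.part_ne_zero hiso)
  have hgm : g ∈ G.part A (G.comp A u) μ := by rw [hg]; simp
  obtain ⟨hgμ, y, ⟨z, hl⟩, hq⟩ := mem_part.1 hgm
  have hy := comp_eq_iff.1 hq
  obtain ⟨u', v', hf, hne'⟩ := exists_first_of_ne hl (hs.supp g hgμ) hy (hy.trans huv) hne
  obtain ⟨f, hf'⟩ := hd.exists_first hf.joined.symm (hd.ne_of_first hs.forest hf).symm
  have hu' : G.comp A u = G.comp A u' :=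
    atComp_unique (hs.supp g hgμ) ⟨y, ⟨z, hl⟩, hq⟩ ⟨u', hf.inc, rfl⟩
  refine ⟨f, hf'.mem, ⟨v', hf'.inc, ?_⟩, u', v', hne', ?_⟩
  · rw [hu']; exact comp_eq_iff.2 hf.joined.symm
  · rw [hg]; exact hd.lab_eq hs.forest (.pair ⟨g, f, hf, hf', rfl⟩ (hχ _ _ hne'))

theorem prodLab_one (hz : zlab b k = 1) (h1 : G.prodLab A c μ = 1)
    (hj : G.Joined F u v) : c u = c v := by
  classical
  by_contra hne
  have hall : ∀ q, G.lab A c (G.part A q μ) = 1 := fun q =>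
    Lab.prod_eq_one _ h1 q (Finset.mem_univ _)
  by_cases h : ∃ x y, G.Joined A x y ∧ c x ≠ c y
  · obtain ⟨x, y, hxy, hne⟩ := h
    obtain ⟨f, hf, hf', u', v', hne', hlab⟩ := hs.exists_pair_mark hxy hne (fun _ _ h => h) (hall _)
    have h2 := hs.mark f hf
    rw [prodLab_add_singleton hf hf', hz, hlab, Finset.prod_eq_one fun q _ => hall q, one_mul,
      mul_one] at h2
    exact Lab.pair_ne_zero hne' h2
  push Not at h
  obtain ⟨e, -, x, y, hl, hxy⟩ := exists_link_ne (χ := c) hj hne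
  have hnj : ¬ G.Joined A x y := fun h' => hxy (h x y h')
  have hcol : ∀ x' y', G.Joined A x x' → G.Joined A y y' → c x' ≠ c y' := by
    intro x' y' hx' hy'
    rwa [← h _ _ hx', ← h _ _ hy']
  have h2 := hs.edge e (fun he => hnj (Joined.of_link he hl)) (hs.forest.insertEdge hl hnj)
  rw [prodLab_insert hs.forest hl hnj hs.supp, hz, Finset.prod_eq_one fun q _ => hall q, one_mul,
    mul_one] at h2
  rcases lab_merge hs.forest (Set.toFinite A) hl hnj (inComp_part hs.supp) (inComp_part hs.supp)
    (hall _) (hall _) hcol with h3 | ⟨x', y', hx', hy', h3⟩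
  · rw [h3] at h2; exact absurd h2 (by decide)
  · rw [h3] at h2; exact Lab.pair_ne_zero (hcol _ _ hx' hy') h2

/-- A pair of colours 1 and 2 can always be extended: the degenerate triple with `v = s` adds an
exit edge, with no condition on other vertices. -/
theorem prodLab_ne_pair (hz : zlab b k = 1) : G.prodLab A c μ ≠ Lab.pair 1 2 := by
  intro h1
  obtain ⟨d, hd⟩ := hs.forest.exists_isDist (Set.toFinite A)
  obtain ⟨q, -, hq, hall⟩ := Lab.prod_eq_pair _ (by decide) h1
  have h := hasLab_lab (by rw [hq]; decide)
  obtain ⟨u, v, hp, hu, hv⟩ : ∃ u v, G.IsPair A u v (G.part A q μ) ∧ c u = 1 ∧ c v = 2 := by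
    generalize hm : G.lab A c (G.part A q μ) = m at h hq
    cases h with
    | one h => exact absurd hq (by decide)
    | @pair u v h hc' =>
      have := (by decide : ∀ i j : Fin 3, i ≠ j → Lab.pair i j = Lab.pair 1 2 →
        (i = 1 ∧ j = 2) ∨ (i = 2 ∧ j = 1)) _ _ hc' hq
      rcases this with h2 | h2
      · exact ⟨u, v, h, h2⟩
      · exact ⟨v, u, h.symm, h2.2, h2.1⟩
    | top h => exact absurd hq (by decide)
  obtain ⟨e, f, he, hf, hef⟩ := hp
  have huv := he.joined
  have hne := hd.ne_of_first hs.forest he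
  obtain ⟨g, hg⟩ := hd.exists_exit (c := c) (k := c u) hs.forest (by rw [hu, hv]; decide) _ u rfl
    huv hne
  obtain ⟨p, p', hp, -, -, -, hjp, -⟩ := hd.exit_spec hs.forest hg
  have hem : e ∈ G.part A q μ := by rw [hef]; simp
  have hqu : q = G.comp A u := atComp_unique he.mem (mem_part.1 hem).2 ⟨u, he.inc, rfl⟩
  refine hs.exists_isTriple_contra hz (fun q' => hall q' (Finset.mem_univ _)) hp.1
    ⟨p, ⟨p', hp.2.1⟩, ?_⟩ (Or.inr ⟨u, u, v, Or.inr (Or.inr (Or.inr ⟨hu, rfl, hv⟩)), e, f, g, he,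
      hf, hg, Or.inl rfl, ?_⟩)
  · rw [hqu]; exact comp_eq_iff.2 hjp.symm
  · rw [hef, Multiset.triple_eq_add]; rfl

/-- If the only nontrivial label is that of a pair of colours 0 and `j`, no edge of the graph joins
the remaining colour `i` to another colour; otherwise the rank could be raised. The argument treats
the marked component, the other components, and edges between components. -/
theorem prodLab_pair (hz : zlab b k = 1) (hij : (i = 1 ∧ j = 2) ∨ (i = 2 ∧ j = 1))
    (h1 : G.prodLab A c μ = Lab.pair 0 j) (hj : G.Joined F x y) (hx : c x = i) : c y = i := by
  classical
  have hA := hs.forest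
  have hfin := Set.toFinite A
  obtain ⟨d, hd⟩ := hA.exists_isDist hfin
  have h0j : (0 : Fin 3) ≠ j := by rcases hij with ⟨-, rfl⟩ | ⟨-, rfl⟩ <;> decide
  obtain ⟨q, -, hq, hall⟩ := Lab.prod_eq_pair _ h0j h1
  have hall' : ∀ q', q' ≠ q → G.lab A c (G.part A q' μ) = 1 := fun q' =>
    hall q' (Finset.mem_univ _)
  have h := hasLab_lab (by rw [hq]; exact Lab.pair_ne_zero h0j)
  obtain ⟨u, w, hp, hu, hw⟩ : ∃ u w, G.IsPair A u w (G.part A q μ) ∧ c u = 0 ∧ c w = j := by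
    generalize hm : G.lab A c (G.part A q μ) = m at h hq
    cases h with
    | one h => exact absurd hq ((by decide : ∀ i j : Fin 3, (1 : Lab) ≠ Lab.pair i j) _ _)
    | @pair u v h hc' =>
      have := (by decide : ∀ j i i' : Fin 3, 0 ≠ j → i ≠ i' → Lab.pair i i' = Lab.pair 0 j →
        (i = 0 ∧ i' = j) ∨ (i = j ∧ i' = 0)) _ _ _ h0j hc' hq
      rcases this with h2 | h2
      · exact ⟨u, v, h, h2⟩
      · exact ⟨v, u, h.symm, h2.2, h2.1⟩
    | top h => exact absurd hq ((by decide : ∀ i j : Fin 3, Lab.top ≠ Lab.pair i j) _ _)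
  obtain ⟨e, f, he, hf, hef⟩ := hp
  have huw := he.joined
  have hem : e ∈ G.part A q μ := by rw [hef]; simp
  have hqu : q = G.comp A u := atComp_unique he.mem (mem_part.1 hem).2 ⟨u, he.inc, rfl⟩
  subst hqu
  -- Colour `i` in the component of the pair would complete a triple: by an exit edge if it occurs
  -- on the path from `u` to `w`, and otherwise by the first edge from a vertex of colour `i`
  -- towards `u`.
  have hno : ∀ v, G.Joined A u v → c v ≠ i := by
    intro v huv hv
    obtain ⟨g, hg, hgu, ht⟩ : ∃ g ∈ A, G.AtComp A (G.comp A u) g ∧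
        G.IsTriple A c ({e, f} + {g}) := by
      by_cases h : ∃ v', G.Joined A u v' ∧ d u v' + d v' w = d u w ∧ c v' = i
      · obtain ⟨v', h2, h3, h4⟩ := h
        exact hd.exists_triple_of_on_path hA he hf h2 h3 hu hw h4 hij
      · push Not at h
        obtain ⟨g, hg⟩ := hd.exists_first huv.symm (by
          rintro rfl; rw [hu] at hv; rcases hij with ⟨rfl, -⟩ | ⟨rfl, -⟩ <;>
            exact absurd hv (by decide))
        exact ⟨g, hg.mem, ⟨v, hg.inc, comp_eq_iff.2 huv.symm⟩,
          hd.triple_of_not_on_path hA he hf hg h hu hw hv hij⟩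
    rw [← hef] at ht
    exact hs.exists_isTriple_contra hz hall' hg hgu ht
  -- Elsewhere, a tree containing colour `i` and another colour could get a pair with exactly one
  -- end of colour `i`; its label times `pair 0 j` is `top`.
  have hno2 : ∀ a v, G.Joined A a v → c a = i → c v = i := by
    intro a v hav ha
    by_contra hv
    have hqa : G.comp A a ≠ G.comp A u := fun h => hno a (comp_eq_iff.1 h).symm ha
    obtain ⟨f', hf1, hf2, u', v', hne', hlab⟩ := hs.exists_pair_mark (χ := fun z => (c z = i)) hav
      (by intro h; exact hv (h.mp ha)) (fun x y h h' => h (by rw [h']))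
      (hall' _ hqa)
    have h2 := hs.mark f' hf1
    rw [prodLab_eq_mul (G.comp A a), hall' _ hqa, one_mul] at h1
    rw [prodLab_add_singleton hf1 hf2, hz, hlab, h1, one_mul] at h2
    refine (by decide : ∀ i j k l : Fin 3, ((i = 1 ∧ j = 2) ∨ (i = 2 ∧ j = 1)) →
      ¬ (k = i ↔ l = i) → Lab.pair k l * Lab.pair 0 j ≠ 0) i j _ _ hij ?_ h2
    exact fun h => hne' (propext h)
  by_contra hy
  obtain ⟨e', -, x, y, hl, hxy⟩ := exists_link_ne (χ := fun z => (c z = i)) hj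
    (by intro h; exact hy (h.mp hx))
  clear hx hy hj
  wlog hx : c x = i generalizing x y
  · refine this y x hl.symm hxy.symm ?_
    by_contra hy
    exact hxy (by simp only [hx, hy])
  have hy : c y ≠ i := fun hy => hxy (by simp only [hx, hy])
  have hnj : ¬ G.Joined A x y := fun h' => hy (hno2 x y h' hx)
  have hcol : ∀ x' y', G.Joined A x x' → G.Joined A y y' → c x' = i ∧ c y' ≠ i := by
    intro x' y' hx' hy'
    exact ⟨hno2 _ _ hx' hx, fun h => hy (hno2 _ _ hy'.symm h)⟩
  have hF' := hA.insertEdge hl hnj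
  have hne : G.comp A y ≠ G.comp A x := fun h => hnj (comp_eq_iff.1 h).symm
  have hqx : G.comp A x ≠ G.comp A u := fun h => hno x (comp_eq_iff.1 h).symm hx
  have h2 := hs.edge e' (fun he => hnj (Joined.of_link he hl)) hF'
  rw [prodLab_insert hA hl hnj hs.supp, hz, one_mul] at h2
  -- Now an edge leads from a tree of colour `i` to a tree without it. If the latter carries the
  -- pair, the mark of the first tree completes a triple. Otherwise the single marks of the two
  -- trees become a pair involving colour `i`. Missing marks leave the label unchanged, so the edge
  -- could be added in every case.
  by_cases hqy : G.comp A y = G.comp A u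
  · rw [Finset.prod_eq_one, mul_one, hqy, hef] at h2
    · obtain ⟨d', hd'⟩ := hF'.exists_isDist (Set.toFinite _)
      obtain h3 | ⟨g, hg⟩ := eq_zero_or_singleton_of_lab (hall' _ hqx)
      · rw [h3, zero_add, ← hef, lab_eq_of_subset hF' (Set.toFinite _) (Set.subset_insert e' A)
          (inComp_part hs.supp), hq] at h2
        exact Lab.pair_ne_zero h0j h2
      · have hgm : g ∈ G.part A (G.comp A x) μ := by rw [hg]; simp
        obtain ⟨hgμ, hgx⟩ := mem_part.1 hgm
        obtain ⟨x', hx'⟩ := exists_first_of_atComp hA hfin (hs.supp g hgμ) hgx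
        have hyu := comp_eq_iff.1 hqy
        have ht := hd'.triple_of_not_on_path (c := c) (i := i) (j := j) hF'
          (he.mono (Set.subset_insert e' A)) (hf.mono (Set.subset_insert e' A))
          (hx'.insert_link hl hnj hyu) (fun v hv hv' => hno v (joined_of_on_path hF' (Set.toFinite _)
            (Set.subset_insert e' A) hd' _ u rfl huw hv hv')) hu hw
            (hcol x' y hx'.joined.symm Joined.rfl').1 hij
        rw [hg, add_comm, hd'.lab_eq hF' (.top ht)] at h2
        exact absurd h2 (by decide)
    · intro q' hq'
      rw [hqy] at hq'
      exact hall' q' (Finset.mem_erase.1 hq').1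
  · rw [prodLab_eq_mul (G.comp A x), hall' _ hqx, one_mul, ← Finset.mul_prod_erase _ _
      (Finset.mem_erase.2 ⟨hne, Finset.mem_univ _⟩), hall' _ hqy, one_mul] at h1
    rw [h1] at h2
    rcases lab_merge hA hfin hl hnj (inComp_part hs.supp) (inComp_part hs.supp)
      (hall' _ hqx) (hall' _ hqy) (fun x' y' hx' hy' h => (hcol x' y' hx' hy').2
        (by rw [← h, (hcol x' y' hx' hy').1])) with h3 | ⟨x', y', hx', hy', h3⟩
    · rw [h3, one_mul] at h2; exact Lab.pair_ne_zero h0j h2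
    · rw [h3, (hcol x' y' hx' hy').1] at h2
      exact (by decide : ∀ i j k : Fin 3, ((i = 1 ∧ j = 2) ∨ (i = 2 ∧ j = 1)) → k ≠ i →
        Lab.pair i k * Lab.pair 0 j ≠ 0) i j _ hij (hcol x' y' hx' hy').2 h2

end Stuck

end Stuck

end Graph

/-! ### Purity -/

namespace Lab

theorem rank_prod {ι : Type*} (s : Finset ι) (f : ι → Lab) (h : ∏ q ∈ s, f q ≠ 0) :
    (∏ q ∈ s, f q).rank = ∑ q ∈ s, (f q).rank := by
  classical
  induction s using Finset.induction_on with
  | empty => rfl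
  | insert a s ha ih =>
    rw [Finset.prod_insert ha] at h ⊢
    rw [Finset.sum_insert ha, rank_mul _ _ h, ih (right_ne_zero_of_mul h)]

end Lab

namespace Graph

variable {α β : Type*} {G : Graph α β} {F F' A A' : Set β} {x y z u v w p s t a x' y' : α}
  {e f g : β} {d : α → α → ℕ} {σ τ ρ μ μ' : Multiset β} {c : α → Fin 3} {i j : Fin 3} {k k' : ℕ}
  {b : Bool}

theorem hasLab_eq_one (hM : ∀ x y, G.Joined G.edgeSet x y → c x = c y) (hF : F ⊆ G.edgeSet)
    {l : Lab} (h : G.HasLab F c σ l) : l = 1 := by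
  cases h with
  | one => rfl
  | pair h hc => exact absurd (hM _ _ (h.joined.mono hF)) hc
  | top h =>
    obtain ⟨u, v, w, hu, hv, hw, e, f, g, h1, h2, h3, h4, h5, h6, rfl⟩ |
      ⟨s, v, t, hg, e, f, g, he, hf, hx, hb, rfl⟩ := h
    · have := hM _ _ (h1.joined.mono hF)
      rw [hu, hv] at this
      exact absurd this (by decide)
    · have := hM _ _ (he.joined.mono hF)
      rcases hg with ⟨h1, -, h2⟩ | ⟨h1, -, h2⟩ | ⟨h1, -, h2⟩ | ⟨h1, -, h2⟩ <;>
      · rw [h1, h2] at this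
        exact absurd this (by decide)

/-- If colour `i` is separated from the others in the whole graph, a component sees either only
colour `i` or only the colours 0 and `j`, so it has no triples. -/
theorem hasLab_eq_pair (hij : (i = 1 ∧ j = 2) ∨ (i = 2 ∧ j = 1))
    (hM : ∀ x y, G.Joined G.edgeSet x y → c x = i → c y = i) (hF : F ⊆ G.edgeSet)
    {l : Lab} (h : G.HasLab F c σ l) : l = 1 ∨ l = Lab.pair 0 j := by
  have hM' : ∀ x y, G.Joined F x y → (c x = i ↔ c y = i) := fun x y h =>
    ⟨hM x y (h.mono hF), hM y x (h.mono hF).symm⟩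
  cases h with
  | one => exact Or.inl rfl
  | pair h hc =>
    exact Or.inr ((by decide : ∀ i j k l : Fin 3, ((i = 1 ∧ j = 2) ∨ (i = 2 ∧ j = 1)) →
      (k = i ↔ l = i) → k ≠ l → Lab.pair k l = Lab.pair 0 j) i j _ _ hij (hM' _ _ h.joined) hc)
  | top h =>
    obtain ⟨u, v, w, hu, hv, hw, e, f, g, h1, h2, h3, h4, h5, h6, rfl⟩ |
      ⟨s, v, t, hg, e, f, g, he, hf, hx, hb, rfl⟩ := h
    · have m1 := hM' _ _ h1.joined
      have m2 := hM' _ _ h2.joined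
      rw [hu, hv] at m1
      rw [hu, hw] at m2
      rcases hij with ⟨rfl, rfl⟩ | ⟨rfl, rfl⟩
      · exact absurd m1 (by decide)
      · exact absurd m2 (by decide)
    · have m1 := hM' _ _ he.joined
      have m2 := hM' _ _ hx.joined
      rcases hij with ⟨rfl, rfl⟩ | ⟨rfl, rfl⟩ <;>
      · rcases hg with ⟨h1, h3, h2⟩ | ⟨h1, h3, h2⟩ | ⟨h1, h3, h2⟩ | ⟨h1, rfl, h2⟩ <;>
        · rw [h1, h2] at m1
          first
          | exact absurd m1 (by decide)
          | (rw [h3, h2] at m2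
             exact absurd m2 (by decide))

variable {N : Finset β}

theorem supp_add_singleton {m : Multiset β} (hg : g ∈ supp N m) : supp N (m + {g}) = supp N m := by
  ext e
  rw [mem_supp, mem_supp, Multiset.mem_add, Multiset.mem_singleton]
  constructor
  · rintro (h | h | rfl)
    · exact Or.inl h
    · exact Or.inr h
    · exact mem_supp.1 hg
  · rintro (h | h)
    · exact Or.inl h
    · exact Or.inr (Or.inl h)

theorem marks_add_singleton {m : Multiset β} (hg : g ∈ supp N m) :
    marks N (m + {g}) = marks N m + {g} := by
  classical
  ext e
  rw [count_marks, Multiset.count_add, Multiset.count_add, count_marks, Multiset.count_singleton]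
  by_cases he : e = g
  · subst he
    rw [if_pos rfl]
    split_ifs with h
    · rfl
    · have := Multiset.one_le_count_iff_mem.2 ((mem_supp.1 hg).resolve_left h)
      omega
  · rw [if_neg he]; rfl

theorem coe_supp_add_singleton_of_notMem {m : Multiset β} :
    (supp N (m + {g}) : Set β) = insert g (supp N m : Set β) := by
  ext e
  simp only [Finset.mem_coe, mem_supp, Multiset.mem_add, Multiset.mem_singleton,
    Set.mem_insert_iff]
  tauto

theorem marks_add_singleton_of_notMem {m : Multiset β} (hg : g ∉ supp N m) :
    marks N (m + {g}) = marks N m := by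
  classical
  rw [mem_supp, not_or] at hg
  ext e
  rw [count_marks, Multiset.count_add, count_marks, Multiset.count_singleton]
  by_cases he : e = g
  · subst he
    rw [if_pos rfl, if_neg hg.1, if_neg hg.1, Multiset.count_eq_zero_of_notMem hg.2]
  · rw [if_neg he]; rfl

variable [Finite α]

namespace Stuck

theorem sum_rank_eq (hs : G.Stuck c b A μ k) : (zlab b k * G.prodLab A c μ).rank =
    k + ∑ q : G.Comp A, (G.lab A c (G.part A q μ)).rank := by
  rw [Lab.rank_mul _ _ hs.ne, rank_zlab _ _ (left_ne_zero_of_mul hs.ne)]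
  congr 1
  exact Lab.rank_prod _ _ (right_ne_zero_of_mul hs.ne)

theorem prodLab_eq_one (hs : G.Stuck c b A μ k)
    (hM : ∀ x y, G.Joined G.edgeSet x y → c x = c y) : G.prodLab A c μ = 1 := by
  refine Finset.prod_eq_one fun q _ => hasLab_eq_one hM hs.forest.1 (hasLab_lab fun h0 => ?_)
  exact right_ne_zero_of_mul hs.ne (Finset.prod_eq_zero (Finset.mem_univ q) h0)

theorem prodLab_eq_pair (hs : G.Stuck c b A μ k) (hij : (i = 1 ∧ j = 2) ∨ (i = 2 ∧ j = 1))
    (hM : ∀ x y, G.Joined G.edgeSet x y → c x = i → c y = i) :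
    G.prodLab A c μ = 1 ∨ G.prodLab A c μ = Lab.pair 0 j := by
  have h := right_ne_zero_of_mul hs.ne
  have h1 : ∀ q, G.lab A c (G.part A q μ) = 1 ∨ G.lab A c (G.part A q μ) = Lab.pair 0 j :=
    fun q => hasLab_eq_pair hij hM hs.forest.1 (hasLab_lab fun h0 =>
      h (Finset.prod_eq_zero (Finset.mem_univ q) h0))
  have h2 : ∀ s : Finset (G.Comp A), ∏ q ∈ s, G.lab A c (G.part A q μ) = 0 ∨
      ∏ q ∈ s, G.lab A c (G.part A q μ) = 1 ∨
      ∏ q ∈ s, G.lab A c (G.part A q μ) = Lab.pair 0 j := by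
    classical
    intro s
    induction s using Finset.induction_on with
    | empty => exact Or.inr (Or.inl rfl)
    | insert a s ha ih =>
      rw [Finset.prod_insert ha]
      exact (by decide : ∀ (j : Fin 3) (a b : Lab), (a = 1 ∨ a = Lab.pair 0 j) →
        (b = 0 ∨ b = 1 ∨ b = Lab.pair 0 j) → a * b = 0 ∨ a * b = 1 ∨ a * b = Lab.pair 0 j)
        j _ _ (h1 a) ih
  exact (h2 Finset.univ).resolve_left h

variable [Finite β]

/-- Raising the exponent of the extra variable would be possible for total labels `1`, `x01` and
`x02` with exponent 0, and for `1` with exponent 1. The label `x12` with exponent 0 is excluded by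
`prodLab_ne_pair`. -/
theorem rank_of_true (hs : G.Stuck c true A μ k) : (zlab true k * G.prodLab A c μ).rank = 2 := by
  have hk := lt_of_zlab_ne_zero _ _ (left_ne_zero_of_mul hs.ne)
  have hne := hs.ne
  have hvar := hs.var
  have hp : zlab true k = 1 → G.prodLab A c μ ≠ Lab.pair 1 2 := hs.prodLab_ne_pair
  generalize G.prodLab A c μ = l at *
  interval_cases k <;> revert l <;> decide

/-- A total label `1`, or `pair 0 j`, for one maximal monomial is translated into a property of the
coloured graph, which restricts the labels of every other one. The label `x12` does not occur, so
what remains is `top` for both. -/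
theorem rank_eq_of_false (hs : G.Stuck c false A μ k) (hs' : G.Stuck c false A' μ' k') :
    (zlab false k * G.prodLab A c μ).rank = (zlab false k' * G.prodLab A' c μ').rank := by
  have hk := zlab_false (left_ne_zero_of_mul hs.ne)
  have hk' := zlab_false (left_ne_zero_of_mul hs'.ne)
  subst hk hk'
  have h1 : G.prodLab A c μ = 1 → G.prodLab A' c μ' = 1 := fun h =>
    hs'.prodLab_eq_one fun x y hj => hs.prodLab_one rfl h hj
  have h1' : G.prodLab A' c μ' = 1 → G.prodLab A c μ = 1 := fun h =>
    hs.prodLab_eq_one fun x y hj => hs'.prodLab_one rfl h hj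
  have h2 : ∀ i j : Fin 3, ((i = 1 ∧ j = 2) ∨ (i = 2 ∧ j = 1)) → G.prodLab A c μ = Lab.pair 0 j →
      G.prodLab A' c μ' = 1 ∨ G.prodLab A' c μ' = Lab.pair 0 j := fun i j hij h =>
    hs'.prodLab_eq_pair hij fun x y hj => hs.prodLab_pair rfl hij h hj
  have h2' : ∀ i j : Fin 3, ((i = 1 ∧ j = 2) ∨ (i = 2 ∧ j = 1)) → G.prodLab A' c μ' = Lab.pair 0 j →
      G.prodLab A c μ = 1 ∨ G.prodLab A c μ = Lab.pair 0 j := fun i j hij h =>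
    hs.prodLab_eq_pair hij fun x y hj => hs'.prodLab_pair rfl hij h hj
  have h3 := hs.prodLab_ne_pair rfl
  have h3' := hs'.prodLab_ne_pair rfl
  have h4 := right_ne_zero_of_mul hs.ne
  have h4' := right_ne_zero_of_mul hs'.ne
  have h5 := h2 1 2 (by decide)
  have h6 := h2 2 1 (by decide)
  have h5' := h2' 1 2 (by decide)
  have h6' := h2' 2 1 (by decide)
  clear h2 h2' hs hs'
  generalize G.prodLab A c μ = l at *
  generalize G.prodLab A' c μ' = l' at *
  have key : ∀ l : Lab, l ≠ Lab.pair 1 2 → l ≠ 0 →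
      l = 1 ∨ l = Lab.pair 0 1 ∨ l = Lab.pair 0 2 ∨ l = Lab.top := by decide
  rcases key l h3 h4 with rfl | rfl | rfl | rfl <;>
    rcases key l' h3' h4' with rfl | rfl | rfl | rfl <;>
    first
    | rfl
    | exact absurd (h1 rfl) (by decide)
    | exact absurd (h1' rfl) (by decide)
    | exact absurd (h5 rfl) (by decide)
    | exact absurd (h6 rfl) (by decide)
    | exact absurd (h5' rfl) (by decide)
    | exact absurd (h6' rfl) (by decide)

theorem rank_eq (hs : G.Stuck c b A μ k) (hs' : G.Stuck c b A' μ' k') :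
    (zlab b k * G.prodLab A c μ).rank = (zlab b k' * G.prodLab A' c μ').rank := by
  cases b with
  | true => rw [hs.rank_of_true, hs'.rank_of_true]
  | false => exact hs.rank_eq_of_false hs'

end Stuck

section Degree

variable [Finite β]

theorem card_add_card_comp [Fintype α] [Fintype β] {B : Finset β} (hB : G.IsForest (B : Set β)) :
    B.card + Fintype.card (G.Comp (B : Set β)) = Fintype.card α := by
  classical
  have h1 := Finset.card_eq_sum_card_fiberwise (f := G.comp (B : Set β)) (s := Finset.univ)
    (t := Finset.univ) (by simp)
  have h2 := congrArg Multiset.card (sum_part (μ := B.val) hB.1 (fun e he => he))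
  rw [Multiset.card_sum] at h2
  rw [Finset.card_univ] at h1
  rw [h1, ← Finset.card_val B, ← h2, ← Finset.card_univ, Finset.card_eq_sum_ones,
    ← Finset.sum_add_distrib]
  refine Finset.sum_congr rfl fun q _ => ?_
  obtain ⟨x, rfl⟩ := comp_surjective q
  have h3 := card_edges_add_one (G := G) (F := (B : Set β)) (x := x)
    (C := Finset.univ.filter fun y => G.comp (B : Set β) y = G.comp B x)
    (EC := B.filter fun e => G.AtComp (B : Set β) (G.comp B x) e) hB (Set.toFinite _)
    (fun y => by
      rw [Finset.mem_filter, comp_eq_iff]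
      exact ⟨fun h => h.2.symm, fun h => ⟨Finset.mem_univ _, h.symm⟩⟩)
    (fun e => by
      rw [Finset.mem_filter]
      refine and_congr_right fun _ => exists_congr fun y => and_congr_right fun _ => ?_
      rw [comp_eq_iff]
      exact ⟨Joined.symm, Joined.symm⟩)
  rw [← h3]
  congr 1

open Classical in
-- In each component the number of marks is one plus the rank of the label, except for unmarked
-- components, which are exactly the isolated vertices. These equations are added up and combined
-- with `card_add_card_comp`.
theorem Stuck.card_eq [Fintype α] [Fintype β] {B : Finset β} (hs : G.Stuck c b (B : Set β) μ k) :
    B.card + Multiset.card μ + k + (Finset.univ.filter fun x => G.Isolated x).card =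
      Fintype.card α + (zlab b k * G.prodLab (B : Set β) c μ).rank := by
  have h1 := card_add_card_comp hs.forest
  have h2 := congrArg Multiset.card (sum_part hs.forest.1 hs.supp)
  rw [Multiset.card_sum] at h2
  have h3 : ∀ q : G.Comp (B : Set β), Multiset.card (G.part (B : Set β) q μ) +
      (if G.part (B : Set β) q μ = 0 then 1 else 0) =
      1 + (G.lab (B : Set β) c (G.part (B : Set β) q μ)).rank := by
    intro q
    have h := (hasLab_lab (G := G) (F := (B : Set β)) (c := c) (σ := G.part (B : Set β) q μ)
      fun h0 => right_ne_zero_of_mul hs.ne (Finset.prod_eq_zero (Finset.mem_univ q) h0)).card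
    split_ifs with h0
    · rw [h0] at h ⊢
      rw [lab_eq_one hs.forest (Set.toFinite _) (by simp)]
      rfl
    · have := Multiset.card_pos.2 h0
      omega
  have h4 := Finset.sum_congr (rfl : (Finset.univ : Finset (G.Comp (B : Set β))) = _)
    fun q _ => h3 q
  rw [Finset.sum_add_distrib, Finset.sum_add_distrib, h2, ← Finset.card_filter,
    ← Finset.card_eq_sum_ones, Finset.card_univ] at h4
  have h5 : (Finset.univ.filter fun x => G.Isolated x).card =
      (Finset.univ.filter fun q => G.part (B : Set β) q μ = 0).card := by
    refine Finset.card_bij (fun x _ => G.comp B x) ?_ ?_ ?_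
    · intro x hx
      rw [Finset.mem_filter] at hx ⊢
      exact ⟨Finset.mem_univ _, hs.isolated_iff.1 hx.2⟩
    · intro x hx y hy h
      exact ((Finset.mem_filter.1 hx).2.eq_of_joined (comp_eq_iff.1 h)).symm
    · intro q hq
      obtain ⟨x, rfl⟩ := comp_surjective q
      exact ⟨x, Finset.mem_filter.2 ⟨Finset.mem_univ _,
        hs.isolated_iff.2 (Finset.mem_filter.1 hq).2⟩, rfl⟩
  rw [← h5] at h4
  have h6 := hs.sum_rank_eq
  omega

end Degree

/-- Multiplying by an edge of the support adds a mark, multiplying by another edge enlarges the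
forest and keeps the marks, and the extra variable raises `k`. -/
theorem stuck_of_maximal {p : Multiset β × ℕ} (hp : Maximal (fun p => G.Allowed N c (zlab b) p) p) :
    G.Stuck c b (supp N p.1 : Set β) (marks N p.1) p.2 := by
  obtain ⟨m, k⟩ := p
  have hmax : ∀ p', (m, k) < p' → ¬ G.Allowed N c (zlab b) p' := fun p' h h' => hp.not_gt h' h
  have hlt : ∀ g : β, (m, k) < (m + {g}, k) := fun g =>
    Prod.mk_lt_mk_of_lt_of_le (lt_add_of_pos_right _ (Multiset.singleton_ne_zero g).bot_lt) le_rfl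
  refine ⟨hp.prop.1, fun e he => mem_supp_of_mem_marks he, hp.prop.2, ?_, ?_, ?_⟩
  · intro g hg
    by_contra hne
    refine hmax _ (hlt g) ⟨?_, ?_⟩
    · simp only; rw [supp_add_singleton hg]; exact hp.prop.1
    · simp only; rw [supp_add_singleton hg, marks_add_singleton hg]; exact hne
  · intro e he hF
    by_contra hne
    refine hmax _ (hlt e) ⟨?_, ?_⟩
    · simp only; rw [coe_supp_add_singleton_of_notMem]; exact hF
    · simp only
      rw [coe_supp_add_singleton_of_notMem, marks_add_singleton_of_notMem he]; exact hne
  · by_contra hne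
    exact hmax (m, k + 1) (Prod.mk_lt_mk_of_le_of_lt le_rfl (Nat.lt_succ_self k)) ⟨hp.prop.1, hne⟩

/-- All maximal admissible monomials have the same degree. -/
theorem degree_eq_of_maximal [Finite β] {p p' : Multiset β × ℕ}
    (hp : Maximal (fun p => G.Allowed N c (zlab b) p) p)
    (hp' : Maximal (fun p => G.Allowed N c (zlab b) p) p') :
    Multiset.card p.1 + p.2 = Multiset.card p'.1 + p'.2 := by
  classical
  have := Fintype.ofFinite α
  have := Fintype.ofFinite β
  have hs := stuck_of_maximal hp
  have hs' := stuck_of_maximal hp'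
  have h1 := hs.card_eq
  have h2 := hs'.card_eq
  have h3 := hs.rank_eq hs'
  have h4 := card_eq_add_marks (N := N) (m := p.1)
  have h5 := card_eq_add_marks (N := N) (m := p'.1)
  rw [Finset.card_sdiff_of_subset subset_supp] at h4 h5
  have h6 := Finset.card_le_card (subset_supp (N := N) (m := p.1))
  have h7 := Finset.card_le_card (subset_supp (N := N) (m := p'.1))
  omega

end Graph

/-! ### The star graph of a triconed graph -/

namespace Graph

/-- The graph with given ends of each edge. -/
def ofEnds {V ε : Type*} (s t : ε → V) : Graph V ε where
  vertexSet := Set.univ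
  IsLink e x y := (s e = x ∧ t e = y) ∨ (s e = y ∧ t e = x)
  edgeSet := Set.univ
  isLink_symm e _ := ⟨fun _ _ h => h.symm⟩
  eq_or_eq_of_isLink_of_isLink := by
    rintro e x y v w (⟨rfl, rfl⟩ | ⟨rfl, rfl⟩) (⟨rfl, rfl⟩ | ⟨rfl, rfl⟩) <;> simp
  edge_mem_iff_exists_isLink e := ⟨fun _ => ⟨s e, t e, Or.inl ⟨rfl, rfl⟩⟩, fun _ => trivial⟩
  left_mem_of_isLink := fun _ _ _ _ => trivial

theorem isLink_ofEnds {V ε : Type*} (s t : ε → V) (e : ε) : (ofEnds s t).IsLink e (s e) (t e) :=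
  Or.inl ⟨rfl, rfl⟩

end Graph

/-- The partition that joins all the elements of a set. -/
def Lab.merge (U : Finset (Fin 3)) : Lab :=
  if U.card ≤ 1 then 1 else if U = Finset.univ then Lab.top else if 2 ∉ U then Lab.x01
    else if 1 ∉ U then Lab.x02 else Lab.x12

theorem Lab.merge_insert : ∀ (U : Finset (Fin 3)) (i j : Fin 3), i ∈ U → j ∉ U →
    Lab.merge (insert j U) = Lab.merge U * Lab.pair i j := by decide

theorem Lab.merge_mul_pair : ∀ (U : Finset (Fin 3)) (i j : Fin 3), i ∈ U → j ∈ U →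
    Lab.merge U * Lab.pair i j = 0 := by decide

section SetLab

variable {κ : Type*} (col : κ → Fin 3)

open Classical in
/-- The partition that joins the colours of a set of objects, zero if the colours repeat. -/
noncomputable def setLab (S : Finset κ) : Lab :=
  if Set.InjOn col S then Lab.merge (S.image col) else 0

theorem setLab_empty : setLab col ∅ = 1 := by
  classical
  rw [setLab, if_pos (by simp)]; rfl

theorem setLab_singleton [DecidableEq κ] (v : κ) : setLab col {v} = 1 := by
  rw [setLab, if_pos (by simp), Finset.image_singleton, Lab.merge, if_pos (by simp)]

/-- A repeated colour gives zero on both sides; a new colour is merged into the class that already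
contains the colour of `u`. -/
theorem setLab_insert [DecidableEq κ] {S : Finset κ} {u v : κ} (hu : u ∈ S) (hv : v ∉ S) :
    setLab col (insert v S) = setLab col S * Lab.pair (col u) (col v) := by
  unfold setLab
  have hu' := Finset.mem_image_of_mem col hu
  by_cases h : Set.InjOn col S
  · rw [if_pos h]
    by_cases hv' : col v ∈ S.image col
    · rw [Lab.merge_mul_pair _ _ _ hu' hv', if_neg]
      rw [Finset.coe_insert, Set.injOn_insert (by exact_mod_cast hv)]
      rintro ⟨-, h'⟩
      exact h' (by obtain ⟨w, hw, hw'⟩ := Finset.mem_image.1 hv'; exact ⟨w, hw, hw'⟩)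
    · rw [if_pos, Finset.image_insert, Lab.merge_insert _ _ _ hu' hv']
      rw [Finset.coe_insert, Set.injOn_insert (by exact_mod_cast hv)]
      refine ⟨h, fun h' => hv' ?_⟩
      obtain ⟨w, hw, hw'⟩ := h'
      exact Finset.mem_image.2 ⟨w, hw, hw'⟩
  · rw [if_neg h, zero_mul, if_neg]
    exact fun h' => h (h'.mono (Finset.coe_subset.2 (Finset.subset_insert v S)))

end SetLab

namespace Graph

variable {α β κ η ι : Type*} {G : Graph α β}

/-- A description of the edges of a triconed graph that are not loops at the cones: the edges at one
cone (`κ`), the edges at no cone (`η`) and the edges between the cones (`ι`). The ends of the edges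
in `η` are given by edges of `κ` at the same vertices. -/
structure ConeModel (G : Graph α β) (κ η ι : Type*) where
  edge : κ ⊕ (η ⊕ ι) → β
  inj : Function.Injective edge
  cone : Fin 3 → α
  cone_inj : Function.Injective cone
  foot : κ → α
  col : κ → Fin 3
  foot_ne : ∀ v i, foot v ≠ cone i
  src : η → κ
  tgt : η → κ
  fst : ι → Fin 3
  snd : ι → Fin 3
  link_left : ∀ v, G.IsLink (edge (Sum.inl v)) (cone (col v)) (foot v)
  link_mid : ∀ e, G.IsLink (edge (Sum.inr (Sum.inl e))) (foot (src e)) (foot (tgt e))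
  link_right : ∀ b, G.IsLink (edge (Sum.inr (Sum.inr b))) (cone (fst b)) (cone (snd b))
  cover : ∀ e x y, G.IsLink e x y → x ≠ y → e ∈ Set.range edge

namespace ConeModel

variable (D : G.ConeModel κ η ι)

/-- A chosen edge at the same vertex. -/
noncomputable def root (v : κ) : κ :=
  haveI : Nonempty κ := ⟨v⟩
  Function.invFun D.foot (D.foot v)

theorem foot_root (v : κ) : D.foot (D.root v) = D.foot v :=
  haveI : Nonempty κ := ⟨v⟩
  Function.invFun_eq ⟨v, rfl⟩

theorem root_eq {u v : κ} (h : D.foot u = D.foot v) : D.root u = D.root v := by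
  unfold root; rw [h]

theorem root_root (v : κ) : D.root (D.root v) = D.root v := D.root_eq (D.foot_root v)

/-- The graph on the set of edges at the cones that arises when every vertex that is not a cone is
replaced by a star. -/
noncomputable def star : Graph κ (κ ⊕ η) :=
  -- For a root `v` the edge `Sum.inl v` is a loop and hence in no forest.
  ofEnds (Sum.elim id D.src) (Sum.elim D.root D.tgt)

theorem link_star_inl (v : κ) : D.star.IsLink (Sum.inl v : κ ⊕ η) v (D.root v) :=
  isLink_ofEnds _ _ (Sum.inl v : κ ⊕ η)

theorem link_star_inr (e : η) : D.star.IsLink (Sum.inr e : κ ⊕ η) (D.src e) (D.tgt e) :=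
  isLink_ofEnds _ _ (Sum.inr e : κ ⊕ η)

section Fin

variable [Fintype κ]

open Classical in
/-- The vertices that are not roots. -/
noncomputable def nonroots : Finset κ := Finset.univ.filter fun v => D.root v ≠ v

theorem mem_nonroots {v : κ} : v ∈ D.nonroots ↔ D.root v ≠ v := by simp [nonroots]

/-- The edges of the stars and the given edges, in the star graph. -/
noncomputable def starSet (F : Finset η) : Finset (κ ⊕ η) := D.nonroots.disjSum F

theorem joined_starSet_root (F : Finset η) (v : κ) :
    D.star.Joined (D.starSet F : Set (κ ⊕ η)) v (D.root v) := by
  by_cases h : D.root v = v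
  · rw [h]; exact Joined.rfl'
  · exact Joined.of_link (Finset.mem_coe.2 (Finset.inl_mem_disjSum.2 (D.mem_nonroots.2 h)))
      (D.link_star_inl v)

theorem joined_starSet_of_foot (F : Finset η) {u v : κ} (h : D.foot u = D.foot v) :
    D.star.Joined (D.starSet F : Set (κ ⊕ η)) u v := by
  refine (D.joined_starSet_root F u).trans ?_
  rw [D.root_eq h]
  exact (D.joined_starSet_root F v).symm

theorem foot_eq_of_joined {u v : κ} (h : D.star.Joined (D.starSet ∅ : Set (κ ⊕ η)) u v) :
    D.foot u = D.foot v := by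
  induction h with
  | refl => rfl
  | tail _ hs ih =>
    obtain ⟨e, he, hl⟩ := hs
    rw [ih]
    rcases e with w | e
    · rcases hl with ⟨rfl, rfl⟩ | ⟨rfl, rfl⟩
      · exact (D.foot_root w).symm
      · exact D.foot_root w
    · have := Finset.inr_mem_disjSum.1 (Finset.mem_coe.1 he)
      simp at this

/-- The leaves of the stars are the vertices that are not roots, and each is incident with no star
edge but its own. -/
theorem isForest_starSet_empty : D.star.IsForest (D.starSet ∅ : Set (κ ⊕ η)) := by
  refine ⟨fun _ _ => trivial, ?_⟩
  rintro (w | e) he x y hl hj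
  · have hw := D.mem_nonroots.1 (Finset.inl_mem_disjSum.1 (Finset.mem_coe.1 he))
    have key : ∀ z, D.star.Joined ((D.starSet ∅ : Set (κ ⊕ η)) \ {Sum.inl w}) w z → z = w := by
      intro z hz
      induction hz with
      | refl => rfl
      | tail _ hs ih =>
        obtain ⟨e, ⟨he, hne⟩, hl⟩ := hs
        rw [ih] at hl
        rcases e with w' | e
        · rcases hl with ⟨h1, h2⟩ | ⟨h1, h2⟩
          · exact absurd (by rw [show w' = w from h1]; rfl) hne
          · have h3 : D.root w' = w := h2
            exact absurd (by rw [← h3, D.root_root]) hw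
        · have := Finset.inr_mem_disjSum.1 (Finset.mem_coe.1 he)
          simp at this
    have h1 := D.link_star_inl w
    rcases hl.eq_and_eq_or_eq_and_eq h1 with ⟨rfl, rfl⟩ | ⟨rfl, rfl⟩
    · exact hw (key _ hj)
    · exact hw (key _ hj.symm)
  · have := Finset.inr_mem_disjSum.1 (Finset.mem_coe.1 he)
    simp at this

end Fin

/-- A set of edges of `G`. -/
def edges (S : Finset κ) (F : Finset η) (B : Finset ι) : Set β :=
  D.edge '' (S.disjSum (F.disjSum B) : Finset (κ ⊕ (η ⊕ ι)))

variable {S : Finset κ} {F : Finset η} {B : Finset ι} {v : κ} {e : η} {b : ι} {x : α}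

theorem edge_inl_mem : D.edge (Sum.inl v) ∈ D.edges S F B ↔ v ∈ S := by
  rw [edges, D.inj.mem_set_image, Finset.mem_coe, Finset.inl_mem_disjSum]

theorem edge_mid_mem : D.edge (Sum.inr (Sum.inl e)) ∈ D.edges S F B ↔ e ∈ F := by
  rw [edges, D.inj.mem_set_image, Finset.mem_coe, Finset.inr_mem_disjSum, Finset.inl_mem_disjSum]

theorem edge_right_mem : D.edge (Sum.inr (Sum.inr b)) ∈ D.edges S F B ↔ b ∈ B := by
  rw [edges, D.inj.mem_set_image, Finset.mem_coe, Finset.inr_mem_disjSum, Finset.inr_mem_disjSum]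

theorem edges_subset : D.edges S F B ⊆ Set.range D.edge := Set.image_subset_range _ _

theorem edges_insert_left [DecidableEq κ] :
    D.edges (insert v S) F B = insert (D.edge (Sum.inl v)) (D.edges S F B) := by
  rw [edges, edges, ← Set.image_insert_eq]
  congr 1
  ext x
  rcases x with x | x | x <;> simp

theorem edges_insert_mid [DecidableEq η] :
    D.edges S (insert e F) B = insert (D.edge (Sum.inr (Sum.inl e))) (D.edges S F B) := by
  rw [edges, edges, ← Set.image_insert_eq]
  congr 1
  ext x
  rcases x with x | x | x <;> simp

theorem edges_insert_right [DecidableEq ι] :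
    D.edges S F (insert b B) = insert (D.edge (Sum.inr (Sum.inr b))) (D.edges S F B) := by
  rw [edges, edges, ← Set.image_insert_eq]
  congr 1
  ext x
  rcases x with x | x | x <;> simp

theorem edges_empty : D.edges ∅ ∅ ∅ = ∅ := by simp [edges]

theorem joined_foot (h : G.Joined (D.edges ∅ F ∅) (D.foot v) x) : ∃ u, x = D.foot u := by
  induction h with
  | refl => exact ⟨v, rfl⟩
  | tail _ hs ih =>
    obtain ⟨e, he, hl⟩ := hs
    obtain ⟨u, rfl⟩ := ih
    obtain ⟨w | w | w, rfl⟩ := D.edges_subset he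
    · simp [D.edge_inl_mem] at he
    · rcases hl.eq_and_eq_or_eq_and_eq (D.link_mid w) with ⟨-, rfl⟩ | ⟨-, rfl⟩
      exacts [⟨_, rfl⟩, ⟨_, rfl⟩]
    · simp [D.edge_right_mem] at he

theorem joined_cone {i : Fin 3} (h : G.Joined (D.edges ∅ F ∅) (D.cone i) x) : x = D.cone i := by
  induction h with
  | refl => rfl
  | tail _ hs ih =>
    obtain ⟨e, he, hl⟩ := hs
    rw [ih] at hl
    obtain ⟨w | w | w, rfl⟩ := D.edges_subset he
    · simp [D.edge_inl_mem] at he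
    · rcases hl.eq_and_eq_or_eq_and_eq (D.link_mid w) with ⟨h, -⟩ | ⟨h, -⟩
      · exact absurd h.symm (D.foot_ne _ _)
      · exact absurd h.symm (D.foot_ne _ _)
    · simp [D.edge_right_mem] at he

variable [Fintype κ]

theorem starSet_insert [DecidableEq κ] [DecidableEq η] : (D.starSet (insert e F) : Set (κ ⊕ η)) =
    insert (Sum.inr e) (D.starSet F : Set (κ ⊕ η)) := by
  ext x
  rcases x with x | x <;> simp [starSet]

/-- Contracting the stars gives back the graph on the vertices that are not cones. Forests and
connectivity correspond, by induction on the added edges. -/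
theorem forest_iff_star (F : Finset η) : (G.IsForest (D.edges ∅ F ∅) ↔
    D.star.IsForest (D.starSet F : Set (κ ⊕ η))) ∧ ∀ u v, G.Joined (D.edges ∅ F ∅) (D.foot u)
      (D.foot v) ↔ D.star.Joined (D.starSet F : Set (κ ⊕ η)) u v := by
  classical
  induction F using Finset.induction_on with
  | empty =>
    rw [edges_empty]
    refine ⟨iff_of_true isForest_empty D.isForest_starSet_empty, fun u v => ?_⟩
    rw [joined_empty]
    exact ⟨D.joined_starSet_of_foot ∅, D.foot_eq_of_joined⟩
  | insert e F he ih =>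
    rw [D.edges_insert_mid, D.starSet_insert]
    have he' : Sum.inr e ∉ (D.starSet F : Set (κ ⊕ η)) := fun h =>
      he (Finset.inr_mem_disjSum.1 (Finset.mem_coe.1 h))
    constructor
    · rw [isForest_insert_iff (D.link_mid e) (fun h => he (D.edge_mid_mem.1 h)),
        isForest_insert_iff (D.link_star_inr e) he', ih.1, ih.2]
    · intro u v
      rw [joined_insert_iff (D.link_mid e), joined_insert_iff (D.link_star_inr e)]
      simp only [ih.2]

/-- The component of the star graph that contains `v`. -/
noncomputable abbrev starComp (F : Finset η) (v : κ) : D.star.Comp (D.starSet F : Set (κ ⊕ η)) :=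
  D.star.comp (D.starSet F : Set (κ ⊕ η)) v

open Classical in
/-- The label of a set of edges at the cones. -/
noncomputable def labLeft (F : Finset η) (S : Finset κ) : Lab :=
  ∏ q : D.star.Comp (D.starSet F : Set (κ ⊕ η)), setLab D.col (S.filter fun v => D.starComp F v = q)

open Classical in
theorem labLeft_insert [DecidableEq κ] {l : Lab} (h : setLab D.col (insert v
    (S.filter fun u => D.starComp F u = D.starComp F v)) =
      setLab D.col (S.filter fun u => D.starComp F u = D.starComp F v) * l) :
    D.labLeft F (insert v S) = D.labLeft F S * l := by
  unfold labLeft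
  rw [← Finset.mul_prod_erase _ _ (Finset.mem_univ (D.starComp F v)),
    ← Finset.mul_prod_erase (Finset.univ) (fun q => setLab D.col (S.filter fun v => D.starComp F v = q))
      (Finset.mem_univ (D.starComp F v)), mul_right_comm, ← h, Finset.filter_insert, if_pos rfl]
  congr 1
  refine Finset.prod_congr rfl fun q hq => ?_
  rw [Finset.filter_insert, if_neg]
  exact fun h => (Finset.mem_erase.1 hq).1 h.symm

theorem labLeft_insert_of_forall [DecidableEq κ] (h : ∀ u ∈ S, D.starComp F u ≠ D.starComp F v) :
    D.labLeft F (insert v S) = D.labLeft F S := by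
  classical
  rw [D.labLeft_insert (l := 1), mul_one]
  rw [Finset.filter_eq_empty_iff.2 fun u hu => h u hu, insert_empty_eq, setLab_singleton,
    setLab_empty, mul_one]

theorem labLeft_insert_of_mem [DecidableEq κ] (hv : v ∉ S) {u : κ} (hu : u ∈ S)
    (h : D.starComp F u = D.starComp F v) :
    D.labLeft F (insert v S) = D.labLeft F S * Lab.pair (D.col u) (D.col v) := by
  classical
  refine D.labLeft_insert (setLab_insert _ (Finset.mem_filter.2 ⟨hu, h⟩) ?_)
  exact fun h => hv (Finset.mem_filter.1 h).1

theorem labLeft_empty : D.labLeft F ∅ = 1 := by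
  classical
  refine Finset.prod_eq_one fun q _ => ?_
  rw [Finset.filter_empty, setLab_empty]

end ConeModel

end Graph

/-! ### Forests of the triconed graph in terms of labels -/

namespace Graph

namespace ConeModel

variable {α β κ η ι : Type*} {G : Graph α β} (D : G.ConeModel κ η ι)
  {S S' : Finset κ} {F F' : Finset η} {B B' : Finset ι} {u v : κ} {e : η} {b : ι} {x y : α}

theorem edges_mono (hS : S ⊆ S') (hF : F ⊆ F') (hB : B ⊆ B') : D.edges S F B ⊆ D.edges S' F' B' :=
  Set.image_mono (Finset.coe_subset.2 (Finset.disjSum_mono hS (Finset.disjSum_mono hF hB)))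

variable [Fintype κ]

theorem starComp_eq_of_foot (h : D.foot u = D.foot v) : D.starComp F u = D.starComp F v :=
  comp_eq_iff.2 (D.joined_starSet_of_foot F h)

theorem joined_of_starComp (h : D.starComp F u = D.starComp F v) :
    G.Joined (D.edges S F B) (D.foot u) (D.foot v) :=
  (((D.forest_iff_star F).2 u v).2 (comp_eq_iff.1 h)).mono
    (D.edges_mono (Finset.empty_subset _) subset_rfl (Finset.empty_subset _))

/-- Induction on the edges at the cones. The last clause carries the induction: a component of `F`
not yet touched by `S` is still a component, so it is joined to no cone. -/
theorem forest_left (hF : G.IsForest (D.edges ∅ F ∅)) (S : Finset κ) :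
    (G.IsForest (D.edges S F ∅) ↔ D.labLeft F S ≠ 0) ∧ (D.labLeft F S ≠ 0 →
      (∀ i j, G.Joined (D.edges S F ∅) (D.cone i) (D.cone j) ↔ (D.labLeft F S).rel i j = true) ∧
      ∀ v, (∀ u ∈ S, D.starComp F u ≠ D.starComp F v) → ∀ y, G.Joined (D.edges S F ∅) (D.foot v) y →
        ∃ u, y = D.foot u ∧ D.starComp F u = D.starComp F v) := by
  classical
  induction S using Finset.induction_on with
  | empty =>
    rw [labLeft_empty]
    refine ⟨iff_of_true hF (by decide), fun _ => ⟨fun i j => ?_, fun v _ y hy => ?_⟩⟩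
    · constructor
      · intro h
        have := D.cone_inj (D.joined_cone h)
        subst this
        exact (by decide : ∀ k : Fin 3, Lab.rel 1 k k = true) _
      · intro h
        rw [(by decide : ∀ i j : Fin 3, Lab.rel 1 i j = true → i = j) i j h]
        exact Joined.rfl'
    · obtain ⟨u, rfl⟩ := D.joined_foot hy
      exact ⟨u, rfl, (comp_eq_iff.2 (((D.forest_iff_star F).2 v u).1 hy)).symm⟩
  | insert v S hv ih =>
    obtain ⟨ih1, ih2⟩ := ih
    have hl := D.link_left v
    have hn : D.edge (Sum.inl v) ∉ D.edges S F ∅ := fun h => hv (D.edge_inl_mem.1 h)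
    rw [D.edges_insert_left]
    have hfar : D.labLeft F S ≠ 0 → ∀ v', (∀ u ∈ insert v S, D.starComp F u ≠ D.starComp F v') →
        ∀ y, G.Joined (insert (D.edge (Sum.inl v)) (D.edges S F ∅)) (D.foot v') y →
        ∃ u, y = D.foot u ∧ D.starComp F u = D.starComp F v' := by
      intro h0 v' hv' y hy
      have h2 := (ih2 h0).2 v' fun u hu => hv' u (Finset.mem_insert_of_mem hu)
      rcases (joined_insert_iff hl).1 hy with h | ⟨h, -⟩ | ⟨h, -⟩
      · exact h2 y h
      · obtain ⟨u, hu, -⟩ := h2 _ h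
        exact absurd hu.symm (D.foot_ne _ _)
      · obtain ⟨u, hu, hc⟩ := h2 _ h
        rw [← D.starComp_eq_of_foot hu] at hc
        exact absurd hc (hv' v (Finset.mem_insert_self _ _))
    -- The first edge from a component to a cone only attaches a tree. A further one acts like an
    -- edge between the cones of the old and the new edge.
    by_cases hS : ∀ u ∈ S, D.starComp F u ≠ D.starComp F v
    · rw [D.labLeft_insert_of_forall hS, isForest_insert_iff hl hn, ih1]
      have hfree : D.labLeft F S ≠ 0 → ∀ i, ¬ G.Joined (D.edges S F ∅) (D.cone i) (D.foot v) := by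
        intro h0 i h
        obtain ⟨u, hu, -⟩ := (ih2 h0).2 v hS _ h.symm
        exact D.foot_ne _ _ hu.symm
      refine ⟨⟨fun h => h.1, fun h => ⟨h, hfree h _⟩⟩, fun h0 => ⟨fun i j => ?_, hfar h0⟩⟩
      rw [joined_insert_iff hl, ← (ih2 h0).1]
      refine ⟨?_, Or.inl⟩
      rintro (h | ⟨-, h⟩ | ⟨h, -⟩)
      exacts [h, absurd h.symm (hfree h0 _), absurd h (hfree h0 _)]
    · push Not at hS
      obtain ⟨u, hu, huv⟩ := hS
      rw [D.labLeft_insert_of_mem hv hu huv, isForest_insert_iff hl hn, ih1]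
      by_cases h0 : D.labLeft F S = 0
      · rw [h0, zero_mul]
        exact ⟨⟨fun h => absurd rfl h.1, fun h => absurd rfl h⟩, fun h => absurd rfl h⟩
      have hj : G.Joined (D.edges S F ∅) (D.foot v) (D.cone (D.col u)) :=
        (D.joined_of_starComp huv).symm.trans
          (Joined.of_link (D.edge_inl_mem.2 hu) (D.link_left u)).symm
      have hr := (ih2 h0).1
      refine ⟨?_, fun h1 => ⟨fun i j => ?_, hfar h0⟩⟩
      · rw [Lab.mul_pair_ne_zero _ _ _ h0, ← Bool.not_eq_true, ← hr]
        constructor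
        · exact fun h h' => h.2 (h'.symm.trans hj.symm)
        · exact fun h => ⟨h0, fun h' => h (hj.symm.trans h'.symm)⟩
      · rw [joined_insert_iff hl, Lab.rel_mul_pair _ _ _ _ _ h1, ← hr, ← hr, ← hr, ← hr, ← hr]
        have e1 : ∀ z, G.Joined (D.edges S F ∅) (D.foot v) z ↔
            G.Joined (D.edges S F ∅) (D.cone (D.col u)) z := fun z =>
          ⟨fun h => hj.symm.trans h, fun h => hj.trans h⟩
        have e2 : ∀ z, G.Joined (D.edges S F ∅) z (D.foot v) ↔
            G.Joined (D.edges S F ∅) z (D.cone (D.col u)) := fun z =>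
          ⟨fun h => h.trans hj, fun h => h.trans hj.symm⟩
        rw [e1, e2]
        tauto

theorem forest_iff (hF : G.IsForest (D.edges ∅ F ∅)) (S : Finset κ) (B : Finset ι) :
    (G.IsForest (D.edges S F B) ↔
      D.labLeft F S * ∏ b ∈ B, Lab.pair (D.fst b) (D.snd b) ≠ 0) ∧
    (D.labLeft F S * ∏ b ∈ B, Lab.pair (D.fst b) (D.snd b) ≠ 0 →
      ∀ i j, G.Joined (D.edges S F B) (D.cone i) (D.cone j) ↔
        (D.labLeft F S * ∏ b ∈ B, Lab.pair (D.fst b) (D.snd b)).rel i j = true) := by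
  classical
  induction B using Finset.induction_on with
  | empty =>
    rw [Finset.prod_empty, mul_one]
    exact ⟨(D.forest_left hF S).1, fun h => ((D.forest_left hF S).2 h).1⟩
  | insert b B hb ih =>
    obtain ⟨ih1, ih2⟩ := ih
    have hl := D.link_right b
    have hn : D.edge (Sum.inr (Sum.inr b)) ∉ D.edges S F B := fun h => hb (D.edge_right_mem.1 h)
    rw [D.edges_insert_right, Finset.prod_insert hb, mul_comm (Lab.pair _ _), ← mul_assoc,
      isForest_insert_iff hl hn, ih1]
    by_cases h0 : D.labLeft F S * ∏ b ∈ B, Lab.pair (D.fst b) (D.snd b) = 0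
    · rw [h0, zero_mul]
      exact ⟨⟨fun h => absurd rfl h.1, fun h => absurd rfl h⟩, fun h => absurd rfl h⟩
    have hr := ih2 h0
    refine ⟨?_, fun h1 i j => ?_⟩
    · rw [Lab.mul_pair_ne_zero _ _ _ h0, ← Bool.not_eq_true, ← hr]
      exact ⟨fun h => h.2, fun h => ⟨h0, h⟩⟩
    · rw [joined_insert_iff hl, Lab.rel_mul_pair _ _ _ _ _ h1, ← hr, ← hr, ← hr, ← hr, ← hr]

end ConeModel

end Graph

/-! ### Generating functions and the substitution -/

open Finset in
/-- Sums over all sets factor over the fibres of a map. -/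
theorem Finset.prod_sum_powerset_fiber {κ Q R : Type*} [Fintype κ] [Fintype Q] [DecidableEq κ]
    [DecidableEq Q] [CommSemiring R] (g : κ → Q) (f : Q → Finset κ → R) :
    ∏ q, ∑ S ∈ (univ.filter fun v => g v = q).powerset, f q S =
      ∑ S : Finset κ, ∏ q, f q (S.filter fun v => g v = q) := by
  rw [prod_univ_sum]
  have key : ∀ p ∈ Fintype.piFinset fun q => (univ.filter fun v => g v = q).powerset,
      ∀ q, (univ.biUnion p).filter (fun v => g v = q) = p q := by
    intro p hp q
    have hp' : ∀ q, ∀ v ∈ p q, g v = q := fun q v hv =>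
      (mem_filter.1 (mem_powerset.1 (Fintype.mem_piFinset.1 hp q) hv)).2
    ext v
    rw [mem_filter, mem_biUnion]
    constructor
    · rintro ⟨⟨q', -, hv⟩, rfl⟩
      rwa [hp' q' v hv]
    · exact fun hv => ⟨⟨q, mem_univ _, hv⟩, hp' q v hv⟩
  refine sum_bij' (fun p _ => univ.biUnion p) (fun S _ q => S.filter fun v => g v = q)
    (fun _ _ => mem_univ _) ?_ ?_ ?_ ?_
  · intro S _
    rw [Fintype.mem_piFinset]
    exact fun q => mem_powerset.2 (filter_subset_filter _ (subset_univ _))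
  · intro p hp
    exact funext fun q => key p hp q
  · intro S _
    ext v
    simp
  · intro p hp
    exact prod_congr rfl fun q _ => by rw [key p hp q]

namespace Tri

variable {κ : Type*} {col : κ → Fin 3}

open Graph (numColour)

/-- The weighted sum of the labels of the sets of objects with the given numbers of objects of each
colour. -/
def setGen (a : Fin 3 → ℝ) (s : ℝ) : Tri :=
  ⟨1 + (a 0 + a 1 + a 2) * s, s ^ 2 * (a 0 * a 1), s ^ 2 * (a 0 * a 2), s ^ 2 * (a 1 * a 2),
    s ^ 3 * (a 0 * (a 1 * a 2))⟩

theorem numColour_insert [DecidableEq κ] {K : Finset κ} {u : κ} (hu : u ∉ K) (i : Fin 3) :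
    numColour col (insert u K) i = numColour col K i + if col u = i then 1 else 0 := by
  classical
  unfold numColour
  rw [Finset.filter_insert]
  split_ifs with h
  · rw [Finset.card_insert_of_notMem (fun h => hu (Finset.mem_filter.1 h).1)]; push_cast; rfl
  · rw [add_zero]

theorem numColour_empty (i : Fin 3) : numColour col ∅ i = 0 := by simp [numColour]

/-- The weighted sum of the labels of the sets that contain a given object of colour `i`. -/
def starGen (i : Fin 3) (a : Fin 3 → ℝ) (s : ℝ) : Tri :=
  if i = 0 then ⟨1, s * a 1, s * a 2, 0, s ^ 2 * (a 1 * a 2)⟩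
  else if i = 1 then ⟨1, s * a 0, 0, s * a 2, s ^ 2 * (a 0 * a 2)⟩
  else ⟨1, 0, s * a 0, s * a 1, s ^ 2 * (a 0 * a 1)⟩

theorem ofLab_pair_zero_one : ofLab (Lab.pair 0 1) = ⟨0, 1, 0, 0, 0⟩ := rfl
theorem ofLab_pair_one_zero : ofLab (Lab.pair 1 0) = ⟨0, 1, 0, 0, 0⟩ := rfl
theorem ofLab_pair_zero_two : ofLab (Lab.pair 0 2) = ⟨0, 0, 1, 0, 0⟩ := rfl
theorem ofLab_pair_two_zero : ofLab (Lab.pair 2 0) = ⟨0, 0, 1, 0, 0⟩ := rfl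
theorem ofLab_pair_one_two : ofLab (Lab.pair 1 2) = ⟨0, 0, 0, 1, 0⟩ := rfl
theorem ofLab_pair_two_one : ofLab (Lab.pair 2 1) = ⟨0, 0, 0, 1, 0⟩ := rfl
theorem ofLab_pair_self (i : Fin 3) : ofLab (Lab.pair i i) = 0 := by fin_cases i <;> rfl

theorem starGen_mul (i j : Fin 3) (a a' : Fin 3 → ℝ) (s : ℝ)
    (h : ∀ k, a' k = a k + if j = k then 1 else 0) :
    starGen i a s * (1 + C s * ofLab (Lab.pair i j)) = starGen i a' s := by
  have h0 := h 0
  have h1 := h 1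
  have h2 := h 2
  fin_cases i <;> fin_cases j <;>
    simp [starGen, ofLab_pair_zero_one, ofLab_pair_one_zero, ofLab_pair_zero_two,
      ofLab_pair_two_zero, ofLab_pair_one_two, ofLab_pair_two_one, ofLab_pair_self] at h0 h1 h2 ⊢ <;>
    simp only [h0, h1, h2, true_or, and_self] <;> ext <;> simp <;> ring

theorem prod_pair (K : Finset κ) (i : Fin 3) (s : ℝ) :
    ∏ u ∈ K, (1 + C s * ofLab (Lab.pair i (col u))) = starGen i (numColour col K) s := by
  classical
  induction K using Finset.induction_on with
  | empty =>
    rw [Finset.prod_empty]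
    simp only [starGen, numColour_empty]
    split_ifs <;> ext <;> simp
  | insert u K hu ih =>
    rw [Finset.prod_insert hu, ih, mul_comm]
    exact starGen_mul i (col u) _ _ s fun k => numColour_insert hu k

/-- Once `v` is in the set, each further object multiplies the label by its pair with `v`, so the
sum is a product. -/
theorem sum_setLab_insert [DecidableEq κ] (K : Finset κ) {v : κ} (hv : v ∉ K) (s : ℝ) :
    ∑ S ∈ K.powerset, C (s ^ S.card) * ofLab (setLab col (insert v S)) =
      ∏ u ∈ K, (1 + C s * ofLab (Lab.pair (col v) (col u))) := by
  induction K using Finset.induction_on with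
  | empty => simp [setLab_singleton]
  | insert u K hu ih =>
    rw [Finset.mem_insert, not_or] at hv
    rw [Finset.sum_powerset_insert hu, Finset.prod_insert hu, ih hv.2, add_mul, one_mul,
      ← ih hv.2, Finset.mul_sum]
    congr 1
    refine Finset.sum_congr rfl fun S hS => ?_
    have huS : u ∉ S := fun h => hu (Finset.mem_powerset.1 hS h)
    rw [Finset.card_insert_of_notMem huS, Finset.insert_comm, setLab_insert col
      (Finset.mem_insert_self v S) (by
        rw [Finset.mem_insert, not_or]; exact ⟨fun h => hv.1 h.symm, huS⟩), pow_succ, map_mul,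
      map_mul]
    ring

theorem setGen_add (j : Fin 3) (a a' : Fin 3 → ℝ) (s : ℝ)
    (h : ∀ k, a' k = a k + if j = k then 1 else 0) :
    setGen a s + C s * starGen j a s = setGen a' s := by
  have h0 := h 0
  have h1 := h 1
  have h2 := h 2
  fin_cases j <;> simp [starGen, setGen] at h0 h1 h2 ⊢ <;>
    (rw [h0, h1, h2]; ext <;> simp <;> ring)

theorem sum_setLab (K : Finset κ) (s : ℝ) :
    ∑ S ∈ K.powerset, C (s ^ S.card) * ofLab (setLab col S) = setGen (numColour col K) s := by
  classical
  induction K using Finset.induction_on with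
  | empty =>
    simp only [setGen, numColour_empty, Finset.powerset_empty, Finset.sum_singleton, setLab_empty]
    ext <;> simp
  | insert u K hu ih =>
    rw [Finset.sum_powerset_insert hu, ih, ← setGen_add (col u) (numColour col K)
      (numColour col (insert u K)) s (fun k => numColour_insert hu k), ← prod_pair,
      ← sum_setLab_insert K hu, Finset.mul_sum]
    congr 1
    refine Finset.sum_congr rfl fun S hS => ?_
    rw [Finset.card_insert_of_notMem fun h => hu (Finset.mem_powerset.1 hS h), pow_succ, map_mul]
    ring

/-- With `s = t / (1 - t)` a factor `1 - t` turns `s` into `t`. The additional term of `theta`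
contributes `t * (1 - t) * s ^ 2 = t ^ 3 / (1 - t)` per pair of colours 1 and 2, which accounts for
the degenerate triples. -/
theorem theta_setGen {t : ℝ} (ht : 1 - t ≠ 0) (a : Fin 3 → ℝ) :
    theta t (setGen a (t / (1 - t))) = C (1 - t)⁻¹ * Graph.markGen a t := by
  change (⟨_, _, _, _, _⟩ : Tri) = _
  ext <;> simp [setGen, Graph.markGen] <;> field_simp <;> ring

/-- The factor of the base edge 12 becomes `1 + t * x12 + t ^ 2 * top`, since `t * (1 - t) * s = t ^
2`; this explains the labels of the extra variable. -/
theorem theta_base {t : ℝ} (ht : 1 - t ≠ 0) (b : Bool) :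
    theta t (if b then 1 + C (t / (1 - t)) * ofLab Lab.x12 else 1) =
      ∑ k ∈ Finset.range 3, C (t ^ k) * ofLab (zlab b k) := by
  rw [Finset.sum_range_succ, Finset.sum_range_succ, Finset.sum_range_one]
  cases b
  · have h : ofLab 0 = 0 := rfl
    rw [if_neg (by decide), map_one]
    change _ = _ + _ * ofLab 0 + _ * ofLab 0
    rw [h, pow_zero, map_one, zlab_zero, map_one]
    simp
  · rw [if_pos rfl]
    change (⟨_, _, _, _, _⟩ : Tri) = C (t ^ 0) * vec Lab.one + C (t ^ 1) * vec Lab.x12 +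
      C (t ^ 2) * vec Lab.top
    have h : ofLab Lab.x12 = ⟨0, 0, 0, 1, 0⟩ := rfl
    rw [h]
    ext <;> simp only [vec, Tri.add_r, Tri.mul_r, Tri.C_r, Tri.one_r, Tri.add_a, Tri.mul_a,
      Tri.C_a, Tri.one_a, Tri.add_b, Tri.mul_b, Tri.C_b, Tri.one_b, Tri.add_c, Tri.mul_c, Tri.C_c,
      Tri.one_c, Tri.add_y, Tri.mul_y, Tri.C_y, Tri.one_y] <;> field_simp <;> ring

/-- This identity dictates the form of `theta`. For example, `x12` times the two base factors has
total `1 + 2 * s`, and `(1 - t) ^ 2 * (1 + 2 * s) = 1 - t ^ 2` is the total of the image of `x12`.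
-/
theorem total_theta {t : ℝ} (ht : 1 - t ≠ 0) (u : Tri) :
    (1 - t) ^ 2 * total (u * ((1 + C (t / (1 - t)) * ofLab Lab.x01) *
      (1 + C (t / (1 - t)) * ofLab Lab.x02))) = total (theta t u) := by
  have h1 : ofLab Lab.x01 = ⟨0, 1, 0, 0, 0⟩ := rfl
  have h2 : ofLab Lab.x02 = ⟨0, 0, 1, 0, 0⟩ := rfl
  rw [h1, h2]
  simp [total, theta]
  field_simp
  ring

end Tri

/-! ### The h-polynomial of a triconed graph -/

namespace Graph

theorem mem_forests {α β : Type*} [Fintype β] {G : Graph α β} {N A : Finset β} :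
    A ∈ G.forests N ↔ N ⊆ A ∧ G.IsForest (A : Set β) := by
  classical
  rw [forests, Finset.mem_filter, and_iff_right (Finset.mem_univ _)]

namespace ConeModel

variable {α β κ η ι : Type*} {G : Graph α β} (D : G.ConeModel κ η ι)
  {F : Finset η}

theorem notMem_of_root {A : Finset (κ ⊕ η)} (hA : D.star.IsForest (A : Set (κ ⊕ η))) {v : κ}
    (hv : D.root v = v) : Sum.inl v ∉ A := by
  intro h
  have hl := D.link_star_inl v
  rw [hv] at hl
  exact hA.ne_of_link (Finset.mem_coe.2 h) hl rfl

theorem coe_map_edge (S : Finset κ) (F : Finset η) (B : Finset ι) :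
    ((S.disjSum (F.disjSum B)).map ⟨D.edge, D.inj⟩ : Set β) = D.edges S F B := by
  rw [Finset.coe_map]; rfl

theorem subset_range_of_isForest {I : Set β} (hI : G.IsForest I) : I ⊆ Set.range D.edge := by
  intro e he
  obtain ⟨x, y, hl⟩ := G.exists_isLink_of_mem_edgeSet (hI.1 he)
  exact D.cover e x y hl (hI.ne_of_link he hl)

variable [Fintype κ]

theorem card_starSet_sub : (D.starSet F).card - (D.starSet ∅).card = F.card := by
  unfold starSet
  rw [Finset.card_disjSum, Finset.card_disjSum, Finset.card_empty]
  omega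

theorem sum_labLeft (F : Finset η) (s : ℝ) :
    ∑ S : Finset κ, Tri.C (s ^ S.card) * Tri.ofLab (D.labLeft F S) =
      ∏ q, Tri.setGen (D.star.compColour (D.starSet F : Set (κ ⊕ η)) D.col q) s := by
  classical
  have h : ∀ q, Tri.setGen (D.star.compColour (D.starSet F : Set (κ ⊕ η)) D.col q) s =
      ∑ S ∈ (Finset.univ.filter fun v => D.starComp F v = q).powerset,
        Tri.C (s ^ S.card) * Tri.ofLab (setLab D.col S) := fun q => (Tri.sum_setLab _ s).symm
  simp only [h]
  refine Eq.trans ?_ (Finset.prod_sum_powerset_fiber (fun v => D.starComp F v)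
    (fun _ S => Tri.C (s ^ S.card) * Tri.ofLab (setLab D.col S))).symm
  refine Finset.sum_congr rfl fun S _ => ?_
  rw [Finset.prod_mul_distrib, ← map_prod, ← map_prod, Finset.prod_pow_eq_pow_sum,
    ← Finset.card_eq_sum_card_fiberwise (fun _ _ => Finset.mem_univ _)]
  rfl

variable [Fintype ι]

open Classical in
theorem sum_forests (hF : G.IsForest (D.edges ∅ F ∅)) (s : ℝ) :
    ∑ S : Finset κ, ∑ B : Finset ι,
      (if G.IsForest (D.edges S F B) then s ^ (S.card + B.card) else 0) =
    Tri.total ((∏ q, Tri.setGen (D.star.compColour (D.starSet F : Set (κ ⊕ η)) D.col q) s) *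
      ∏ b : ι, (1 + Tri.C s * Tri.ofLab (Lab.pair (D.fst b) (D.snd b)))) := by
  rw [← sum_labLeft, Finset.prod_one_add, Finset.powerset_univ, Finset.sum_mul_sum, map_sum]
  refine Finset.sum_congr rfl fun S _ => ?_
  rw [map_sum]
  refine Finset.sum_congr rfl fun B _ => ?_
  have h : Tri.C (s ^ S.card) * Tri.ofLab (D.labLeft F S) *
      ∏ b ∈ B, (Tri.C s * Tri.ofLab (Lab.pair (D.fst b) (D.snd b))) =
      Tri.C (s ^ (S.card + B.card)) *
        Tri.ofLab (D.labLeft F S * ∏ b ∈ B, Lab.pair (D.fst b) (D.snd b)) := by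
    rw [Finset.prod_mul_distrib, Finset.prod_const, ← map_prod, pow_add, map_mul, map_mul,
      map_pow Tri.C s B.card]
    ring
  rw [h, Tri.total_C_mul, Tri.total_ofLab]
  by_cases h0 : G.IsForest (D.edges S F B)
  · rw [if_pos h0, if_pos ((D.forest_iff hF S B).1.1 h0), mul_one]
  · rw [if_neg h0, if_neg (fun h => h0 ((D.forest_iff hF S B).1.2 h)), mul_zero]

/-- The base edges are the two edges at the first cone and possibly a third edge. -/
def HasBase (b : Bool) : Prop := ∀ s : ℝ,
  ∏ k : ι, (1 + Tri.C s * Tri.ofLab (Lab.pair (D.fst k) (D.snd k))) =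
    (if b then 1 + Tri.C s * Tri.ofLab Lab.x12 else 1) *
      ((1 + Tri.C s * Tri.ofLab Lab.x01) * (1 + Tri.C s * Tri.ofLab Lab.x02))

/-- The rank of the graph. -/
noncomputable def rank : ℕ := Fintype.card κ - D.nonroots.card + 2

variable [Fintype η]

open Classical in
-- The rank is the number of edges of `F`, plus the number of components, plus 2. The corresponding
-- powers of `1 - t` turn `s ^ |F|` into `t ^ |F|`, cancel the inverse factor that each component
-- gets from `theta_setGen`, and supply the square in `total_theta`.
theorem sum_forests_eq {b : Bool} (hb : D.HasBase b) (hF : G.IsForest (D.edges ∅ F ∅)) {t : ℝ}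
    (ht : 0 < t) (ht' : t < 1)
    (hr : ∀ S B, G.IsForest (D.edges S F B) → S.card + F.card + B.card ≤ D.rank) :
    ∑ S : Finset κ, ∑ B : Finset ι, (if G.IsForest (D.edges S F B) then
      t ^ (S.card + F.card + B.card) * (1 - t) ^ (D.rank - (S.card + F.card + B.card)) else 0) =
    t ^ F.card * Tri.total ((∑ k ∈ Finset.range 3, Tri.C (t ^ k) * Tri.ofLab (zlab b k)) *
      ∏ q, markGen (D.star.compColour (D.starSet F : Set (κ ⊕ η)) D.col q) t) := by
  have h1 : 1 - t ≠ 0 := by linarith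
  set s := t / (1 - t) with hs
  have hst : t = s * (1 - t) := by rw [hs]; field_simp
  have hpow : ∀ m, m ≤ D.rank → t ^ m * (1 - t) ^ (D.rank - m) = (1 - t) ^ D.rank * s ^ m := by
    intro m hm
    obtain ⟨k, hk⟩ := Nat.exists_eq_add_of_le hm
    rw [hk, Nat.add_sub_cancel_left]
    nth_rewrite 1 [hst]
    rw [mul_pow, pow_add]
    ring
  have h2 : ∑ S : Finset κ, ∑ B : Finset ι, (if G.IsForest (D.edges S F B) then
      t ^ (S.card + F.card + B.card) * (1 - t) ^ (D.rank - (S.card + F.card + B.card)) else 0) =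
      (1 - t) ^ D.rank * s ^ F.card * ∑ S : Finset κ, ∑ B : Finset ι,
      (if G.IsForest (D.edges S F B) then s ^ (S.card + B.card) else 0) := by
    rw [Finset.mul_sum]
    refine Finset.sum_congr rfl fun S _ => ?_
    rw [Finset.mul_sum]
    refine Finset.sum_congr rfl fun B _ => ?_
    split_ifs with h
    · rw [hpow _ (hr S B h), mul_assoc, ← pow_add]
      congr 2
      ring
    · rw [mul_zero]
  have hcomp := card_add_card_comp ((D.forest_iff_star F).1.1 hF)
  have hcard : (D.starSet F).card = D.nonroots.card + F.card := Finset.card_disjSum _ _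
  have hrank : D.rank = F.card + Fintype.card (D.star.Comp (D.starSet F : Set (κ ⊕ η))) + 2 := by
    unfold rank; omega
  rw [h2, D.sum_forests hF, hb, ← mul_assoc, hrank, pow_add, mul_assoc ((1 - t) ^ _),
    mul_comm ((1 - t) ^ 2), mul_assoc, mul_assoc, Tri.total_theta h1, map_mul, map_prod,
    Tri.theta_base h1]
  simp only [hs, Tri.theta_setGen h1]
  rw [Finset.prod_mul_distrib, Finset.prod_const, ← map_pow, mul_assoc (Tri.C _), Tri.total_C_mul,
    mul_comm (∏ q, _), Finset.card_univ]
  rw [pow_add, div_pow, inv_pow]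
  field_simp

/-- A forest contains no star edge of a root, as these are loops; so if it contains all the others,
it is determined by its edges in `η`. -/
theorem eq_starSet {A : Finset (κ ⊕ η)} (hA : A ∈ D.star.forests (D.starSet ∅)) :
    A = D.starSet A.toRight := by
  obtain ⟨hN, hA⟩ := mem_forests.1 hA
  ext x
  rcases x with v | e
  · unfold starSet
    rw [Finset.inl_mem_disjSum]
    constructor
    · intro h
      rw [mem_nonroots]
      exact fun h' => D.notMem_of_root hA h' h
    · exact fun h => hN (Finset.inl_mem_disjSum.2 h)
  · unfold starSet
    rw [Finset.inr_mem_disjSum, Finset.mem_toRight]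

open Classical in
theorem sum_star_forests (f : Finset (κ ⊕ η) → ℝ) :
    ∑ A ∈ D.star.forests (D.starSet ∅), f A =
      ∑ F : Finset η, if G.IsForest (D.edges ∅ F ∅) then f (D.starSet F) else 0 := by
  rw [← Finset.sum_filter]
  symm
  refine Finset.sum_bij (fun F _ => D.starSet F) ?_ ?_ ?_ ?_
  · intro F hF
    rw [mem_forests]
    exact ⟨Finset.disjSum_mono subset_rfl (Finset.empty_subset F),
      (D.forest_iff_star F).1.1 (Finset.mem_filter.1 hF).2⟩
  · intro F _ F' _ h
    exact (Finset.disjSum_inj.1 h).2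
  · intro A hA
    refine ⟨A.toRight, ?_, (D.eq_starSet hA).symm⟩
    rw [Finset.mem_filter]
    refine ⟨Finset.mem_univ _, (D.forest_iff_star _).1.2 ?_⟩
    rw [← D.eq_starSet hA]
    exact (mem_forests.1 hA).2
  · exact fun _ _ => rfl

open Classical in
-- Edges outside the model are loops, which lie in no independent set, so independent sets are
-- triples of subsets of `η`, `κ` and `ι`.
theorem sum_indeps (hE : G.graphicMatroid.E.Finite) (f : ℕ → ℝ) :
    ∑ I ∈ Matroid.finsetIndeps hE, f I.card = ∑ F : Finset η, ∑ S : Finset κ, ∑ B : Finset ι,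
      if G.IsForest (D.edges S F B) then f (S.card + F.card + B.card) else 0 := by
  have h : ∑ F : Finset η, ∑ S : Finset κ, ∑ B : Finset ι,
      (if G.IsForest (D.edges S F B) then f (S.card + F.card + B.card) else 0) =
      ∑ p : Finset η × Finset κ × Finset ι, if G.IsForest (D.edges p.2.1 p.1 p.2.2) then
        f (p.2.1.card + p.1.card + p.2.2.card) else 0 := by
    rw [Fintype.sum_prod_type]
    refine Finset.sum_congr rfl fun F _ => ?_
    rw [Fintype.sum_prod_type]
  rw [h, ← Finset.sum_filter]
  symm
  refine Finset.sum_bij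
    (fun p _ => (p.2.1.disjSum (p.1.disjSum p.2.2)).map ⟨D.edge, D.inj⟩) ?_ ?_ ?_ ?_
  · intro p hp
    rw [Matroid.mem_finsetIndeps, D.coe_map_edge]
    exact (Finset.mem_filter.1 hp).2
  · rintro ⟨F, S, B⟩ _ ⟨F', S', B'⟩ _ h
    have h1 := Finset.disjSum_inj.1 (Finset.map_injective _ h)
    have h2 := Finset.disjSum_inj.1 h1.2
    simp only at h1 h2
    rw [h1.1, h2.1, h2.2]
  · intro I hI
    have hI := Matroid.mem_finsetIndeps.1 hI
    have hsub := D.subset_range_of_isForest hI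
    obtain ⟨T, hT⟩ : ∃ T : Finset (κ ⊕ (η ⊕ ι)), T.map ⟨D.edge, D.inj⟩ = I := by
      refine ⟨Finset.univ.filter fun x => D.edge x ∈ I, ?_⟩
      ext e
      rw [Finset.mem_map]
      constructor
      · rintro ⟨x, hx, rfl⟩
        exact (Finset.mem_filter.1 hx).2
      · intro he
        obtain ⟨x, rfl⟩ := hsub he
        exact ⟨x, Finset.mem_filter.2 ⟨Finset.mem_univ _, he⟩, rfl⟩
    have hT' : T.toLeft.disjSum (T.toRight.toLeft.disjSum T.toRight.toRight) = T := by
      rw [Finset.toLeft_disjSum_toRight, Finset.toLeft_disjSum_toRight]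
    refine ⟨(T.toRight.toLeft, T.toLeft, T.toRight.toRight), ?_, ?_⟩
    · rw [Finset.mem_filter]
      refine ⟨Finset.mem_univ _, ?_⟩
      simp only
      rw [← D.coe_map_edge, hT', hT]
      exact hI
    · simp only
      rw [hT', hT]
  · intro p _
    simp only [Finset.card_map, Finset.card_disjSum]
    congr 1
    ring

end ConeModel

end Graph

/-! ### The rank and the order ideal -/

namespace Graph

namespace ConeModel

variable {α β κ η ι : Type*} {G : Graph α β} (D : G.ConeModel κ η ι) [Fintype κ]

open Classical in
/-- The chosen edges. -/
noncomputable def roots : Finset κ := Finset.univ.filter fun v => D.root v = v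

theorem mem_roots {v : κ} : v ∈ D.roots ↔ D.root v = v := by simp [roots]

theorem card_roots : D.roots.card = Fintype.card κ - D.nonroots.card := by
  classical
  have h := Finset.card_filter_add_card_filter_not (s := (Finset.univ : Finset κ))
    (fun v => D.root v = v)
  rw [Finset.card_univ] at h
  have h1 : D.roots.card = (Finset.univ.filter fun v => D.root v = v).card := by
    unfold roots; congr
  have h2 : D.nonroots.card = (Finset.univ.filter fun v => ¬ D.root v = v).card := by
    unfold nonroots; congr
  omega

theorem labLeft_of_subset_roots (S : Finset κ) : S ⊆ D.roots → D.labLeft ∅ S = 1 := by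
  classical
  induction S using Finset.induction_on with
  | empty => exact fun _ => D.labLeft_empty
  | insert v S hv ih =>
    intro h
    rw [D.labLeft_insert_of_forall, ih ((Finset.subset_insert v S).trans h)]
    intro u hu huv
    have h1 := D.root_eq (D.foot_eq_of_joined (comp_eq_iff.1 huv))
    rw [D.mem_roots.1 (h (Finset.mem_insert_of_mem hu)),
      D.mem_roots.1 (h (Finset.mem_insert_self v S))] at h1
    exact hv (h1 ▸ hu)

/-- One cone edge at each foot together with base edges connecting the cones joins the ends of every
edge and has no cycle. This computes the rank. -/
theorem isBase_roots {B : Finset ι} (hB : ∏ b ∈ B, Lab.pair (D.fst b) (D.snd b) = Lab.top) :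
    G.graphicMatroid.IsBase (D.edges D.roots ∅ B) := by
  have hF : G.IsForest (D.edges ∅ ∅ ∅) := by rw [edges_empty]; exact isForest_empty
  obtain ⟨h1, h2⟩ := D.forest_iff hF D.roots B
  have hl : D.labLeft ∅ D.roots * ∏ b ∈ B, Lab.pair (D.fst b) (D.snd b) = Lab.top := by
    rw [hB, D.labLeft_of_subset_roots _ subset_rfl, one_mul]
  rw [hl] at h1 h2
  have hne : Lab.top ≠ 0 := by decide
  have hcone : ∀ i j, G.Joined (D.edges D.roots ∅ B) (D.cone i) (D.cone j) := fun i j =>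
    (h2 hne i j).2 ((by decide : ∀ i j, Lab.rel Lab.top i j = true) i j)
  have hfoot : ∀ v, G.Joined (D.edges D.roots ∅ B) (D.cone 0) (D.foot v) := by
    intro v
    rw [← D.foot_root v]
    exact (hcone 0 _).trans (Joined.of_link
      (D.edge_inl_mem.2 (D.mem_roots.2 (D.root_root v))) (D.link_left (D.root v)))
  have hall : ∀ e x y, G.IsLink e x y → G.Joined (D.edges D.roots ∅ B) x y := by
    intro e x y hl
    by_cases hxy : x = y
    · rw [hxy]; exact Joined.rfl'
    obtain ⟨w | w | w, rfl⟩ := D.cover e x y hl hxy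
    · rcases hl.eq_and_eq_or_eq_and_eq (D.link_left w) with ⟨rfl, rfl⟩ | ⟨rfl, rfl⟩
      · exact (hcone _ 0).trans (hfoot _)
      · exact ((hcone _ 0).trans (hfoot _)).symm
    · rcases hl.eq_and_eq_or_eq_and_eq (D.link_mid w) with ⟨rfl, rfl⟩ | ⟨rfl, rfl⟩ <;>
        exact (hfoot _).symm.trans (hfoot _)
    · rcases hl.eq_and_eq_or_eq_and_eq (D.link_right w) with ⟨rfl, rfl⟩ | ⟨rfl, rfl⟩ <;>
        exact hcone _ _
  rw [Matroid.isBase_iff_maximal_indep]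
  refine ⟨h1.2 hne, fun J (hJ : G.IsForest J) hBJ e he => ?_⟩
  by_contra heB
  obtain ⟨x, y, hl⟩ := G.exists_isLink_of_mem_edgeSet (hJ.1 he)
  refine hJ.2 e he x y hl ((hall e x y hl).mono fun g hg => ⟨hBJ hg, ?_⟩)
  rintro rfl
  exact heB hg

theorem ncard_edges (S : Finset κ) (F : Finset η) (B : Finset ι) :
    (D.edges S F B).ncard = S.card + F.card + B.card := by
  rw [← coe_map_edge, Set.ncard_coe_finset, Finset.card_map, Finset.card_disjSum,
    Finset.card_disjSum, add_assoc]

theorem ncard_of_isBase {B : Finset ι} (hB : ∏ b ∈ B, Lab.pair (D.fst b) (D.snd b) = Lab.top)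
    (hc : B.card = 2) {I : Set β} (hI : G.graphicMatroid.IsBase I) : I.ncard = D.rank := by
  rw [hI.ncard_eq_ncard_of_isBase (D.isBase_roots hB), ncard_edges, Finset.card_empty, hc,
    card_roots]
  rfl

variable [Fintype η] [Fintype ι]

theorem exists_monomials [LinearOrder β] (hfin : G.edgeSet.Finite) {b : Bool} (hb : D.HasBase b)
    {B : Finset ι} (hB : ∏ b ∈ B, Lab.pair (D.fst b) (D.snd b) = Lab.top) (hc : B.card = 2) :
    ∃ X : Finset (Multiset (κ ⊕ η) × ℕ), (∀ p ∈ X, ∀ p', p' ≤ p → p' ∈ X) ∧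
      (∀ p p', Maximal (fun p => p ∈ X) p → Maximal (fun p => p ∈ X) p' →
        Multiset.card p.1 + p.2 = Multiset.card p'.1 + p'.2) ∧
      ∀ i, G.graphicMatroid.hVector i =
        (X.filter fun p => Multiset.card p.1 + p.2 = i).card := by
  classical
  obtain ⟨X, hX, hsum⟩ := exists_allowed D.star (D.starSet ∅) D.col (lt_of_zlab_ne_zero b)
  have hX' : (fun p => p ∈ X) = fun p => D.star.Allowed (D.starSet ∅) D.col (zlab b) p :=
    funext fun p => propext (hX p)
  refine ⟨X, fun p hp p' hle => (hX p').2 (((hX p).1 hp).mono (zlab_dvd b) hle), ?_, ?_⟩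
  · rw [hX']
    exact fun p p' => degree_eq_of_maximal
  have hE : G.graphicMatroid.E.Finite := hfin
  have hbase := fun I hI => D.ncard_of_isBase hB hc (I := I) hI
  refine Matroid.hVector_eq_of_sum hE D.rank hbase X _ fun t ht ht' => ?_
  rw [hsum t, D.sum_star_forests, D.sum_indeps hE fun m => t ^ m * (1 - t) ^ (D.rank - m)]
  refine Finset.sum_congr rfl fun F _ => ?_
  split_ifs with hF
  · rw [D.sum_forests_eq hb hF ht ht', card_starSet_sub]
    intro S B' hSB
    obtain ⟨I, hI, hsub⟩ := Matroid.Indep.exists_isBase_superset (M := G.graphicMatroid) hSB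
    rw [← hbase I hI, ← ncard_edges]
    exact Set.ncard_le_ncard hsub (hE.subset hI.subset_ground)
  · symm
    refine Finset.sum_eq_zero fun S _ => Finset.sum_eq_zero fun B' _ => if_neg fun h => hF ?_
    exact h.subset (D.edges_mono (Finset.empty_subset _) subset_rfl (Finset.empty_subset _))

end ConeModel

end Graph

/-! ### From multisets to exponent vectors -/

/-- A pure order ideal of monomials, written as a multiset of variables and a power of one more
variable, gives a pure O-sequence. -/
theorem isPureOSequence_of_multiset {γ : Type*} [Finite γ] {h : ℕ → ℕ}
    (X : Finset (Multiset γ × ℕ)) (hX : ∀ p ∈ X, ∀ p', p' ≤ p → p' ∈ X)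
    (hp : ∀ p p', Maximal (fun p => p ∈ X) p → Maximal (fun p => p ∈ X) p' →
        Multiset.card p.1 + p.2 = Multiset.card p'.1 + p'.2)
    (hh : ∀ i, h i = (X.filter fun p => Multiset.card p.1 + p.2 = i).card) :
    IsPureOSequence h := by
  classical
  have := Fintype.ofFinite γ
  -- The element `none` stands for the additional variable.
  let ε := Fintype.equivFin (Option γ)
  let φ : Multiset γ × ℕ → (Fin (Fintype.card (Option γ)) →₀ ℕ) := fun p =>
    Finsupp.equivFunOnFinite.symm fun j => (ε.symm j).elim p.2 fun x => p.1.count x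
  have hφ : ∀ p j, φ p j = (ε.symm j).elim p.2 fun x => p.1.count x := fun p j => rfl
  have hle : ∀ p p', φ p ≤ φ p' ↔ p ≤ p' := by
    intro p p'
    rw [Finsupp.le_def, Prod.le_def, Multiset.le_iff_count]
    constructor
    · intro hl
      refine ⟨fun x => ?_, ?_⟩
      · simpa [hφ] using hl (ε (some x))
      · simpa [hφ] using hl (ε none)
    · rintro ⟨h1, h2⟩ j
      rw [hφ, hφ]
      rcases ε.symm j with _ | x
      exacts [h2, h1 x]
  have hinj : Function.Injective φ := fun p p' he =>
    le_antisymm ((hle _ _).1 he.le) ((hle _ _).1 he.ge)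
  have hsurj : ∀ f, ∃ p, φ p = f := by
    intro f
    refine ⟨(∑ x : γ, f (ε (some x)) • {x}, f (ε none)), Finsupp.ext fun j => ?_⟩
    rw [hφ]
    obtain ⟨o, rfl⟩ := ε.surjective j
    rw [Equiv.symm_apply_apply]
    rcases o with _ | x
    · rfl
    · simp [Multiset.count_sum', Multiset.count_singleton]
  have hdeg : ∀ p, (φ p).degree = Multiset.card p.1 + p.2 := by
    intro p
    rw [Finsupp.degree_eq_sum, ← Equiv.sum_comp ε, Fintype.sum_option]
    simp only [hφ, Equiv.symm_apply_apply, Option.elim]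
    rw [Multiset.sum_count_eq_card (fun _ _ => Finset.mem_univ _), add_comm]
  have hmem : ∀ p, φ p ∈ X.map ⟨φ, hinj⟩ ↔ p ∈ X := fun p =>
    Finset.mem_map' ⟨φ, hinj⟩
  have hmax : ∀ p, Maximal (fun k => k ∈ X.map ⟨φ, hinj⟩) (φ p) → Maximal (fun p => p ∈ X) p :=
    fun p hm => ⟨(hmem p).1 hm.prop, fun p' hp' hl =>
      (hle _ _).1 (hm.le_of_ge ((hmem p').2 hp') ((hle _ _).2 hl))⟩
  refine ⟨_, X.map ⟨φ, hinj⟩, ?_, ?_, fun i => ?_⟩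
  · intro m hm m' hl
    obtain ⟨p, rfl⟩ := hsurj m
    obtain ⟨p', rfl⟩ := hsurj m'
    exact (hmem _).2 (hX p ((hmem p).1 hm) p' ((hle _ _).1 hl))
  · intro m m' hm hm'
    obtain ⟨p, rfl⟩ := hsurj m
    obtain ⟨p', rfl⟩ := hsurj m'
    rw [hdeg, hdeg]
    exact hp p p' (hmax p hm) (hmax p' hm')
  · rw [hh, Finset.filter_map, Finset.card_map]
    congr 1
    refine Finset.filter_congr fun p _ => ?_
    simp [hdeg]

/-! ### Construction of the model and conclusion -/

namespace Graph

variable {α β : Type*} {G : Graph α β} {c : Fin 3 → α}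

/-- The edges between a cone and another vertex. -/
abbrev ConeEdge (G : Graph α β) (c : Fin 3 → α) : Type _ :=
  {e : β // ∃ i w, G.IsLink e (c i) w ∧ ∀ j, w ≠ c j}

/-- The edges between two vertices that are not cones. -/
abbrev FarEdge (G : Graph α β) (c : Fin 3 → α) : Type _ :=
  {e : β // ∃ w w', G.IsLink e w w' ∧ (∀ j, w ≠ c j) ∧ ∀ j, w' ≠ c j}

/-- The adjacent pairs of cones, given by the third cone. -/
abbrev BaseEdge (G : Graph α β) (c : Fin 3 → α) : Type _ :=
  {k : Fin 3 // ∃ e, G.IsLink e (c (k + 1)) (c (k + 2))}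

/-- Every vertex that is not a cone is adjacent to a cone, so the ends of far edges can be named by
cone edges. Since no parallel edges meet a cone, one chosen edge for each adjacent pair of cones
covers all edges between distinct cones. -/
theorem exists_coneModel (hc : Function.Injective c)
    (hpar : ∀ i v, v ≠ c i → ∀ e f, G.IsLink e (c i) v → G.IsLink f (c i) v → e = f)
    (hadj : ∀ v ∈ G.vertexSet, (∀ j, v ≠ c j) → ∃ i e, G.IsLink e (c i) v) :
    ∃ D : G.ConeModel (G.ConeEdge c) (G.FarEdge c) (G.BaseEdge c),
      (∀ k, D.fst k = k.1 + 1) ∧ ∀ k, D.snd k = k.1 + 2 := by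
  choose col foot hlink hfoot using fun v : G.ConeEdge c => v.2
  choose w w' hww hw hw' using fun e : G.FarEdge c => e.2
  choose base hbase using fun k : G.BaseEdge c => k.2
  have hex : ∀ x ∈ G.vertexSet, (∀ j, x ≠ c j) → ∃ v, foot v = x := by
    intro x hx hxc
    obtain ⟨i, e, he⟩ := hadj x hx hxc
    refine ⟨⟨e, i, x, he, hxc⟩, ?_⟩
    rcases (hlink ⟨e, i, x, he, hxc⟩).eq_and_eq_or_eq_and_eq he with ⟨-, h⟩ | ⟨h, -⟩
    exacts [h, absurd h.symm (hxc _)]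
  choose src hsrc using fun e : G.FarEdge c => hex _ (hww e).left_mem (hw e)
  choose tgt htgt using fun e : G.FarEdge c => hex _ (hww e).right_mem (hw' e)
  have hthird : ∀ i j : Fin 3, i ≠ j → ∃ k : Fin 3, (k + 1 = i ∧ k + 2 = j) ∨
      (k + 1 = j ∧ k + 2 = i) := by decide
  refine ⟨{
    edge := Sum.elim Subtype.val (Sum.elim Subtype.val base)
    inj := ?_
    cone := c
    cone_inj := hc
    foot := foot
    col := col
    foot_ne := hfoot
    src := src
    tgt := tgt
    fst := fun k => k.1 + 1
    snd := fun k => k.1 + 2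
    link_left := hlink
    link_mid := fun e => by rw [hsrc, htgt]; exact hww e
    link_right := hbase
    cover := ?_ }, fun _ => rfl, fun _ => rfl⟩
  · refine Function.Injective.sumElim Subtype.val_injective
      (Function.Injective.sumElim Subtype.val_injective ?_ ?_) ?_
    · intro k k' h
      have hk := hbase k
      rw [h] at hk
      have key : ∀ k k' : Fin 3, (k + 1 = k' + 1 ∧ k + 2 = k' + 2) ∨
          (k + 1 = k' + 2 ∧ k + 2 = k' + 1) → k = k' := by decide
      refine Subtype.ext (key _ _ ?_)
      rcases hk.eq_and_eq_or_eq_and_eq (hbase k') with ⟨h1, h2⟩ | ⟨h1, h2⟩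
      exacts [Or.inl ⟨hc h1, hc h2⟩, Or.inr ⟨hc h1, hc h2⟩]
    · intro e k h
      have he := hww e
      rw [h] at he
      rcases he.eq_and_eq_or_eq_and_eq (hbase k) with ⟨h1, -⟩ | ⟨h1, -⟩ <;> exact hw e _ h1
    · rintro v (e | k) h
      · have hv := hlink v
        rw [show v.1 = e.1 from h] at hv
        rcases hv.eq_and_eq_or_eq_and_eq (hww e) with ⟨h1, -⟩ | ⟨h1, -⟩
        exacts [hw e _ h1.symm, hw' e _ h1.symm]
      · have hv := hlink v
        rw [show v.1 = base k from h] at hv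
        rcases hv.eq_and_eq_or_eq_and_eq (hbase k) with ⟨-, h1⟩ | ⟨-, h1⟩ <;> exact hfoot v _ h1
  · intro e x y hl hxy
    by_cases hx : ∃ i, c i = x
    · obtain ⟨i, rfl⟩ := hx
      by_cases hy : ∃ j, c j = y
      · obtain ⟨j, rfl⟩ := hy
        obtain ⟨k, ⟨rfl, rfl⟩ | ⟨rfl, rfl⟩⟩ := hthird i j fun h => hxy (h ▸ rfl)
        · exact ⟨Sum.inr (Sum.inr ⟨k, e, hl⟩), hpar _ _ hxy.symm _ _ (hbase ⟨k, e, hl⟩) hl⟩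
        · exact ⟨Sum.inr (Sum.inr ⟨k, e, hl.symm⟩),
            hpar _ _ hxy _ _ (hbase ⟨k, e, hl.symm⟩) hl.symm⟩
      · exact ⟨Sum.inl ⟨e, i, y, hl, fun j h => hy ⟨j, h.symm⟩⟩, rfl⟩
    · by_cases hy : ∃ j, c j = y
      · obtain ⟨j, rfl⟩ := hy
        exact ⟨Sum.inl ⟨e, j, x, hl.symm, fun j h => hx ⟨j, h.symm⟩⟩, rfl⟩
      · exact ⟨Sum.inr (Sum.inl ⟨e, x, y, hl, fun j h => hx ⟨j, h.symm⟩,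
          fun j h => hy ⟨j, h.symm⟩⟩), rfl⟩

variable {κ η : Type*} [Fintype (G.BaseEdge c)]

open Classical in
theorem ConeModel.hasBase (D : G.ConeModel κ η (G.BaseEdge c)) (hfst : ∀ k, D.fst k = k.1 + 1)
    (hsnd : ∀ k, D.snd k = k.1 + 2) (h1 : ∃ e, G.IsLink e (c (1 + 1)) (c (1 + 2)))
    (h2 : ∃ e, G.IsLink e (c (2 + 1)) (c (2 + 2))) :
    D.HasBase (decide (∃ e, G.IsLink e (c (0 + 1)) (c (0 + 2)))) := by
  intro s
  have hs : ∀ k : Fin 3, k ∈ (if ∃ e, G.IsLink e (c (0 + 1)) (c (0 + 2)) then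
      Finset.univ else {1, 2}) ↔ ∃ e, G.IsLink e (c (k + 1)) (c (k + 2)) := by
    intro k
    split_ifs with h <;> fin_cases k
    · simpa using h
    · simpa using h1
    · simpa using h2
    · simpa using h
    · simpa using h1
    · simpa using h2
  simp only [hfst, hsnd]
  rw [← Finset.prod_subtype _ hs fun k => 1 + Tri.C s * Tri.ofLab (Lab.pair (k + 1) (k + 2))]
  have e0 : Lab.pair (0 + 1) (0 + 2) = Lab.x12 := by decide
  have e1 : Lab.pair (1 + 1) (1 + 2) = Lab.x02 := by decide
  have e2 : Lab.pair (2 + 1) (2 + 2) = Lab.x01 := by decide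
  by_cases h : ∃ e, G.IsLink e (c (0 + 1)) (c (0 + 2))
  · rw [if_pos h, decide_eq_true h, if_pos rfl, Fin.prod_univ_three, e0, e1, e2]
    ring
  · rw [if_neg h, decide_eq_false h, if_neg Bool.false_ne_true,
      Finset.prod_pair (by decide), e1, e2]
    ring

end Graph

theorem mainTheorem1 {α β : Type*} [LinearOrder β] (G : Graph α β)
    (hfin : G.edgeSet.Finite) (hG : G.IsTriconed) :
    IsPureOSequence G.graphicMatroid.hVector := by
  classical
  obtain ⟨c₀, c₁, c₂, h01, h02, h12, ⟨e₁, he₁⟩, ⟨e₂, he₂⟩, hpar, hadj⟩ := hG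
  let c : Fin 3 → α := ![c₀, c₁, c₂]
  have hci : ∀ i, c i = c₀ ∨ c i = c₁ ∨ c i = c₂ := by
    intro i; fin_cases i <;> simp [c]
  have hc : Function.Injective c := by
    intro i j h
    fin_cases i <;> fin_cases j <;> simp_all [c, eq_comm]
  obtain ⟨D, hfst, hsnd⟩ := Graph.exists_coneModel (G := G) hc
    (fun i v hv e f he hf => hpar _ (hci i) v hv e f he hf) (fun v hv hvc => by
      rcases hadj v hv (hvc 0) (hvc 1) (hvc 2) with ⟨e, he⟩ | ⟨e, he⟩ | ⟨e, he⟩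
      exacts [⟨0, e, he⟩, ⟨1, e, he⟩, ⟨2, e, he⟩])
  have : Finite G.edgeSet := hfin.to_subtype
  have hκ : Finite (G.ConeEdge c) := Finite.of_injective
    (fun e => (⟨e.1, e.2.choose_spec.choose_spec.1.edge_mem⟩ : G.edgeSet))
    fun e f h => Subtype.ext (Subtype.mk.inj h)
  have hη : Finite (G.FarEdge c) := Finite.of_injective
    (fun e => (⟨e.1, e.2.choose_spec.choose_spec.1.edge_mem⟩ : G.edgeSet))
    fun e f h => Subtype.ext (Subtype.mk.inj h)
  have := Fintype.ofFinite (G.ConeEdge c)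
  have := Fintype.ofFinite (G.FarEdge c)
  have := Fintype.ofFinite (G.BaseEdge c)
  -- Indices are taken modulo 3: index 1 stands for the cones 2 and 0, and index 2 for the cones 0
  -- and 1. Index 0, for the cones 1 and 2, may be absent and decides about the extra variable.
  have h1 : ∃ e, G.IsLink e (c (1 + 1)) (c (1 + 2)) := ⟨e₂, he₂.symm⟩
  have h2 : ∃ e, G.IsLink e (c (2 + 1)) (c (2 + 2)) := ⟨e₁, he₁⟩
  have hne : (⟨1, h1⟩ : G.BaseEdge c) ≠ ⟨2, h2⟩ := fun h =>
    absurd (congrArg Subtype.val h) (by decide : (1 : Fin 3) ≠ 2)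
  obtain ⟨X, hX, hp, hh⟩ := D.exists_monomials hfin (D.hasBase hfst hsnd h1 h2)
    (B := {⟨1, h1⟩, ⟨2, h2⟩}) (by
      rw [Finset.prod_pair hne, hfst, hsnd, hfst, hsnd]
      exact (by decide : Lab.pair (1 + 1) (1 + 2) * Lab.pair (2 + 1) (2 + 2) = Lab.top)) (Finset.card_pair hne)
  exact isPureOSequence_of_multiset X hX hp hh
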